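/- Conventions. Manifolds are smooth, Hausdorff, finite-dimensional and without boundary. A Lie groupoid $G\rightrightarrows M$ has source and target $s,t:G\to M$ (surjective submersions), and the product $m(g,h)=gh$ is defined on $G^{(2)}=\{(g,h): s(g)=t(h)\}$; it is compact if $G$ is compact. The orbit of $x\in M$ is $t(s^{-1}(x))$. A contact form on $G$ is a pointwise surjective $\alpha\in\Omega^1(G)$ such that $d\alpha$ is nondegenerate on $\ker\alpha$. For a Lie groupoid homomorphism $F:G\to\mathbb R^*$, a form $\alpha\in\Omega^1(G)$ is $F$-multiplicative if $m^*\alpha=\mathrm{pr}_1^*\alpha+\mathrm{pr}_1^*(F)\,\mathrm{pr}_2^*\alpha$ on $G^{(2)}$; if moreover $\alpha$ is a contact form, $(G,\alpha,F)$ is a co-oriented contact groupoid. Let $I\subseteq\mathbb R$ be an open interval containing $0$; write $i_\tau(x)=(x,\tau)$, let $\mathrm{pr}:G\times I\to G$ be the projection, and let $G\times I\rightrightarrows M\times I$ be the constant deformation of $G$, i.e. the Lie groupoid with fibre $G\rightrightarrows M$ over every $\tau\in I$. Theorem 3.3. Let $(G,\alpha,\sigma)$ be a compact co-oriented contact groupoid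 over $M$, where $\sigma:G\to\{\pm1\}$ is a Lie groupoid homomorphism. Let $(G\times I,\tilde\alpha,\mathrm{pr}^*\sigma)=\{(G,\alpha_\tau,\sigma)\}_{\tau\in I}$ be a deformation of $(G,\alpha,\sigma)$, that is, $\tilde\alpha\in\Omega^1(G\times I)$ is a pointwise surjective, $\mathrm{pr}^*\sigma$-multiplicative 1-form on $G\times I$ such that, with $\alpha_\tau:=i_\tau^*\tilde\alpha$, each $(G,\alpha_\tau,\sigma)$ is a co-oriented contact groupoid, $\{0_g\}\oplus T_\tau I\subset\ker\tilde\alpha_{(g,\tau)}$ for all $(g,\tau)\in G\times I$, and $\alpha_0=\alpha$. Then there exist (i) a Lie groupoid automorphism $\tilde\Phi$ of $G\times I$ of the form $\tilde\Phi(g,\tau)=(\Phi_\tau(g),\tau)$ with $\Phi_0=\mathrm{id}_G$, and (ii) a function $\tilde f\in C^\infty(M\times I)$ that is constant along the orbits of $G\times I$, such that $\Phi_\tau^*\alpha_\tau=e^{t^*f_\tau}\,\alpha$ for all $\tau\in I$, where $f_\tau=i_\tau^*\tilde f$. -/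

import Mathlib

open scoped Manifold ContDiff
open Set

noncomputable section

namespace ContactGpd

/-! ### Differential 1-forms -/

section Forms

variable {E H N E' H' N' : Type*}
  [NormedAddCommGroup E] [NormedSpace ℝ E] [TopologicalSpace H]
  [TopologicalSpace N] [ChartedSpace H N]
  [NormedAddCommGroup E'] [NormedSpace ℝ E'] [TopologicalSpace H']
  [TopologicalSpace N'] [ChartedSpace H' N']

/-- A (not necessarily smooth) real-valued 1-form on a manifold `N` modelled on `I`. -/
abbrev Form1 (I : ModelWithCorners ℝ E H) (N : Type*) [TopologicalSpace N] [ChartedSpace H N] :=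
  (x : N) → (TangentSpace I x →L[ℝ] ℝ)

/-- A 1-form is smooth if it is a smooth section of the cotangent bundle `Hom(TN, ℝ)`. -/
def Form1.IsSmooth {I : ModelWithCorners ℝ E H} [IsManifold I ∞ N] (η : Form1 I N) : Prop :=
  ContMDiff I (I.prod 𝓘(ℝ, E →L[ℝ] ℝ)) ∞
    (fun x ↦ Bundle.TotalSpace.mk' (E →L[ℝ] ℝ)
      (E := fun x : N ↦ (TangentSpace I x →L[ℝ] ℝ)) x (η x))

/-- The pullback `Φ^*η` of a 1-form along a map. -/
def Form1.pullback {I : ModelWithCorners ℝ E H} {I' : ModelWithCorners ℝ E' H'}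
    (Φ : N → N') (η : Form1 I' N') : Form1 I N :=
  fun x ↦ (η (Φ x)).comp (mfderiv I I' Φ x)

/-- The coordinate expression of a 1-form in the preferred chart at `x₀`: the pullback of the form
along the inverse of the chart. -/
def Form1.inChart {I : ModelWithCorners ℝ E H} (η : Form1 I N) (x₀ : N) : E → (E →L[ℝ] ℝ) :=
  fun y ↦ (η ((extChartAt I x₀).symm y)).comp
    (mfderivWithin 𝓘(ℝ, E) I (extChartAt I x₀).symm (range I) y)

/-- The exterior derivative `dη` of a 1-form, evaluated at `x` on `v, w ∈ T_x N`. It is computed in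
the preferred chart at `x`; the differential of that chart at `x` is the identification of `T_x N`
with the model space. -/
def Form1.d {I : ModelWithCorners ℝ E H} (η : Form1 I N) (x : N) (v w : TangentSpace I x) : ℝ :=
  extDerivWithin
    (fun y ↦ ContinuousAlternatingMap.ofSubsingleton ℝ E ℝ (0 : Fin 1) (Form1.inChart η x y))
    (range I) (extChartAt I x x)
    ![mfderiv I 𝓘(ℝ, E) (extChartAt I x) x v, mfderiv I 𝓘(ℝ, E) (extChartAt I x) x w]

/-- A contact form: a smooth, pointwise surjective 1-form `α` such that `dα` is
nondegenerate on the hyperplane distribution `ker α`. -/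
structure Form1.IsContact {I : ModelWithCorners ℝ E H} [IsManifold I ∞ N] (α : Form1 I N) :
    Prop where
  smooth : Form1.IsSmooth α
  surjective : ∀ x, Function.Surjective (α x)
  nondegenerate : ∀ (x : N) (v : TangentSpace I x), α x v = 0 →
    (∀ w : TangentSpace I x, α x w = 0 → Form1.d α x v w = 0) → v = 0

end Forms

/-! ### Lie groupoids -/

section Groupoids

variable {EG HG EM HM : Type*}
  [NormedAddCommGroup EG] [NormedSpace ℝ EG] [TopologicalSpace HG]
  [NormedAddCommGroup EM] [NormedSpace ℝ EM] [TopologicalSpace HM]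

/-- A Lie groupoid `G ⇉ M`. The product `mul g h` is only meaningful for composable pairs, i.e. if
`src g = tgt h`: all the axioms, and smoothness, only concern such pairs. Since the set of
composable pairs is an embedded submanifold of `G × G`, smoothness of the multiplication on this
submanifold is the same as `ContMDiffOn`. -/
structure LieGroupoid (IG : ModelWithCorners ℝ EG HG) (IM : ModelWithCorners ℝ EM HM)
    (G M : Type*) [TopologicalSpace G] [ChartedSpace HG G]
    [TopologicalSpace M] [ChartedSpace HM M] where
  src : G → M
  tgt : G → M
  unit : M → G
  mul : G → G → G
  inv : G → G
  src_unit : ∀ x, src (unit x) = x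
  tgt_unit : ∀ x, tgt (unit x) = x
  src_mul : ∀ g h, src g = tgt h → src (mul g h) = src h
  tgt_mul : ∀ g h, src g = tgt h → tgt (mul g h) = tgt g
  mul_assoc : ∀ g h k, src g = tgt h → src h = tgt k → mul (mul g h) k = mul g (mul h k)
  unit_mul : ∀ g, mul (unit (tgt g)) g = g
  mul_unit : ∀ g, mul g (unit (src g)) = g
  src_inv : ∀ g, src (inv g) = tgt g
  tgt_inv : ∀ g, tgt (inv g) = src g
  inv_mul : ∀ g, mul (inv g) g = unit (src g)
  mul_inv : ∀ g, mul g (inv g) = unit (tgt g)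
  smooth_src : ContMDiff IG IM ∞ src
  smooth_tgt : ContMDiff IG IM ∞ tgt
  /-- the source map is a submersion -/
  submersion_src : ∀ g, Function.Surjective (mfderiv IG IM src g)
  /-- the target map is a submersion -/
  submersion_tgt : ∀ g, Function.Surjective (mfderiv IG IM tgt g)
  smooth_unit : ContMDiff IM IG ∞ unit
  smooth_inv : ContMDiff IG IG ∞ inv
  smooth_mul : ContMDiffOn (IG.prod IG) IG ∞ (fun p : G × G ↦ mul p.1 p.2)
    {p : G × G | src p.1 = tgt p.2}

namespace LieGroupoid

variable {IG : ModelWithCorners ℝ EG HG} {IM : ModelWithCorners ℝ EM HM}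
  {G M : Type*} [TopologicalSpace G] [ChartedSpace HG G]
  [TopologicalSpace M] [ChartedSpace HM M]

/-- The set of composable pairs. -/
def composable (𝒢 : LieGroupoid IG IM G M) : Set (G × G) := {p | 𝒢.src p.1 = 𝒢.tgt p.2}

/-- The orbit `t (s⁻¹ (x))` of a point of the base. -/
def orbit (𝒢 : LieGroupoid IG IM G M) (x : M) : Set M := 𝒢.tgt '' (𝒢.src ⁻¹' {x})

/-- A function on the base which is constant along the orbits. -/
def ConstOnOrbits (𝒢 : LieGroupoid IG IM G M) (f : M → ℝ) : Prop :=
  ∀ x, ∀ y ∈ 𝒢.orbit x, f y = f x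

/-- The tangent multiplication `dm (X, Y)`, for `X ∈ T_g G` and `Y ∈ T_h G`. It is meaningful for
vectors with `ds X = dt Y`; these are the vectors tangent to the submanifold of composable
pairs, and on them any derivative of `m` within this submanifold takes the same value. -/
def tangentMul (𝒢 : LieGroupoid IG IM G M) (g h : G) (X : TangentSpace IG g)
    (Y : TangentSpace IG h) : TangentSpace IG (𝒢.mul g h) :=
  mfderivWithin (IG.prod IG) IG (fun p : G × G ↦ 𝒢.mul p.1 p.2) 𝒢.composable (g, h)
    ((X, Y) : EG × EG)

/-- A Lie groupoid homomorphism from `G` to the multiplicative group `ℝ^*`. -/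
structure IsCharacter (𝒢 : LieGroupoid IG IM G M) (F : G → ℝ) : Prop where
  smooth : ContMDiff IG 𝓘(ℝ, ℝ) ∞ F
  ne_zero : ∀ g, F g ≠ 0
  map_mul : ∀ g h, 𝒢.src g = 𝒢.tgt h → F (𝒢.mul g h) = F g * F h

/-- A 1-form `α` on `G` is `F`-multiplicative if `m^* α = pr₁^* α + (pr₁^* F) pr₂^* α` on the
manifold of composable pairs. -/
def IsMultiplicative (𝒢 : LieGroupoid IG IM G M) (α : Form1 IG G) (F : G → ℝ) : Prop :=
  ∀ g h, 𝒢.src g = 𝒢.tgt h → ∀ (X : TangentSpace IG g) (Y : TangentSpace IG h),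
    (mfderiv IG IM 𝒢.src g X : EM) = (mfderiv IG IM 𝒢.tgt h Y : EM) →
    α (𝒢.mul g h) (𝒢.tangentMul g h X Y) = α g X + F g * α h Y

/-- `(G, α, F)` is a co-oriented contact groupoid. -/
structure IsCoOrientedContact [IsManifold IG ∞ G] (𝒢 : LieGroupoid IG IM G M)
    (α : Form1 IG G) (F : G → ℝ) : Prop where
  isContact : Form1.IsContact α
  isCharacter : 𝒢.IsCharacter F
  isMultiplicative : 𝒢.IsMultiplicative α F

/-- An automorphism of a Lie groupoid: a diffeomorphism of the arrows, covering a diffeomorphism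
of the base and compatible with the source, the target and the multiplication (hence with units
and inverses, and so is its inverse). -/
structure Aut (𝒢 : LieGroupoid IG IM G M) where
  arrows : G ≃ₘ^∞⟮IG, IG⟯ G
  base : M ≃ₘ^∞⟮IM, IM⟯ M
  map_src : ∀ g, 𝒢.src (arrows g) = base (𝒢.src g)
  map_tgt : ∀ g, 𝒢.tgt (arrows g) = base (𝒢.tgt g)
  map_mul : ∀ g h, 𝒢.src g = 𝒢.tgt h → arrows (𝒢.mul g h) = 𝒢.mul (arrows g) (arrows h)

/-! ### Constant deformations -/

theorem surjective_mfderiv_prodMap_id {f : G → M} (hf : ContMDiff IG IM ∞ f)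
    (hs : ∀ g, Function.Surjective (mfderiv IG IM f g)) (I : TopologicalSpace.Opens ℝ)
    (p : G × I) :
    Function.Surjective (mfderiv (IG.prod 𝓘(ℝ, ℝ)) (IM.prod 𝓘(ℝ, ℝ))
      (Prod.map f (id : I → I)) p) := by
  have h1 : MDifferentiableAt IG IM f p.1 := hf.mdifferentiable (by simp) p.1
  have h2 : MDifferentiableAt 𝓘(ℝ, ℝ) 𝓘(ℝ, ℝ) (id : I → I) p.2 := mdifferentiableAt_id
  rw [mfderiv_prodMap h1 h2, mfderiv_id]
  rintro ⟨a, b⟩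
  obtain ⟨v, hv⟩ := hs p.1 a
  exact ⟨(v, b), Prod.ext hv rfl⟩

/-- The constant deformation `G × I ⇉ M × I` of `G ⇉ M`, over an open set `I ⊆ ℝ`. -/
def const (𝒢 : LieGroupoid IG IM G M) (I : TopologicalSpace.Opens ℝ) :
    LieGroupoid (IG.prod 𝓘(ℝ, ℝ)) (IM.prod 𝓘(ℝ, ℝ)) (G × I) (M × I) where
  src := Prod.map 𝒢.src id
  tgt := Prod.map 𝒢.tgt id
  unit := Prod.map 𝒢.unit id
  mul p q := (𝒢.mul p.1 q.1, p.2)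
  inv := Prod.map 𝒢.inv id
  src_unit x := Prod.ext (𝒢.src_unit _) rfl
  tgt_unit x := Prod.ext (𝒢.tgt_unit _) rfl
  src_mul p q h := Prod.ext (𝒢.src_mul _ _ (congrArg Prod.fst h))
    (show p.2 = q.2 from congrArg (fun x : M × I ↦ x.2) h)
  tgt_mul p q h := Prod.ext (𝒢.tgt_mul _ _ (congrArg Prod.fst h)) rfl
  mul_assoc p q r h k :=
    Prod.ext (𝒢.mul_assoc _ _ _ (congrArg Prod.fst h) (congrArg Prod.fst k)) rfl
  unit_mul p := Prod.ext (𝒢.unit_mul _) rfl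
  mul_unit p := Prod.ext (𝒢.mul_unit _) rfl
  src_inv p := Prod.ext (𝒢.src_inv _) rfl
  tgt_inv p := Prod.ext (𝒢.tgt_inv _) rfl
  inv_mul p := Prod.ext (𝒢.inv_mul _) rfl
  mul_inv p := Prod.ext (𝒢.mul_inv _) rfl
  smooth_src := 𝒢.smooth_src.prodMap contMDiff_id
  smooth_tgt := 𝒢.smooth_tgt.prodMap contMDiff_id
  submersion_src := surjective_mfderiv_prodMap_id 𝒢.smooth_src 𝒢.submersion_src I
  submersion_tgt := surjective_mfderiv_prodMap_id 𝒢.smooth_tgt 𝒢.submersion_tgt I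
  smooth_unit := 𝒢.smooth_unit.prodMap contMDiff_id
  smooth_inv := 𝒢.smooth_inv.prodMap contMDiff_id
  smooth_mul := by
    refine ContMDiffOn.prodMk ?_ (contMDiff_snd.comp contMDiff_fst).contMDiffOn
    exact 𝒢.smooth_mul.comp
      ((contMDiff_fst.comp contMDiff_fst).prodMk (contMDiff_fst.comp contMDiff_snd)).contMDiffOn
      (fun p hp ↦ congrArg Prod.fst hp)

/-- The inclusion `i_τ : N → N × I`, `i_τ(x) = (x, τ)`, of the fibre over `τ`. -/
def incl (N : Type*) {I : TopologicalSpace.Opens ℝ} (τ : I) : N → N × I := fun x ↦ (x, τ)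

/-- `(G × I, α', F')`, where `G × I` is the constant deformation of `G`, is a deformation of the
co-oriented contact groupoid `(G, α, F)`. -/
structure IsDeformation [IsManifold IG ∞ G] (𝒢 : LieGroupoid IG IM G M)
    (α : Form1 IG G) (F : G → ℝ) (I : TopologicalSpace.Opens ℝ) (h0 : (0 : ℝ) ∈ I)
    (α' : Form1 (IG.prod 𝓘(ℝ, ℝ)) (G × I)) (F' : G × I → ℝ) : Prop where
  smooth : Form1.IsSmooth α'
  surjective : ∀ p, Function.Surjective (α' p)
  isCharacter : (𝒢.const I).IsCharacter F'
  isMultiplicative : (𝒢.const I).IsMultiplicative α' F'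
  /-- each fibre is a co-oriented contact groupoid -/
  fibre : ∀ τ : I, 𝒢.IsCoOrientedContact (Form1.pullback (incl G τ) α') (F' ∘ incl G τ)
  /-- `0 ⊕ TI` is contained in the kernel of `α'` -/
  vertical : ∀ (p : G × I) (v : TangentSpace (IG.prod 𝓘(ℝ, ℝ)) p),
    mfderiv (IG.prod 𝓘(ℝ, ℝ)) IG (Prod.fst : G × I → G) p v = 0 → α' p v = 0
  form_zero : Form1.pullback (incl G ⟨0, h0⟩) α' = α
  char_zero : F' ∘ incl G ⟨0, h0⟩ = F

/-- An automorphism of the constant deformation `G × I`: an automorphism of the Lie groupoid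
`G × I` of the form `(g, τ) ↦ (Φ_τ g, τ)`, with `Φ_0 = id`. -/
structure ConstAut (𝒢 : LieGroupoid IG IM G M) (I : TopologicalSpace.Opens ℝ)
    (h0 : (0 : ℝ) ∈ I) extends Aut (𝒢.const I) where
  snd_arrows : ∀ p, (arrows p).2 = p.2
  arrows_zero : ∀ g, arrows (g, ⟨0, h0⟩) = (g, ⟨0, h0⟩)

/-- The member `Φ_τ : G → G` of an automorphism of the constant deformation. -/
def ConstAut.at {𝒢 : LieGroupoid IG IM G M} {I : TopologicalSpace.Opens ℝ}
    {h0 : (0 : ℝ) ∈ I} (Φ : 𝒢.ConstAut I h0) (τ : I) : G → G :=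
  fun g ↦ (Φ.arrows (g, τ)).1

end LieGroupoid

end Groupoids

end ContactGpd

end

open Filter Topology

namespace ContactGpd

/-! ### Smooth local flows in Banach spaces -/

section LocalFlow

/-! This is Gray's stability argument, run so that every object stays multiplicative. Write α_t for
the fibre forms, α̇_t for their time derivative and R_t for the Reeb field. Let X_t be the field in
ker α_t with dα_t(X_t, ·) = -α̇_t on ker α_t; splitting off the Reeb direction gives dα_t(X_t, ·) =
-α̇_t + α̇_t(R_t) α_t everywhere. By Cartan's formula the pullback of α_t along the flow Φ_t of X
satisfies a scalar linear ODE at each tangent vector, so Φ_t^*α_t = exp(∫₀ᵗ α̇_s(R_s)∘Φ_s ds) α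
(`IsGrayIsotopy.pullback_eq`). Compactness of G lets the flow exist on all of I
(`isSolvableOn_of_compactSpace`).

It remains to see that Φ_t is a groupoid automorphism and that the exponent descends to M. Since σ
does not depend on time, α̇_t is σ-multiplicative; since σ = ±1 is locally constant, dα_t is
σ-multiplicative as well (`IsMult.dform_dm`). Hence the unit space is isotropic, ker ds and ker dt
are dα_t-orthogonal, and the two resulting dimension counts give dim G = 2 dim M + 1. So the tangent
space of the units is maximal isotropic in ker α_t, and a vector lies in ker dt as soon as it is
dα_t-orthogonal to ker ds ∩ ker α_t (likewise with s and t exchanged). The first fact makes X_t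
tangent to the units, the second shows that s and t project X_t to the same field on M; then X_t is
multiplicative (`IsContactMult.isGrayAt_dm`), products of integral curves are integral curves, and
uniqueness gives Φ_t(gh) = Φ_t(g)Φ_t(h).

The Reeb field is right invariant, and left invariant up to the sign σ. Therefore α̇_t(R_t) takes
the same value at g and at the units at both ends of g. After integration the exponent is a function
of t(g), constant along orbits.

Smooth dependence of flows is built from Picard–Lindelöf: the derivative of a flow is part of the
flow of the prolonged field, so regularity climbs one order at a time. -/

theorem norm_le_gronwallBound_abs {E : Type*} [NormedAddCommGroup E] [NormedSpace ℝ E]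
    {e e' : ℝ → E} {K η ε : ℝ}
    (he : ∀ s ∈ Ioo (-ε) ε, HasDerivAt e (e' s) s)
    (hb : ∀ s ∈ Ioo (-ε) ε, ‖e' s‖ ≤ K * ‖e s‖ + η) :
    ∀ t ∈ Ioo (-ε) ε, ‖e t‖ ≤ gronwallBound ‖e 0‖ K η |t| := by
  have key : ∀ (f f' : ℝ → E), (∀ s ∈ Ioo (-ε) ε, HasDerivAt f (f' s) s) →
      (∀ s ∈ Ioo (-ε) ε, ‖f' s‖ ≤ K * ‖f s‖ + η) → ∀ t, 0 ≤ t → t < ε →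
      ‖f t‖ ≤ gronwallBound ‖f 0‖ K η t := by
    intro f f' h1 h2 t ht0 htε
    have hsub : Icc 0 t ⊆ Ioo (-ε) ε := fun s hs ↦ ⟨by linarith [hs.1], by linarith [hs.2]⟩
    have := norm_le_gronwallBound_of_norm_deriv_right_le (f := f) (f' := f') (δ := ‖f 0‖)
      (K := K) (ε := η) (a := 0) (b := t)
      (fun s hs ↦ (h1 s (hsub hs)).continuousAt.continuousWithinAt)
      (fun s hs ↦ (h1 s (hsub (Ico_subset_Icc_self hs))).hasDerivWithinAt) le_rfl
      (fun s hs ↦ h2 s (hsub (Ico_subset_Icc_self hs))) t ⟨ht0, le_rfl⟩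
    simpa using this
  intro t ht
  rcases le_total 0 t with h | h
  · rw [abs_of_nonneg h]
    exact key e e' he hb t h ht.2
  · rw [abs_of_nonpos h]
    have := key (fun s ↦ e (-s)) (fun s ↦ -e' (-s)) (fun s hs ↦ by
        have := (he (-s) ⟨by linarith [hs.2], by linarith [hs.1]⟩).scomp s (hasDerivAt_neg s)
        simpa [Function.comp_def] using this)
      (fun s hs ↦ by
        rw [norm_neg]
        exact hb (-s) ⟨by linarith [hs.2], by linarith [hs.1]⟩) (-t) (by linarith)
      (by linarith [ht.1])
    simpa using this

/-- The vector field whose flow is the flow of `v` together with its derivative. -/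
noncomputable def prolongation {E : Type*} [NormedAddCommGroup E] [NormedSpace ℝ E] (v : E → E) :
    E × (E →L[ℝ] E) → E × (E →L[ℝ] E) :=
  fun p ↦ (v p.1, (fderiv ℝ v p.1).comp p.2)

/-- Prolonging costs one derivative, which is harmless in class C^∞; this is what lets the induction
on regularity keep its hypothesis unchanged. -/
theorem contDiffOn_prolongation {E : Type*} [NormedAddCommGroup E] [NormedSpace ℝ E]
    {v : E → E} {W : Set E} (hW : IsOpen W) (hv : ContDiffOn ℝ ∞ v W) :
    ContDiffOn ℝ ∞ (prolongation v) (W ×ˢ univ) := by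
  have h1 : ContDiffOn ℝ ∞ (fderiv ℝ v) W := ((contDiffOn_infty_iff_fderiv_of_isOpen hW).1 hv).2
  have hm : MapsTo (Prod.fst : E × (E →L[ℝ] E) → E) (W ×ˢ univ) W := fun p hp ↦ hp.1
  exact (hv.comp contDiffOn_fst hm).prodMk ((h1.comp contDiffOn_fst hm).clm_comp contDiffOn_snd)

/-- Mean value inequality on the segment from x to y, where the derivative of v differs from its
value at x by at most C‖y - x‖. It supplies the quadratic error in the variational equation. -/
theorem norm_sub_sub_le_sq {E F : Type*} [NormedAddCommGroup E] [NormedSpace ℝ E]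
    [NormedAddCommGroup F] [NormedSpace ℝ F]
    {v : E → F} {B : Set E} (hB : Convex ℝ B) {C : ℝ} (hC : 0 ≤ C)
    (hd : ∀ x ∈ B, DifferentiableAt ℝ v x)
    (hL : ∀ x ∈ B, ∀ y ∈ B, ‖fderiv ℝ v x - fderiv ℝ v y‖ ≤ C * ‖x - y‖)
    {x y : E} (hx : x ∈ B) (hy : y ∈ B) :
    ‖v y - v x - fderiv ℝ v x (y - x)‖ ≤ C * ‖y - x‖ ^ 2 := by
  have hs : segment ℝ x y ⊆ B := hB.segment_subset hx hy
  have := (convex_segment x y).norm_image_sub_le_of_norm_hasFDerivWithin_le' (f := v)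
    (f' := fderiv ℝ v) (φ := fderiv ℝ v x) (C := C * ‖y - x‖) (x := x) (y := y)
    (fun z hz ↦ (hd z (hs hz)).hasFDerivAt.hasFDerivWithinAt)
    (fun z hz ↦ (hL z (hs hz) x hx).trans (by
      gcongr
      obtain ⟨a, b, ha, hb, hab, rfl⟩ := hz
      have : a • x + b • y - x = b • (y - x) := by
        rw [show a = 1 - b by linarith]; module
      rw [this, norm_smul, Real.norm_of_nonneg hb]
      exact mul_le_of_le_one_left (norm_nonneg _) (by linarith)))
    (left_mem_segment _ _ _) (right_mem_segment _ _ _)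
  linarith [this, show C * ‖y - x‖ * ‖y - x‖ = C * ‖y - x‖ ^ 2 by ring]

/-- A solution of the variational equation is the derivative of the flow. -/
theorem hasFDerivAt_flow {E : Type*} [NormedAddCommGroup E] [NormedSpace ℝ E]
    {v : E → E} {B U : Set E} (hB : Convex ℝ B) (hU : IsOpen U) {C K ε : ℝ} (hC : 0 ≤ C)
    (hK : 0 < K)
    (hd : ∀ x ∈ B, DifferentiableAt ℝ v x)
    (hL : ∀ x ∈ B, ∀ y ∈ B, ‖fderiv ℝ v x - fderiv ℝ v y‖ ≤ C * ‖x - y‖)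
    (hbd : ∀ x ∈ B, ‖fderiv ℝ v x‖ ≤ K)
    {φ : ℝ → E → E} {A : ℝ → E → (E →L[ℝ] E)}
    (hφ0 : ∀ x ∈ U, φ 0 x = x) (hA0 : ∀ x ∈ U, A 0 x = ContinuousLinearMap.id ℝ E)
    (hφB : ∀ t ∈ Ioo (-ε) ε, ∀ x ∈ U, φ t x ∈ B)
    (hφ : ∀ t ∈ Ioo (-ε) ε, ∀ x ∈ U, HasDerivAt (fun s ↦ φ s x) (v (φ t x)) t)
    (hA : ∀ t ∈ Ioo (-ε) ε, ∀ x ∈ U,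
      HasDerivAt (fun s ↦ A s x) ((fderiv ℝ v (φ t x)).comp (A t x)) t)
    {t : ℝ} (ht : t ∈ Ioo (-ε) ε) {x : E} (hx : x ∈ U) :
    HasFDerivAt (φ t) (A t x) x := by
  have hLip : ∀ y ∈ B, ∀ z ∈ B, ‖v z - v y‖ ≤ K * ‖z - y‖ := fun y hy z hz ↦
    hB.norm_image_sub_le_of_norm_fderiv_le hd hbd hy hz
  set D := Real.exp (K * ε) with hD
  have hD0 : 0 < D := Real.exp_pos _
  have habs : ∀ s ∈ Ioo (-ε) ε, Real.exp (K * |s|) ≤ D := fun s hs ↦ by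
    rw [hD]; gcongr; exact (abs_lt.2 hs).le
  -- Lipschitz dependence on the initial value, with a constant uniform in time.
  have h1 : ∀ y ∈ U, ∀ s ∈ Ioo (-ε) ε, ‖φ s y - φ s x‖ ≤ ‖y - x‖ * D := by
    intro y hy s hs
    have := norm_le_gronwallBound_abs (e := fun s ↦ φ s y - φ s x)
      (e' := fun s ↦ v (φ s y) - v (φ s x)) (K := K) (η := 0) (ε := ε)
      (fun s hs ↦ (hφ s hs y hy).sub (hφ s hs x hx))
      (fun s hs ↦ by simpa using hLip _ (hφB s hs x hx) _ (hφB s hs y hy)) s hs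
    rw [gronwallBound_ε0, hφ0 y hy, hφ0 x hx] at this
    exact this.trans (by gcongr; exact habs s hs)
  -- The defect φ_s y - φ_s x - A_s(y - x) starts at 0 and solves the linearised equation up to a
  -- forcing term that is quadratic in ‖y - x‖ by `h1`, so Grönwall keeps it quadratic.
  have h2 : ∀ y ∈ U, ‖φ t y - φ t x - A t x (y - x)‖ ≤ (C * D ^ 2 / K * D) * ‖y - x‖ ^ 2 := by
    intro y hy
    have := norm_le_gronwallBound_abs (e := fun s ↦ φ s y - φ s x - A s x (y - x))
      (e' := fun s ↦ v (φ s y) - v (φ s x) - (fderiv ℝ v (φ s x)) (A s x (y - x)))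
      (K := K) (η := C * (‖y - x‖ * D) ^ 2) (ε := ε)
      (fun s hs ↦ ((hφ s hs y hy).sub (hφ s hs x hx)).sub (by
        have := (hA s hs x hx).clm_apply (hasDerivAt_const s (y - x))
        simpa using this))
      (fun s hs ↦ by
        have e1 := norm_sub_sub_le_sq hB hC hd hL (hφB s hs x hx) (hφB s hs y hy)
        have e2 : v (φ s y) - v (φ s x) - (fderiv ℝ v (φ s x)) (A s x (y - x)) =
            (fderiv ℝ v (φ s x)) (φ s y - φ s x - A s x (y - x)) +
            (v (φ s y) - v (φ s x) - fderiv ℝ v (φ s x) (φ s y - φ s x)) := by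
          simp only [map_sub]; abel
        rw [e2]
        refine (norm_add_le _ _).trans (add_le_add ?_ (e1.trans ?_))
        · exact ((fderiv ℝ v (φ s x)).le_opNorm _).trans (by
            gcongr; exact hbd _ (hφB s hs x hx))
        · gcongr
          exact h1 y hy s hs) t ht
    have e0 : (φ 0 y - φ 0 x - A 0 x (y - x)) = 0 := by
      rw [hφ0 y hy, hφ0 x hx, hA0 x hx]; simp
    rw [e0, norm_zero, gronwallBound_of_K_ne_0 hK.ne'] at this
    refine this.trans ?_
    simp only [zero_mul, zero_add]
    have : Real.exp (K * |t|) - 1 ≤ D := by linarith [habs t ht]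
    calc _ ≤ C * (‖y - x‖ * D) ^ 2 / K * D := by gcongr
      _ = _ := by ring
  rw [hasFDerivAt_iff_isLittleO]
  have hO : (fun y ↦ φ t y - φ t x - A t x (y - x)) =O[𝓝 x] fun y ↦ ‖y - x‖ ^ 2 :=
    Asymptotics.IsBigO.of_bound (C * D ^ 2 / K * D) (by
      filter_upwards [hU.mem_nhds hx] with y hy
      simpa using h2 y hy)
  refine hO.trans_isLittleO ?_
  have h3 := Asymptotics.isLittleO_norm_pow_id (E' := E) (n := 2) (by norm_num)
  have h4 : Tendsto (fun y ↦ y - x) (𝓝 x) (𝓝 0) := by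
    have : Continuous fun y ↦ y - x := by fun_prop
    simpa using this.tendsto x
  exact h3.comp_tendsto h4

/-- Picard–Lindelöf with joint continuity in time and initial value: the base case of the induction
on regularity. -/
theorem exists_continuous_localFlow {F : Type*} [NormedAddCommGroup F] [NormedSpace ℝ F]
    [CompleteSpace F] {v : F → F} {x₀ : F} (hv : ContDiffAt ℝ 1 v x₀) :
    ∃ ε > 0, ∃ U : Set F, IsOpen U ∧ x₀ ∈ U ∧ ∃ φ : ℝ → F → F, (∀ x ∈ U, φ 0 x = x) ∧
      (∀ t ∈ Ioo (-ε) ε, ∀ x ∈ U, HasDerivAt (fun s ↦ φ s x) (v (φ t x)) t) ∧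
      ContinuousOn (fun p : ℝ × F ↦ φ p.1 p.2) (Ioo (-ε) ε ×ˢ U) := by
  obtain ⟨ε, hε, a, r, L, K, hr, hpl⟩ := IsPicardLindelof.of_contDiffAt_one hv
  obtain ⟨α, h1, h2⟩ := (hpl 0).exists_forall_mem_closedBall_eq_hasDerivWithinAt_continuousOn
  refine ⟨ε, hε, Metric.ball x₀ r, Metric.isOpen_ball, Metric.mem_ball_self (by exact_mod_cast hr),
    fun t x ↦ α (x, t), fun x hx ↦ (h1 x (Metric.ball_subset_closedBall hx)).1,
    fun t ht x hx ↦ ?_, ?_⟩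
  · have ht' : t ∈ Ioo (0 - ε) (0 + ε) := by simpa using ht
    exact ((h1 x (Metric.ball_subset_closedBall hx)).2 t (Ioo_subset_Icc_self ht')).hasDerivAt
      (Icc_mem_nhds ht'.1 ht'.2)
  · refine h2.comp (by fun_prop) (fun p hp ↦ ⟨Metric.ball_subset_closedBall hp.2, ?_⟩)
    simpa using Ioo_subset_Icc_self hp.1

/-- The induction runs over all Banach spaces at once. A C^k flow of the prolonged field on F × (F
→L F), started at (x, id), has as its components the flow of v and its spatial derivative; with time
derivative v∘ψ also C^k, the flow of v is C^(k+1). The domain may shrink with k. -/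
theorem exists_contDiffOn_localFlow (k : ℕ) : ∀ {F : Type*} [NormedAddCommGroup F]
    [NormedSpace ℝ F] [CompleteSpace F] {v : F → F} {W : Set F} {x₀ : F} (_ : IsOpen W)
    (_ : ContDiffOn ℝ ∞ v W) (_ : x₀ ∈ W),
    ∃ ε > 0, ∃ U : Set F, IsOpen U ∧ x₀ ∈ U ∧ ∃ φ : ℝ → F → F, (∀ x ∈ U, φ 0 x = x) ∧
      (∀ t ∈ Ioo (-ε) ε, ∀ x ∈ U, HasDerivAt (fun s ↦ φ s x) (v (φ t x)) t) ∧
      (∀ t ∈ Ioo (-ε) ε, ∀ x ∈ U, φ t x ∈ W) ∧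
      ContDiffOn ℝ k (fun p : ℝ × F ↦ φ p.1 p.2) (Ioo (-ε) ε ×ˢ U) := by
  induction k with
  | zero =>
    intro F _ _ _ v W x₀ hW hv hx₀
    obtain ⟨ε, hε, U, hU, hxU, φ, h0, h1, h2⟩ := exists_continuous_localFlow
      (((hv.contDiffAt (hW.mem_nhds hx₀))).of_le (by exact_mod_cast le_top))
    have hc : ContinuousAt (fun p : ℝ × F ↦ φ p.1 p.2) (0, x₀) :=
      h2.continuousAt ((isOpen_Ioo.prod hU).mem_nhds ⟨by simpa using hε, hxU⟩)
    have hWn : W ∈ 𝓝 (φ 0 x₀) := by rw [h0 x₀ hxU]; exact hW.mem_nhds hx₀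
    -- Joint continuity at time 0 gives a smaller time interval and neighbourhood from which the
    -- flow does not leave W.
    have := hc.preimage_mem_nhds hWn
    rw [nhds_prod_eq, Filter.mem_prod_iff] at this
    obtain ⟨T, hT, U', hU', hTU⟩ := this
    obtain ⟨δ, hδ, hδT⟩ := Metric.mem_nhds_iff.1 hT
    obtain ⟨U'', hU''s, hU''o, hU''x⟩ := mem_nhds_iff.1 hU'
    have hsub : Ioo (-min ε δ) (min ε δ) ⊆ Ioo (-ε) ε := fun t ht ↦
      ⟨by linarith [ht.1, min_le_left ε δ], ht.2.trans_le (min_le_left _ _)⟩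
    refine ⟨min ε δ, lt_min hε hδ, U ∩ U'', hU.inter hU''o, ⟨hxU, hU''x⟩, φ,
      fun x hx ↦ h0 x hx.1, fun t ht x hx ↦ h1 t (hsub ht) x hx.1, fun t ht x hx ↦ ?_, ?_⟩
    · refine hTU (Set.mk_mem_prod (hδT ?_) (hU''s hx.2))
      rw [Metric.mem_ball, Real.dist_eq, sub_zero, abs_lt]
      exact ⟨by linarith [ht.1, min_le_right ε δ], ht.2.trans_le (min_le_right _ _)⟩
    · exact_mod_cast contDiffOn_zero.2 (h2.mono (prod_mono hsub inter_subset_left))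
  | succ k ih =>
    intro F _ _ _ v W x₀ hW hv hx₀
    have hfd : ContDiffOn ℝ ∞ (fderiv ℝ v) W :=
      ((contDiffOn_infty_iff_fderiv_of_isOpen hW).1 hv).2
    obtain ⟨C, s, hs, hC⟩ := ((hfd.contDiffAt (hW.mem_nhds hx₀)).of_le
      (show (1 : WithTop ℕ∞) ≤ ∞ by exact_mod_cast le_top)).exists_lipschitzOnWith
    obtain ⟨r, hr, hrs⟩ := Metric.mem_nhds_iff.1 (Filter.inter_mem hs (hW.mem_nhds hx₀))
    set B := Metric.ball x₀ r with hBdef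
    have hBW : B ⊆ W := fun x hx ↦ (hrs hx).2
    have hLB : ∀ x ∈ B, ∀ y ∈ B, ‖fderiv ℝ v x - fderiv ℝ v y‖ ≤ C * ‖x - y‖ := fun x hx y hy ↦
      hC.norm_sub_le (hrs hx).1 (hrs hy).1
    -- The first two terms bound the derivative on the ball; the added 1 makes K positive, since
    -- `hasFDerivAt_flow` divides by it.
    set K : ℝ := C * r + ‖fderiv ℝ v x₀‖ + 1 with hK
    have hK0 : 0 < K := by positivity
    have hbd : ∀ x ∈ B, ‖fderiv ℝ v x‖ ≤ K := by
      intro x hx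
      have h1 := hLB x hx x₀ (Metric.mem_ball_self hr)
      have h2 : ‖x - x₀‖ ≤ r := by rw [← dist_eq_norm]; exact (Metric.mem_ball.1 hx).le
      have h3 : (C : ℝ) * ‖x - x₀‖ ≤ C * r := by gcongr
      have h4 := norm_le_norm_sub_add (fderiv ℝ v x) (fderiv ℝ v x₀)
      linarith
    -- Taking B × univ as the domain keeps the base component in the convex ball B, where the bounds
    -- on the derivative of v hold.
    obtain ⟨ε, hε, U, hU, hxU, φ, h0, h1, h2, h3⟩ := ih (F := F × (F →L[ℝ] F))
      (v := prolongation v) (W := B ×ˢ univ) (x₀ := (x₀, ContinuousLinearMap.id ℝ F))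
      (Metric.isOpen_ball.prod isOpen_univ)
      ((contDiffOn_prolongation Metric.isOpen_ball (hv.mono hBW)))
      ⟨Metric.mem_ball_self hr, mem_univ _⟩
    set U' : Set F := (fun x ↦ (x, ContinuousLinearMap.id ℝ F)) ⁻¹' U with hU'
    have hU'o : IsOpen U' := hU.preimage (by fun_prop)
    set ψ : ℝ → F → F := fun t x ↦ (φ t (x, ContinuousLinearMap.id ℝ F)).1 with hψ
    set A : ℝ → F → (F →L[ℝ] F) := fun t x ↦ (φ t (x, ContinuousLinearMap.id ℝ F)).2 with hA
    have hψd : ∀ t ∈ Ioo (-ε) ε, ∀ x ∈ U', HasDerivAt (fun s ↦ ψ s x) (v (ψ t x)) t :=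
      fun t ht x hx ↦ ((ContinuousLinearMap.fst ℝ F (F →L[ℝ] F)).hasFDerivAt.comp_hasDerivAt t
        (h1 t ht _ hx))
    have hAd : ∀ t ∈ Ioo (-ε) ε, ∀ x ∈ U',
        HasDerivAt (fun s ↦ A s x) ((fderiv ℝ v (ψ t x)).comp (A t x)) t :=
      fun t ht x hx ↦ ((ContinuousLinearMap.snd ℝ F (F →L[ℝ] F)).hasFDerivAt.comp_hasDerivAt t
        (h1 t ht _ hx))
    have hpair : ContDiffOn ℝ k (fun p : ℝ × F ↦ φ p.1 (p.2, ContinuousLinearMap.id ℝ F))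
        (Ioo (-ε) ε ×ˢ U') :=
      h3.comp (f := fun p : ℝ × F ↦ (p.1, (p.2, ContinuousLinearMap.id ℝ F)))
        (by fun_prop) (fun p hp ↦ ⟨hp.1, hp.2⟩)
    have hψk : ContDiffOn ℝ k (fun p : ℝ × F ↦ ψ p.1 p.2) (Ioo (-ε) ε ×ˢ U') := hpair.fst
    have hAk : ContDiffOn ℝ k (fun p : ℝ × F ↦ A p.1 p.2) (Ioo (-ε) ε ×ˢ U') := hpair.snd
    have hψB : ∀ t ∈ Ioo (-ε) ε, ∀ x ∈ U', ψ t x ∈ B := fun t ht x hx ↦ (h2 t ht _ hx).1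
    have hψx : ∀ t ∈ Ioo (-ε) ε, ∀ x ∈ U', HasFDerivAt (ψ t) (A t x) x := fun t ht x hx ↦
      hasFDerivAt_flow (convex_ball x₀ r) hU'o C.2 hK0
        (fun x hx ↦ (hv.contDiffAt (hW.mem_nhds (hBW hx))).differentiableAt (by simp))
        hLB hbd (fun x hx ↦ by simp [hψ, h0 _ hx]) (fun x hx ↦ by simp [hA, h0 _ hx])
        hψB hψd hAd ht hx
    have hO : IsOpen (Ioo (-ε) ε ×ˢ U') := isOpen_Ioo.prod hU'o
    have hvψ : ContDiffOn ℝ k (fun p : ℝ × F ↦ v (ψ p.1 p.2)) (Ioo (-ε) ε ×ˢ U') :=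
      (hv.of_le (by exact_mod_cast le_top)).comp hψk (fun p hp ↦ hBW (hψB p.1 hp.1 p.2 hp.2))
    set f₁ : ℝ → F → (ℝ →L[ℝ] F) := fun t x ↦ ContinuousLinearMap.toSpanSingleton ℝ (v (ψ t x))
    have hf₁ : ContDiffOn ℝ k (fun p : ℝ × F ↦ f₁ p.1 p.2) (Ioo (-ε) ε ×ˢ U') :=
      (ContinuousLinearMap.toSpanSingletonCLE (𝕜 := ℝ) (E := F)).contDiff.comp_contDiffOn hvψ
    -- Two continuous partial derivatives give the joint derivative in time and space.
    have hder : ∀ p ∈ Ioo (-ε) ε ×ˢ U', HasFDerivAt (fun p : ℝ × F ↦ ψ p.1 p.2)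
        ((f₁ p.1 p.2).coprod (A p.1 p.2)) p := by
      intro p hp
      have hn := hO.mem_nhds hp
      exact (hasStrictFDerivAt_uncurry_coprod (f := ψ) (f₁ := f₁) (f₂ := A) (u := p)
        (by filter_upwards [hn] with q hq using (hψd q.1 hq.1 q.2 hq.2).hasFDerivAt)
        (by filter_upwards [hn] with q hq using hψx q.1 hq.1 q.2 hq.2)
        (hf₁.continuousOn.continuousAt hn) (hAk.continuousOn.continuousAt hn)).hasFDerivAt
    refine ⟨ε, hε, U', hU'o, hxU, ψ, fun x hx ↦ by simp [hψ, h0 _ hx], hψd,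
      fun t ht x hx ↦ hBW (hψB t ht x hx), ?_⟩
    have hk : ((k + 1 : ℕ) : WithTop ℕ∞) = (k : WithTop ℕ∞) + 1 := by norm_cast
    rw [hk, contDiffOn_succ_iff_hasFDerivWithinAt_of_uniqueDiffOn hO.uniqueDiffOn]
    refine ⟨fun h ↦ absurd h (by simp), fun p ↦ (f₁ p.1 p.2).coprod (A p.1 p.2), ?_,
      fun p hp ↦ (hder p hp).hasFDerivWithinAt⟩
    have : (fun p : ℝ × F ↦ (f₁ p.1 p.2).coprod (A p.1 p.2)) = fun p : ℝ × F ↦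
        (f₁ p.1 p.2).comp (ContinuousLinearMap.fst ℝ ℝ F) +
        (A p.1 p.2).comp (ContinuousLinearMap.snd ℝ ℝ F) := by
      ext p <;> simp
    rw [this]
    exact (hf₁.clm_comp contDiffOn_const).add (hAk.clm_comp contDiffOn_const)

end LocalFlow


/-! ### Derivatives of maps between manifolds, as maps between the model spaces -/

section HasD

variable {E H N E' H' N' E'' H'' N'' : Type*}
  [NormedAddCommGroup E] [NormedSpace ℝ E] [TopologicalSpace H]
  [TopologicalSpace N] [ChartedSpace H N]
  [NormedAddCommGroup E'] [NormedSpace ℝ E'] [TopologicalSpace H']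
  [TopologicalSpace N'] [ChartedSpace H' N']
  [NormedAddCommGroup E''] [NormedSpace ℝ E''] [TopologicalSpace H'']
  [TopologicalSpace N''] [ChartedSpace H'' N'']

/-- `f` has derivative `L` at `x`, where the tangent spaces are identified with the model spaces. -/
def HasD (I : ModelWithCorners ℝ E H) (I' : ModelWithCorners ℝ E' H') (f : N → N') (x : N)
    (L : E →L[ℝ] E') : Prop :=
  HasMFDerivAt I I' f x L

/-- The derivative of `f` at `x`, where the tangent spaces are identified with the model spaces. -/
noncomputable def D (I : ModelWithCorners ℝ E H) (I' : ModelWithCorners ℝ E' H') (f : N → N')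
    (x : N) : E →L[ℝ] E' :=
  mfderiv I I' f x

variable {I : ModelWithCorners ℝ E H} {I' : ModelWithCorners ℝ E' H'}
  {I'' : ModelWithCorners ℝ E'' H''}

theorem HasD.comp {g : N' → N''} {f : N → N'} {x : N} {y : N'} {L' : E' →L[ℝ] E''}
    {L : E →L[ℝ] E'} (hg : HasD I' I'' g y L') (hf : HasD I I' f x L) (h : f x = y) :
    HasD I I'' (fun z ↦ g (f z)) x (L'.comp L) := by
  subst h
  exact HasMFDerivAt.comp x hg hf

theorem HasD.unique {f : N → N'} {x : N} {L L' : E →L[ℝ] E'} (h : HasD I I' f x L)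
    (h' : HasD I I' f x L') : L = L' :=
  hasMFDerivAt_unique h h'

theorem HasD.congr {f g : N → N'} {x : N} {L : E →L[ℝ] E'} (h : HasD I I' f x L)
    (hg : g =ᶠ[𝓝 x] f) : HasD I I' g x L :=
  HasMFDerivAt.congr_of_eventuallyEq h hg

theorem HasD.continuousAt {f : N → N'} {x : N} {L : E →L[ℝ] E'} (h : HasD I I' f x L) :
    ContinuousAt f x :=
  HasMFDerivAt.continuousAt h

theorem HasD.eq_D {f : N → N'} {x : N} {L : E →L[ℝ] E'} (h : HasD I I' f x L) :
    D I I' f x = L :=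
  HasMFDerivAt.mfderiv h

theorem hasD_of_mdifferentiableAt {f : N → N'} {x : N} (h : MDifferentiableAt I I' f x) :
    HasD I I' f x (D I I' f x) :=
  MDifferentiableAt.hasMFDerivAt h

theorem hasD_of_contMDiffAt {f : N → N'} {x : N} {n : WithTop ℕ∞} (h : ContMDiffAt I I' n f x)
    (hn : n ≠ 0) : HasD I I' f x (D I I' f x) :=
  hasD_of_mdifferentiableAt (h.mdifferentiableAt hn)

theorem HasD.prodMk {f : N → N'} {g : N → N''} {x : N} {L : E →L[ℝ] E'} {L' : E →L[ℝ] E''}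
    (hf : HasD I I' f x L) (hg : HasD I I'' g x L') :
    HasD I (I'.prod I'') (fun z ↦ (f z, g z)) x (L.prod L') :=
  HasMFDerivAt.prodMk hf hg

theorem hasD_id (x : N) : HasD I I (fun z : N ↦ z) x (ContinuousLinearMap.id ℝ E) :=
  hasMFDerivAt_id x

theorem hasD_iff_hasFDerivAt {f : E → E'} {x : E} {L : E →L[ℝ] E'} :
    HasD 𝓘(ℝ, E) 𝓘(ℝ, E') f x L ↔ HasFDerivAt f L x :=
  hasMFDerivAt_iff_hasFDerivAt

theorem hasD_iff_hasDerivAt {f : ℝ → E'} {t : ℝ} {w : E'} :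
    HasD 𝓘(ℝ, ℝ) 𝓘(ℝ, E') f t (ContinuousLinearMap.toSpanSingleton ℝ w) ↔ HasDerivAt f w t :=
  hasD_iff_hasFDerivAt.trans hasDerivAt_iff_hasFDerivAt.symm

end HasD

/-! ### Derivatives of the preferred charts -/

section Charts

variable {E N : Type*} [NormedAddCommGroup E] [NormedSpace ℝ E]
  [TopologicalSpace N] [ChartedSpace E N] [IsManifold 𝓘(ℝ, E) ∞ N]

/-- The derivative of the preferred chart at `x₀`. -/
noncomputable def dchart (x₀ x : N) : E →L[ℝ] E := D 𝓘(ℝ, E) 𝓘(ℝ, E) (extChartAt 𝓘(ℝ, E) x₀) x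

/-- The derivative of the inverse of the preferred chart at `x₀`. -/
noncomputable def dchartSymm (x₀ : N) (y : E) : E →L[ℝ] E :=
  mfderivWithin 𝓘(ℝ, E) 𝓘(ℝ, E) (extChartAt 𝓘(ℝ, E) x₀).symm (range 𝓘(ℝ, E)) y

theorem isManifold_one : IsManifold 𝓘(ℝ, E) 1 N :=
  IsManifold.of_le (n := ∞) (by exact_mod_cast le_top)

theorem hasD_chart {x₀ x : N} (hx : x ∈ (extChartAt 𝓘(ℝ, E) x₀).source) :
    HasD 𝓘(ℝ, E) 𝓘(ℝ, E) (extChartAt 𝓘(ℝ, E) x₀) x (dchart x₀ x) := by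
  have : IsManifold 𝓘(ℝ, E) 1 N := isManifold_one
  exact hasD_of_mdifferentiableAt (mdifferentiableAt_extChartAt (by simpa using hx))

theorem hasD_chart_symm {x₀ : N} {y : E} (hy : y ∈ (extChartAt 𝓘(ℝ, E) x₀).target) :
    HasD 𝓘(ℝ, E) 𝓘(ℝ, E) (extChartAt 𝓘(ℝ, E) x₀).symm y (dchartSymm x₀ y) := by
  have : IsManifold 𝓘(ℝ, E) 1 N := isManifold_one
  have h := (mdifferentiableWithinAt_extChartAt_symm (I := 𝓘(ℝ, E)) hy).hasMFDerivWithinAt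
  exact h.hasMFDerivAt (by simp)

theorem dchart_dchartSymm {x₀ : N} {y : E} (hy : y ∈ (extChartAt 𝓘(ℝ, E) x₀).target) (v : E) :
    dchart x₀ ((extChartAt 𝓘(ℝ, E) x₀).symm y) (dchartSymm x₀ y v) = v := by
  have : IsManifold 𝓘(ℝ, E) 1 N := isManifold_one
  exact DFunLike.congr_fun (mfderiv_extChartAt_comp_mfderivWithin_extChartAt_symm hy) v

theorem dchartSymm_dchart {x₀ : N} {y : E} (hy : y ∈ (extChartAt 𝓘(ℝ, E) x₀).target) (v : E) :
    dchartSymm x₀ y (dchart x₀ ((extChartAt 𝓘(ℝ, E) x₀).symm y) v) = v := by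
  have : IsManifold 𝓘(ℝ, E) 1 N := isManifold_one
  exact DFunLike.congr_fun (mfderivWithin_extChartAt_symm_comp_mfderiv_extChartAt hy) v

end Charts

/-! ### Time-dependent vector fields -/

section Flows

variable {E N : Type*} [NormedAddCommGroup E] [NormedSpace ℝ E]
  [TopologicalSpace N] [ChartedSpace E N]

/-- The expression of a time-dependent vector field in the preferred chart at `x₀`. -/
noncomputable def chartField (X : ℝ → N → E) (x₀ : N) (p : ℝ × E) : E :=
  dchart x₀ ((extChartAt 𝓘(ℝ, E) x₀).symm p.2) (X p.1 ((extChartAt 𝓘(ℝ, E) x₀).symm p.2))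

/-- A time-dependent vector field is smooth on the time interval `I`. -/
def IsSmoothField (X : ℝ → N → E) (I : Set ℝ) : Prop :=
  ∀ x₀ : N, ContDiffOn ℝ ∞ (chartField X x₀) (I ×ˢ (extChartAt 𝓘(ℝ, E) x₀).target)

/-- `γ` solves the differential equation `γ' = X_t(γ)` at time `t`. -/
def IsSolAt (X : ℝ → N → E) (γ : ℝ → N) (t : ℝ) : Prop :=
  HasD 𝓘(ℝ, ℝ) 𝓘(ℝ, E) γ t (ContinuousLinearMap.toSpanSingleton ℝ (X t (γ t)))

variable {X : ℝ → N → E} {I J : Set ℝ}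

theorem IsSolAt.congr {γ γ' : ℝ → N} {t : ℝ} (h : IsSolAt X γ t) (h' : γ' =ᶠ[𝓝 t] γ) :
    IsSolAt X γ' t := by
  unfold IsSolAt
  rw [h'.self_of_nhds]
  exact HasD.congr h h'

theorem IsSolAt.continuousAt {γ : ℝ → N} {t : ℝ} (h : IsSolAt X γ t) : ContinuousAt γ t :=
  HasD.continuousAt h

theorem IsSmoothField.contDiffAt (hX : IsSmoothField X I) (hI : IsOpen I) {t : ℝ} (ht : t ∈ I)
    {x₀ : N} {y : E} (hy : y ∈ (extChartAt 𝓘(ℝ, E) x₀).target) :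
    ContDiffAt ℝ ∞ (chartField X x₀) (t, y) :=
  (hX x₀).contDiffAt ((hI.prod (isOpen_extChartAt_target x₀)).mem_nhds ⟨ht, hy⟩)

/-- The local evolution near `(t₀, x)` exists and is of class `C^k`. -/
def HasLocalEvolution (X : ℝ → N → E) (k : ℕ) (t₀ δ : ℝ) (x : N) : Prop :=
  ∃ U : Set N, IsOpen U ∧ x ∈ U ∧ ∃ ev : ℝ → ℝ → N → N,
    (∀ s ∈ Metric.ball t₀ δ, ∀ z ∈ U, ev s s z = z) ∧
    (∀ s ∈ Metric.ball t₀ δ, ∀ t ∈ Metric.ball t₀ δ, ∀ z ∈ U,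
      IsSolAt X (fun r ↦ ev r s z) t) ∧
    ContMDiffOn (𝓘(ℝ, ℝ × ℝ).prod 𝓘(ℝ, E)) 𝓘(ℝ, E) k
      (fun p : (ℝ × ℝ) × N ↦ ev p.1.1 p.1.2 p.2) ((Metric.ball t₀ δ ×ˢ Metric.ball t₀ δ) ×ˢ U)

theorem HasLocalEvolution.mono {k : ℕ} {t₀ δ δ' : ℝ} {x : N} (h : HasLocalEvolution X k t₀ δ x)
    (hδ : δ' ≤ δ) : HasLocalEvolution X k t₀ δ' x := by
  obtain ⟨U, hU, hx, ev, h1, h2, h3⟩ := h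
  have hs : Metric.ball t₀ δ' ⊆ Metric.ball t₀ δ := Metric.ball_subset_ball hδ
  exact ⟨U, hU, hx, ev, fun s hs' ↦ h1 s (hs hs'), fun s hs' t ht ↦ h2 s (hs hs') t (hs ht),
    h3.mono (prod_mono (prod_mono hs hs) subset_rfl)⟩

variable [IsManifold 𝓘(ℝ, E) ∞ N]

theorem IsSolAt.hasDerivAt_chart {γ : ℝ → N} {t : ℝ} {x₀ : N} (h : IsSolAt X γ t)
    (ht : γ t ∈ (extChartAt 𝓘(ℝ, E) x₀).source) :
    HasDerivAt (fun s ↦ extChartAt 𝓘(ℝ, E) x₀ (γ s))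
      (chartField X x₀ (t, extChartAt 𝓘(ℝ, E) x₀ (γ t))) t := by
  rw [← hasD_iff_hasDerivAt]
  convert HasD.comp (hasD_chart ht) h rfl using 1
  ext
  rw [ContinuousLinearMap.comp_apply, ContinuousLinearMap.toSpanSingleton_apply,
    ContinuousLinearMap.toSpanSingleton_apply, one_smul, one_smul, chartField]
  simp only [(extChartAt 𝓘(ℝ, E) x₀).left_inv ht]

theorem isSolAt_of_hasDerivAt_chart {q : ℝ → E} {t : ℝ} {x₀ : N}
    (hq : q t ∈ (extChartAt 𝓘(ℝ, E) x₀).target)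
    (h : HasDerivAt q (chartField X x₀ (t, q t)) t) :
    IsSolAt X (fun s ↦ (extChartAt 𝓘(ℝ, E) x₀).symm (q s)) t := by
  unfold IsSolAt
  convert HasD.comp (hasD_chart_symm hq) (hasD_iff_hasDerivAt.2 h) rfl using 1
  ext
  rw [ContinuousLinearMap.comp_apply, ContinuousLinearMap.toSpanSingleton_apply,
    ContinuousLinearMap.toSpanSingleton_apply, one_smul, one_smul, chartField,
    dchartSymm_dchart hq]

/-- By continuity both curves stay, for nearby times, in one chart and in a set where the chart
field is Lipschitz in space uniformly in time; uniqueness of ODE solutions in E applies. -/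
theorem IsSolAt.eventuallyEq (hX : IsSmoothField X I) (hI : IsOpen I) {t : ℝ} (ht : t ∈ I)
    {γ γ' : ℝ → N} (h : ∀ᶠ s in 𝓝 t, IsSolAt X γ s) (h' : ∀ᶠ s in 𝓝 t, IsSolAt X γ' s)
    (heq : γ t = γ' t) : γ =ᶠ[𝓝 t] γ' := by
  set x₀ := γ t with hx₀
  set y₀ := extChartAt 𝓘(ℝ, E) x₀ x₀ with hy₀
  obtain ⟨K, S, hS, hK⟩ := ((hX.contDiffAt hI ht (mem_extChartAt_target (I := 𝓘(ℝ, E)) x₀)).of_le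
    (show (1 : WithTop ℕ∞) ≤ ∞ by exact_mod_cast le_top)).exists_lipschitzOnWith
  rw [nhds_prod_eq, Filter.mem_prod_iff] at hS
  obtain ⟨T, hT, B, hB, hTB⟩ := hS
  have aux : ∀ {γ : ℝ → N}, (∀ᶠ s in 𝓝 t, IsSolAt X γ s) → γ t = x₀ → ∀ᶠ s in 𝓝 t,
      γ s ∈ (extChartAt 𝓘(ℝ, E) x₀).source ∧
      (HasDerivAt (fun s ↦ extChartAt 𝓘(ℝ, E) x₀ (γ s))
      (chartField X x₀ (s, extChartAt 𝓘(ℝ, E) x₀ (γ s))) s ∧ extChartAt 𝓘(ℝ, E) x₀ (γ s) ∈ B) := by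
    intro γ h h0
    have hc : ContinuousAt γ t := h.self_of_nhds.continuousAt
    have h1 : ∀ᶠ s in 𝓝 t, γ s ∈ (extChartAt 𝓘(ℝ, E) x₀).source :=
      hc.eventually_mem (by rw [h0]; exact extChartAt_source_mem_nhds x₀)
    have hc2 : ContinuousAt (fun s ↦ extChartAt 𝓘(ℝ, E) x₀ (γ s)) t :=
      ContinuousAt.comp (g := extChartAt 𝓘(ℝ, E) x₀) (by rw [h0]; exact continuousAt_extChartAt x₀)
        hc
    have h2 : ∀ᶠ s in 𝓝 t, extChartAt 𝓘(ℝ, E) x₀ (γ s) ∈ B :=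
      hc2.eventually_mem (by rw [h0]; exact hB)
    filter_upwards [h, h1, h2] with s a b c
    exact ⟨b, a.hasDerivAt_chart b, c⟩
  have a1 := aux h rfl
  have a2 := aux h' heq.symm
  have := ODE_solution_unique_of_eventually (v := fun s y ↦ chartField X x₀ (s, y))
    (s := fun _ ↦ B) (K := K) (t₀ := t)
    (by
      filter_upwards [hT] with s hs
      intro y hy z hz
      simpa [Prod.edist_eq] using
        hK (hTB (Set.mk_mem_prod hs hy)) (hTB (Set.mk_mem_prod hs hz)))
    (a1.mono fun s hs ↦ hs.2) (a2.mono fun s hs ↦ hs.2) (by simp [← heq, hx₀])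
  filter_upwards [this, a1, a2] with s h1 h2 h3
  exact (extChartAt 𝓘(ℝ, E) x₀).injOn h2.1 h3.1 h1

/-- Agreement propagates to nearby times by local uniqueness, and disagreement does so because N is
Hausdorff; on a preconnected set one of the two holds throughout. -/
theorem IsSolAt.eqOn [T2Space N] (hX : IsSmoothField X I) (hI : IsOpen I) (hJI : J ⊆ I)
    (hJ : IsOpen J) (hJc : IsPreconnected J) {γ γ' : ℝ → N} (h : ∀ t ∈ J, IsSolAt X γ t)
    (h' : ∀ t ∈ J, IsSolAt X γ' t) {t₀ : ℝ} (ht₀ : t₀ ∈ J) (heq : γ t₀ = γ' t₀) :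
    EqOn γ γ' J := by
  intro t ht
  refine hJc.induction₂' (fun a b ↦ γ a = γ' a → γ b = γ' b) (fun a ha ↦ ?_)
    (fun a b c _ _ _ h1 h2 h3 ↦ h2 (h1 h3)) ht₀ ht heq
  refine Filter.Eventually.filter_mono nhdsWithin_le_nhds ?_
  by_cases hab : γ a = γ' a
  · filter_upwards [IsSolAt.eventuallyEq hX hI (hJI ha) (by filter_upwards [hJ.mem_nhds ha] using h)
      (by filter_upwards [hJ.mem_nhds ha] using h') hab] with b hb
    exact ⟨fun _ ↦ hb, fun _ ↦ hab⟩
  · filter_upwards [((h a ha).continuousAt.ne_iff_eventually_ne (h' a ha).continuousAt).1 hab]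
      with b hb
    exact ⟨fun h ↦ absurd h hab, fun h ↦ absurd h hb⟩

/-- The time-dependent field becomes the autonomous field (1, X) on ℝ × E; the evolution from s to t
is its flow from (s, y) for time t - s. -/
theorem exists_hasLocalEvolution [CompleteSpace E] (hX : IsSmoothField X I) (hI : IsOpen I)
    {t₀ : ℝ} (ht₀ : t₀ ∈ I) (k : ℕ) (x₀ : N) : ∃ δ > 0, HasLocalEvolution X k t₀ δ x₀ := by
  set φ := extChartAt 𝓘(ℝ, E) x₀ with hφ
  have hO : IsOpen (I ×ˢ φ.target) := hI.prod (isOpen_extChartAt_target x₀)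
  obtain ⟨ε, hε, U, hU, hxU, ψ, h0, h1, h2, h3⟩ := exists_contDiffOn_localFlow k
    (v := fun p : ℝ × E ↦ ((1 : ℝ), chartField X x₀ p)) (x₀ := (t₀, φ x₀)) hO
    (contDiffOn_const.prodMk (hX x₀)) ⟨ht₀, mem_extChartAt_target x₀⟩
  -- The clock coordinate has derivative 1, so its deviation from p.1 + s has zero derivative and
  -- zero initial value; Grönwall with K = η = 0 kills it.
  have hfst : ∀ t ∈ Ioo (-ε) ε, ∀ p ∈ U, (ψ t p).1 = p.1 + t := by
    intro t ht p hp
    have := norm_le_gronwallBound_abs (e := fun s ↦ (ψ s p).1 - s - p.1) (e' := fun _ ↦ (0 : ℝ))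
      (K := 0) (η := 0) (ε := ε) (fun s hs ↦ by
        have := ((((ContinuousLinearMap.fst ℝ ℝ E).hasFDerivAt.comp_hasDerivAt s
          (h1 s hs p hp))).sub (hasDerivAt_id s)).sub_const p.1
        simpa using this) (fun s _ ↦ by simp) t ht
    rw [h0 p hp, gronwallBound_K0] at this
    have h' : (ψ t p).1 - t - p.1 = 0 := by simpa using this
    linarith
  obtain ⟨T, hT, B, hB, hTB⟩ := Filter.mem_prod_iff.1 (nhds_prod_eq (x := t₀) (y := φ x₀) ▸
    hU.mem_nhds hxU)
  obtain ⟨δ, hδ, hδT⟩ := Metric.mem_nhds_iff.1 hT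
  obtain ⟨B', hB'B, hB'o, hB'x⟩ := mem_nhds_iff.1 hB
  have hmem : ∀ s ∈ Metric.ball t₀ (min δ (ε / 2)), ∀ y ∈ B', (s, y) ∈ U := fun s hs y hy ↦
    hTB (Set.mk_mem_prod (hδT (Metric.ball_subset_ball (min_le_left _ _) hs)) (hB'B hy))
  -- Radius ε / 2 ensures that the difference of two admissible times is an admissible flow time.
  have hdiff : ∀ s ∈ Metric.ball t₀ (min δ (ε / 2)), ∀ t ∈ Metric.ball t₀ (min δ (ε / 2)),
      t - s ∈ Ioo (-ε) ε := by
    intro s hs t ht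
    rw [Metric.mem_ball, Real.dist_eq, lt_min_iff, abs_lt, abs_lt] at hs ht
    constructor <;> linarith [hs.2.1, hs.2.2, ht.2.1, ht.2.2]
  refine ⟨min δ (ε / 2), lt_min hδ (by linarith), φ.source ∩ φ ⁻¹' B',
    (continuousOn_extChartAt x₀).isOpen_inter_preimage (isOpen_extChartAt_source x₀) hB'o,
    ⟨mem_extChartAt_source x₀, hB'x⟩,
    fun t s x ↦ φ.symm (ψ (t - s) (s, φ x)).2, fun s hs z hz ↦ ?_, fun s hs t ht z hz ↦ ?_, ?_⟩
  · simp only [sub_self]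
    rw [h0 _ (hmem s hs _ hz.2)]
    exact φ.left_inv hz.1
  · have hp := hmem s hs _ hz.2
    have hd := hdiff s hs t ht
    refine isSolAt_of_hasDerivAt_chart (q := fun r ↦ (ψ (r - s) (s, φ z)).2) (h2 _ hd _ hp).2 ?_
    have e1 := (((ContinuousLinearMap.snd ℝ ℝ E).hasFDerivAt.comp_hasDerivAt (t - s)
          (h1 (t - s) hd _ hp))).comp_sub_const t s
    have e2 : (t, (ψ (t - s) (s, φ z)).2) = ψ (t - s) (s, φ z) :=
      Prod.ext (by rw [hfst _ hd _ hp]; simp) rfl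
    rw [e2]
    exact e1
  · have m1 : ContMDiffOn (𝓘(ℝ, ℝ × ℝ).prod 𝓘(ℝ, E)) 𝓘(ℝ, E) k
        (fun p : (ℝ × ℝ) × N ↦ φ p.2) (univ ×ˢ φ.source) :=
      ContMDiffOn.comp (t := φ.source) (by
        have := contMDiffOn_extChartAt (I := 𝓘(ℝ, E)) (n := ∞) (x := x₀)
        rw [hφ, extChartAt_source]
        exact this.of_le (by exact_mod_cast le_top)) contMDiff_snd.contMDiffOn (fun p hp ↦ hp.2)
    have m2 : ContMDiffOn (𝓘(ℝ, ℝ × ℝ).prod 𝓘(ℝ, E)) 𝓘(ℝ, ℝ × (ℝ × E)) k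
        (fun p : (ℝ × ℝ) × N ↦ (p.1.1 - p.1.2, (p.1.2, φ p.2))) (univ ×ˢ φ.source) := by
      have a : ContMDiff (𝓘(ℝ, ℝ × ℝ).prod 𝓘(ℝ, E)) 𝓘(ℝ, ℝ × ℝ) k
        (fun p : (ℝ × ℝ) × N ↦ p.1) := contMDiff_fst
      have b : ContDiff ℝ k (fun q : ℝ × ℝ ↦ q.1 - q.2) := by fun_prop
      have c : ContDiff ℝ k (fun q : ℝ × ℝ ↦ q.2) := by fun_prop
      exact (b.contMDiff.comp a).contMDiffOn.prodMk_space
        ((c.contMDiff.comp a).contMDiffOn.prodMk_space m1)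
    have m3 : ContMDiffOn 𝓘(ℝ, E) 𝓘(ℝ, E) k φ.symm φ.target :=
      (contMDiffOn_extChartAt_symm (I := 𝓘(ℝ, E)) (n := ∞) x₀).of_le (by exact_mod_cast le_top)
    have m4 : ContMDiffOn 𝓘(ℝ, ℝ × (ℝ × E)) 𝓘(ℝ, E) k
        (fun p : ℝ × (ℝ × E) ↦ (ψ p.1 p.2).2) (Ioo (-ε) ε ×ˢ U) := h3.snd.contMDiffOn
    refine m3.comp (m4.comp (m2.mono (fun p hp ↦ ⟨mem_univ _, hp.2.1⟩)) ?_) ?_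
    · exact fun p hp ↦ ⟨hdiff _ hp.1.2 _ hp.1.1, hmem _ hp.1.2 _ hp.2.2⟩
    · exact fun p hp ↦ (h2 _ (hdiff _ hp.1.2 _ hp.1.1) _ (hmem _ hp.1.2 _ hp.2.2)).2


/-- A local evolution near x serves all points of its neighbourhood with the same δ; finitely many
such neighbourhoods cover N. -/
theorem exists_uniform_hasLocalEvolution [CompleteSpace E] [CompactSpace N]
    (hX : IsSmoothField X I) (hI : IsOpen I) {t₀ : ℝ} (ht₀ : t₀ ∈ I) (k : ℕ) :
    ∃ δ > 0, Metric.ball t₀ δ ⊆ I ∧ ∀ x : N, HasLocalEvolution X k t₀ δ x := by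
  obtain ⟨δ₁, h1, h1I⟩ := Metric.isOpen_iff.1 hI t₀ ht₀
  obtain ⟨δ, hδ, h⟩ := (isCompact_univ (X := N)).induction_on
    (p := fun S ↦ ∃ δ > 0, ∀ x ∈ S, HasLocalEvolution X k t₀ δ x) ⟨1, one_pos, by simp⟩
    (fun S T hST ⟨δ, hδ, h⟩ ↦ ⟨δ, hδ, fun x hx ↦ h x (hST hx)⟩)
    (fun S T ⟨δ, hδ, h⟩ ⟨δ', hδ', h'⟩ ↦ ⟨min δ δ', lt_min hδ hδ', fun x hx ↦ hx.elim
      (fun hx ↦ (h x hx).mono (min_le_left _ _)) (fun hx ↦ (h' x hx).mono (min_le_right _ _))⟩)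
    (fun x _ ↦ by
      obtain ⟨δ, hδ, U, hU, hxU, h⟩ := exists_hasLocalEvolution hX hI ht₀ k x
      exact ⟨U, mem_nhdsWithin_of_mem_nhds (hU.mem_nhds hxU), δ, hδ,
        fun y hy ↦ ⟨U, hU, hy, h⟩⟩)
  exact ⟨min δ δ₁, lt_min hδ h1, (Metric.ball_subset_ball (min_le_right _ _)).trans h1I,
    fun x ↦ (h x (mem_univ x)).mono (min_le_left _ _)⟩

/-- Every initial value problem with initial time in `J` has a solution on all of `J`. -/
def IsSolvableOn (X : ℝ → N → E) (J : Set ℝ) : Prop :=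
  ∀ s ∈ J, ∀ x : N, ∃ γ : ℝ → N, γ s = x ∧ ∀ t ∈ J, IsSolAt X γ t

/-- Solve on J, restart at the common time b on J', and glue: uniqueness on the interval J ∩ J'
makes the two pieces agree there. -/
theorem IsSolvableOn.union [T2Space N] (hX : IsSmoothField X I) (hI : IsOpen I) {J' : Set ℝ}
    (hJI : J ⊆ I) (hJ : IsOpen J) (hJ' : IsOpen J') (hJc : J.OrdConnected) (hJc' : J'.OrdConnected)
    {b : ℝ} (hb : b ∈ J) (hb' : b ∈ J') (h : IsSolvableOn X J) (h' : IsSolvableOn X J') :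
    ∀ s ∈ J, ∀ x : N, ∃ γ : ℝ → N, γ s = x ∧ ∀ t ∈ J ∪ J', IsSolAt X γ t := by
  classical
  intro s hs x
  obtain ⟨γ, h0, h1⟩ := h s hs x
  obtain ⟨γ', h0', h1'⟩ := h' b hb' (γ b)
  have heq : EqOn γ γ' (J ∩ J') := IsSolAt.eqOn hX hI (inter_subset_left.trans hJI)
    (hJ.inter hJ') (hJc.inter hJc').isPreconnected (fun t ht ↦ h1 t ht.1) (fun t ht ↦ h1' t ht.2)
    ⟨hb, hb'⟩ h0'.symm
  refine ⟨fun t ↦ if t ∈ J then γ t else γ' t, by simp [hs, h0], fun t ht ↦ ?_⟩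
  by_cases htJ : t ∈ J
  · refine (h1 t htJ).congr ?_
    filter_upwards [hJ.mem_nhds htJ] with r hr
    simp [hr]
  · have htJ' : t ∈ J' := ht.resolve_left htJ
    refine (h1' t htJ').congr ?_
    filter_upwards [hJ'.mem_nhds htJ'] with r hr
    by_cases hrJ : r ∈ J
    · simp [hrJ, heq ⟨hrJ, hr⟩]
    · simp [hrJ]

/-- Call two times linked if some open interval inside I contains both and every initial value
problem is solvable on it. Nearby times are linked by the uniform existence time, linking is
transitive by gluing, and I is connected. A solution on I is then assembled from the solutions on
the linking intervals. -/
theorem isSolvableOn_of_compactSpace [CompleteSpace E] [CompactSpace N] [T2Space N]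
    (hX : IsSmoothField X I) (hI : IsOpen I) (hIc : I.OrdConnected) : IsSolvableOn X I := by
  have key : ∀ s ∈ I, ∀ t ∈ I, ∃ J : Set ℝ, IsOpen J ∧ J.OrdConnected ∧ J ⊆ I ∧
      IsSolvableOn X J ∧ s ∈ J ∧ t ∈ J := by
    intro s hs t ht
    refine hIc.isPreconnected.induction₂ (fun s t ↦ ∃ J : Set ℝ, IsOpen J ∧ J.OrdConnected ∧
      J ⊆ I ∧ IsSolvableOn X J ∧ s ∈ J ∧ t ∈ J) (fun s hs ↦ ?_) ?_ ?_ hs ht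
    · refine Filter.Eventually.filter_mono nhdsWithin_le_nhds ?_
      obtain ⟨δ, hδ, hδI, h⟩ := exists_uniform_hasLocalEvolution hX hI hs 0
      filter_upwards [Metric.ball_mem_nhds s hδ] with t ht
      refine ⟨Metric.ball s δ, Metric.isOpen_ball, (convex_ball s δ).ordConnected, hδI,
        fun r hr x ↦ ?_, Metric.mem_ball_self hδ, ht⟩
      obtain ⟨U, hU, hxU, ev, h1, h2, -⟩ := h x
      exact ⟨fun t ↦ ev t r x, h1 r hr x hxU, fun t ht ↦ h2 r hr t ht x hxU⟩
    · rintro s t r - - - ⟨J, hJ, hJc, hJI, hJs, h1, h2⟩ ⟨J', hJ', hJc', hJI', hJs', h1', h2'⟩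
      refine ⟨J ∪ J', hJ.union hJ', (IsPreconnected.union t h2 h1' hJc.isPreconnected
        hJc'.isPreconnected).ordConnected, union_subset hJI hJI', ?_, Or.inl h1, Or.inr h2'⟩
      rintro a (ha | ha) x
      · exact IsSolvableOn.union hX hI hJI hJ hJ' hJc hJc' h2 h1' hJs hJs' a ha x
      · rw [union_comm]
        exact IsSolvableOn.union hX hI hJI' hJ' hJ hJc' hJc h1' h2 hJs' hJs a ha x
    · rintro s t - - ⟨J, hJ, hJc, hJI, hJs, h1, h2⟩
      exact ⟨J, hJ, hJc, hJI, hJs, h2, h1⟩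
  intro s hs x
  choose! J hJo hJc hJI hJs hsJ htJ using key s hs
  have : ∀ t ∈ I, ∃ γ : ℝ → N, γ s = x ∧ ∀ r ∈ J t, IsSolAt X γ r :=
    fun t ht ↦ hJs t ht s (hsJ t ht) x
  have hN : Nonempty N := ⟨x⟩
  choose! γ hγs hγ using this
  -- Diagonal choice: for r near t the curves γ r and γ t agree on J r ∩ J t, which is an interval
  -- containing s, so the diagonal coincides with γ t near t.
  refine ⟨fun t ↦ γ t t, hγs s hs, fun t ht ↦ (hγ t ht t (htJ t ht)).congr ?_⟩
  filter_upwards [(hJo t ht).mem_nhds (htJ t ht)] with r hr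
  have hrI := hJI t ht hr
  exact IsSolAt.eqOn (J := J r ∩ J t) hX hI (inter_subset_right.trans (hJI t ht))
    ((hJo r hrI).inter (hJo t ht)) ((hJc r hrI).inter (hJc t ht)).isPreconnected
    (fun a ha ↦ hγ r hrI a ha.1) (fun a ha ↦ hγ t ht a ha.2) ⟨hsJ r hrI, hsJ t ht⟩
    ((hγs r hrI).trans (hγs t ht).symm) ⟨htJ r hrI, hr⟩

/-- The evolution of a smooth time-dependent vector field on a compact manifold. -/
structure IsEvolution (X : ℝ → N → E) (I : Set ℝ) (ev : ℝ → ℝ → N → N) : Prop where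
  self : ∀ s ∈ I, ∀ x, ev s s x = x
  isSolAt : ∀ s ∈ I, ∀ t ∈ I, ∀ x, IsSolAt X (fun r ↦ ev r s x) t

theorem IsEvolution.eq_of_isSolAt [T2Space N] (hX : IsSmoothField X I) (hI : IsOpen I)
    {ev : ℝ → ℝ → N → N} (hev : IsEvolution X I ev)
    (hJI : J ⊆ I) (hJ : IsOpen J) (hJc : J.OrdConnected) {γ : ℝ → N}
    (h : ∀ t ∈ J, IsSolAt X γ t) {s t : ℝ} (hs : s ∈ J) (ht : t ∈ J) : γ t = ev t s (γ s) :=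
  IsSolAt.eqOn hX hI hJI hJ hJc.isPreconnected h
    (fun r hr ↦ hev.isSolAt s (hJI hs) r (hJI hr) (γ s)) hs (hev.self s (hJI hs) _).symm ht

/-- The cocycle law, by uniqueness: after time s both sides are the solution through the same point.
-/
theorem IsEvolution.comp [T2Space N] (hX : IsSmoothField X I) (hI : IsOpen I)
    (hIc : I.OrdConnected) {ev : ℝ → ℝ → N → N} (hev : IsEvolution X I ev) {r s t : ℝ}
    (hr : r ∈ I) (hs : s ∈ I) (ht : t ∈ I) (x : N) : ev t s (ev s r x) = ev t r x :=
  (hev.eq_of_isSolAt hX hI subset_rfl hI hIc (γ := fun a ↦ ev a r x)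
    (fun a ha ↦ hev.isSolAt r hr a ha x) hs ht).symm

/-- Fix a finite order k. Near the diagonal t = s the evolution is a local one, hence C^k; away from
it, the cocycle law writes it as a composite, and C^k regularity spreads along the connected
interval I. -/
theorem IsEvolution.contMDiffOn [CompleteSpace E] [CompactSpace N] [T2Space N]
    (hX : IsSmoothField X I) (hI : IsOpen I)
    (hIc : I.OrdConnected) {ev : ℝ → ℝ → N → N} (hev : IsEvolution X I ev) :
    ContMDiffOn (𝓘(ℝ, ℝ × ℝ).prod 𝓘(ℝ, E)) 𝓘(ℝ, E) ∞
      (fun p : (ℝ × ℝ) × N ↦ ev p.1.1 p.1.2 p.2) ((I ×ˢ I) ×ˢ univ) := by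
  rw [contMDiffOn_infty]
  intro k
  set Ev : (ℝ × ℝ) × N → N := fun p ↦ ev p.1.1 p.1.2 p.2 with hEv
  have hloc : ∀ a ∈ I, ∃ δ > 0, Metric.ball a δ ⊆ I ∧ ∀ t ∈ Metric.ball a δ,
      ∀ s ∈ Metric.ball a δ, ∀ x,
      ContMDiffAt (𝓘(ℝ, ℝ × ℝ).prod 𝓘(ℝ, E)) 𝓘(ℝ, E) k Ev ((t, s), x) := by
    intro a ha
    obtain ⟨δ, hδ, hδI, h⟩ := exists_uniform_hasLocalEvolution hX hI ha k
    refine ⟨δ, hδ, hδI, fun t ht s hs x ↦ ?_⟩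
    obtain ⟨U, hU, hxU, ev', h1, h2, h3⟩ := h x
    have hO : IsOpen ((Metric.ball a δ ×ˢ Metric.ball a δ) ×ˢ U) :=
      (Metric.isOpen_ball.prod Metric.isOpen_ball).prod hU
    have hmem := hO.mem_nhds (show ((t, s), x) ∈ _ from ⟨⟨ht, hs⟩, hxU⟩)
    refine (h3.contMDiffAt hmem).congr_of_eventuallyEq ?_
    filter_upwards [hmem] with p hp
    have := hev.eq_of_isSolAt hX hI hδI Metric.isOpen_ball (convex_ball a δ).ordConnected
      (γ := fun r ↦ ev' r p.1.2 p.2) (fun r hr ↦ h2 _ hp.1.2 r hr _ hp.2) hp.1.2 hp.1.1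
    simp only [hEv]
    rw [this, h1 _ hp.1.2 _ hp.2]
  -- Through ev t s = ev t c ∘ ev c s, regularity at (c, s) passes to (t, s) whenever c and t lie in
  -- a common small ball; s may be far away.
  have step : ∀ a ∈ I, ∃ δ > 0, Metric.ball a δ ⊆ I ∧ ∀ c ∈ Metric.ball a δ,
      ∀ t ∈ Metric.ball a δ, ∀ s ∈ I,
      (∀ x, ContMDiffAt (𝓘(ℝ, ℝ × ℝ).prod 𝓘(ℝ, E)) 𝓘(ℝ, E) k Ev ((c, s), x)) →
      (∀ x, ContMDiffAt (𝓘(ℝ, ℝ × ℝ).prod 𝓘(ℝ, E)) 𝓘(ℝ, E) k Ev ((t, s), x)) := by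
    intro a ha
    obtain ⟨δ, hδ, hδI, h⟩ := hloc a ha
    refine ⟨δ, hδ, hδI, fun c hc t ht s hs hcs x ↦ ?_⟩
    have e : (fun p : (ℝ × ℝ) × N ↦ Ev ((p.1.1, c), Ev ((c, p.1.2), p.2))) =ᶠ[𝓝 ((t, s), x)] Ev := by
      have hO : IsOpen ((I ×ˢ I) ×ˢ (univ : Set N)) := (hI.prod hI).prod isOpen_univ
      filter_upwards [hO.mem_nhds (show ((t, s), x) ∈ _ from ⟨⟨hδI ht, hs⟩, mem_univ _⟩)] with p hp
      exact hev.comp hX hI hIc hp.1.2 (hδI hc) hp.1.1 p.2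
    refine ContMDiffAt.congr_of_eventuallyEq ?_ e.symm
    have a1 : ContMDiff (𝓘(ℝ, ℝ × ℝ).prod 𝓘(ℝ, E)) 𝓘(ℝ, ℝ × ℝ) k
        (fun p : (ℝ × ℝ) × N ↦ (c, p.1.2)) :=
      (show ContDiff ℝ k (fun q : ℝ × ℝ ↦ (c, q.2)) by fun_prop).contMDiff.comp contMDiff_fst
    have a2 : ContMDiff (𝓘(ℝ, ℝ × ℝ).prod 𝓘(ℝ, E)) 𝓘(ℝ, ℝ × ℝ) k
        (fun p : (ℝ × ℝ) × N ↦ (p.1.1, c)) :=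
      (show ContDiff ℝ k (fun q : ℝ × ℝ ↦ (q.1, c)) by fun_prop).contMDiff.comp contMDiff_fst
    have b1 : ContMDiffAt (𝓘(ℝ, ℝ × ℝ).prod 𝓘(ℝ, E)) 𝓘(ℝ, E) k
        (fun p : (ℝ × ℝ) × N ↦ Ev ((c, p.1.2), p.2)) ((t, s), x) :=
      ContMDiffAt.comp (g := Ev) ((t, s), x) (hcs x) (a1.prodMk contMDiff_snd).contMDiffAt
    exact ContMDiffAt.comp (g := Ev) ((t, s), x) (h t ht c hc _) (a2.contMDiffAt.prodMk b1)
  have all : ∀ s ∈ I, ∀ t ∈ I, ∀ x,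
      ContMDiffAt (𝓘(ℝ, ℝ × ℝ).prod 𝓘(ℝ, E)) 𝓘(ℝ, E) k Ev ((t, s), x) := by
    intro s hs t ht
    refine hIc.isPreconnected.induction₂' (fun a b ↦
      (∀ x, ContMDiffAt (𝓘(ℝ, ℝ × ℝ).prod 𝓘(ℝ, E)) 𝓘(ℝ, E) k Ev ((a, s), x)) →
      (∀ x, ContMDiffAt (𝓘(ℝ, ℝ × ℝ).prod 𝓘(ℝ, E)) 𝓘(ℝ, E) k Ev ((b, s), x)))
      (fun a ha ↦ Filter.Eventually.filter_mono nhdsWithin_le_nhds ?_)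
      (fun a b c _ _ _ h1 h2 h3 ↦ h2 (h1 h3)) hs ht ?_
    · obtain ⟨δ, hδ, hδI, h⟩ := step a ha
      filter_upwards [Metric.ball_mem_nhds a hδ] with b hb
      exact ⟨h a (Metric.mem_ball_self hδ) b hb s hs, h b hb a (Metric.mem_ball_self hδ) s hs⟩
    · obtain ⟨δ, hδ, hδI, h⟩ := hloc s hs
      exact h s (Metric.mem_ball_self hδ) s (Metric.mem_ball_self hδ)
  exact fun p hp ↦ (all p.1.2 hp.1.2 p.1.1 hp.1.1 p.2).contMDiffWithinAt

theorem exists_isEvolution [CompleteSpace E] [CompactSpace N] [T2Space N]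
    (hX : IsSmoothField X I) (hI : IsOpen I) (hIc : I.OrdConnected) :
    ∃ ev : ℝ → ℝ → N → N, IsEvolution X I ev := by
  have h := isSolvableOn_of_compactSpace hX hI hIc
  choose! γ h1 h2 using h
  exact ⟨fun t s x ↦ γ s x t, h1, fun s hs t ht x ↦ h2 s hs x t ht⟩

end Flows

/-! ### Calculus of 1-forms in charts -/

section Curl

variable {V E : Type*} [NormedAddCommGroup V] [NormedSpace ℝ V]
  [NormedAddCommGroup E] [NormedSpace ℝ E]

/-- The exterior derivative of a 1-form on a vector space. -/
noncomputable def curl (P : V → V →L[ℝ] ℝ) (v e₁ e₂ : V) : ℝ :=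
  fderiv ℝ P v e₁ e₂ - fderiv ℝ P v e₂ e₁

theorem hasFDerivAt_pullback {a : E → E →L[ℝ] ℝ} {q : V → E} {v₀ : V} (hq : ContDiffAt ℝ 2 q v₀)
    (ha : DifferentiableAt ℝ a (q v₀)) :
    ∃ L : V →L[ℝ] V →L[ℝ] ℝ, HasFDerivAt (fun v ↦ (a (q v)).comp (fderiv ℝ q v)) L v₀ ∧
      ∀ e₁ e₂, L e₁ e₂ = fderiv ℝ a (q v₀) (fderiv ℝ q v₀ e₁) (fderiv ℝ q v₀ e₂) +
        a (q v₀) (fderiv ℝ (fderiv ℝ q) v₀ e₁ e₂) := by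
  have h1 : HasFDerivAt q (fderiv ℝ q v₀) v₀ :=
    (hq.differentiableAt (by norm_num)).hasFDerivAt
  have h2 : HasFDerivAt (fderiv ℝ q) (fderiv ℝ (fderiv ℝ q) v₀) v₀ :=
    ((hq.fderiv_right (m := 1) (by norm_num)).differentiableAt (by norm_num)).hasFDerivAt
  refine ⟨_, (ha.hasFDerivAt.comp v₀ h1).clm_comp h2, fun e₁ e₂ ↦ ?_⟩
  simp [add_comm]

/-- The exterior derivative commutes with pullback because the extra term, a applied to the second
derivative of q, is symmetric and drops out of the antisymmetrisation. -/
theorem curl_pullback {a : E → E →L[ℝ] ℝ} {q : V → E} {v₀ : V} (hq : ContDiffAt ℝ 2 q v₀)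
    (ha : DifferentiableAt ℝ a (q v₀)) (e₁ e₂ : V) :
    curl (fun v ↦ (a (q v)).comp (fderiv ℝ q v)) v₀ e₁ e₂ =
      curl a (q v₀) (fderiv ℝ q v₀ e₁) (fderiv ℝ q v₀ e₂) := by
  obtain ⟨L, hL, h⟩ := hasFDerivAt_pullback hq ha
  have hs : fderiv ℝ (fderiv ℝ q) v₀ e₁ e₂ = fderiv ℝ (fderiv ℝ q) v₀ e₂ e₁ :=
    (hq.isSymmSndFDerivAt (by simp)).eq e₁ e₂
  simp only [curl, hL.fderiv, h, hs]
  ring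

theorem curl_add_const_mul {P Q : V → V →L[ℝ] ℝ} {v : V} (hP : DifferentiableAt ℝ P v)
    (hQ : DifferentiableAt ℝ Q v) (c : ℝ) (e₁ e₂ : V) :
    curl (fun v ↦ P v + c • Q v) v e₁ e₂ = curl P v e₁ e₂ + c * curl Q v e₁ e₂ := by
  have := (hP.hasFDerivAt.add (hQ.hasFDerivAt.const_smul c)).fderiv
  simp only [curl]
  rw [show (fun v ↦ P v + c • Q v) = P + c • Q from rfl, this]
  simp
  ring

theorem curl_congr {P Q : V → V →L[ℝ] ℝ} {v : V} (h : P =ᶠ[𝓝 v] Q) (e₁ e₂ : V) :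
    curl P v e₁ e₂ = curl Q v e₁ e₂ := by
  simp only [curl, h.fderiv_eq]

theorem two_le_infty : (2 : WithTop ℕ∞) ≤ ∞ :=
  WithTop.coe_le_coe.2 (le_top : (2 : ℕ∞) ≤ ⊤)

theorem hasDerivAt_of_hasFDerivAt_prod {F : Type*} [NormedAddCommGroup F] [NormedSpace ℝ F]
    {g : ℝ × V → F} {g' : ℝ × V →L[ℝ] F} {t : ℝ} {r : V} (h : HasFDerivAt g g' (t, r)) :
    HasDerivAt (fun s ↦ g (s, r)) (g' (1, 0)) t :=
  h.comp_hasDerivAt (f := fun s ↦ (s, r)) t ((hasDerivAt_id t).prodMk (hasDerivAt_const t r))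

/-- The variational equation for a family of solutions of `ψ' = X_t(ψ)`. -/
theorem hasDerivAt_fderiv_along_flow {X : ℝ × E → E} {ψ : ℝ × V → E} {t₁ : ℝ} {r₀ : V}
    (hX : DifferentiableAt ℝ X (t₁, ψ (t₁, r₀))) (hψ : ContDiffAt ℝ 2 ψ (t₁, r₀))
    (hsol : ∀ᶠ p in 𝓝 (t₁, r₀), HasDerivAt (fun t ↦ ψ (t, p.2)) (X (p.1, ψ p)) p.1) (u : V) :
    HasDerivAt (fun t ↦ fderiv ℝ ψ (t, r₀) (0, u))
      (fderiv ℝ X (t₁, ψ (t₁, r₀)) (0, fderiv ℝ ψ (t₁, r₀) (0, u))) t₁ := by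
  have h1 : HasFDerivAt ψ (fderiv ℝ ψ (t₁, r₀)) (t₁, r₀) :=
    (hψ.differentiableAt (by norm_num)).hasFDerivAt
  have h2 : HasFDerivAt (fderiv ℝ ψ) (fderiv ℝ (fderiv ℝ ψ) (t₁, r₀)) (t₁, r₀) :=
    ((hψ.fderiv_right (m := 1) (by norm_num)).differentiableAt (by norm_num)).hasFDerivAt
  have hdt : ∀ᶠ p in 𝓝 (t₁, r₀), fderiv ℝ ψ p (1, 0) = X (p.1, ψ p) := by
    have hd : ∀ᶠ p in 𝓝 (t₁, r₀), DifferentiableAt ℝ ψ p :=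
      (hψ.eventually (by simp)).mono fun p hp ↦ hp.differentiableAt (by norm_num)
    filter_upwards [hsol, hd] with p hp hpd
    exact (hasDerivAt_of_hasFDerivAt_prod (t := p.1) (r := p.2) hpd.hasFDerivAt).unique hp
  have hXψ : HasFDerivAt (fun p : ℝ × V ↦ X (p.1, ψ p)) ((fderiv ℝ X (t₁, ψ (t₁, r₀))).comp
      ((ContinuousLinearMap.fst ℝ ℝ V).prod (fderiv ℝ ψ (t₁, r₀)))) (t₁, r₀) :=
    HasFDerivAt.comp (g := X) (t₁, r₀) hX.hasFDerivAt (hasFDerivAt_fst.prodMk h1)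
  have e1 : HasFDerivAt (fun p ↦ fderiv ℝ ψ p (1, 0))
      ((ContinuousLinearMap.apply ℝ E ((1 : ℝ), (0 : V))).comp
        (fderiv ℝ (fderiv ℝ ψ) (t₁, r₀))) (t₁, r₀) :=
    (ContinuousLinearMap.apply ℝ E ((1 : ℝ), (0 : V))).hasFDerivAt.comp (t₁, r₀) h2
  have e2 := (e1.congr_of_eventuallyEq (EventuallyEq.symm hdt)).unique hXψ
  have e3 := DFunLike.congr_fun e2 ((0 : ℝ), u)
  -- Exchange the two derivatives of ψ, then differentiate ∂_t ψ = X(t, ψ) in the direction u.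
  have hwd : fderiv ℝ (fderiv ℝ ψ) (t₁, r₀) (1, 0) (0, u) =
      fderiv ℝ X (t₁, ψ (t₁, r₀)) (0, fderiv ℝ ψ (t₁, r₀) (0, u)) := by
    rw [(hψ.isSymmSndFDerivAt (by simp)).eq]
    exact e3
  rw [← hwd]
  exact (ContinuousLinearMap.apply ℝ E ((0 : ℝ), u)).hasFDerivAt.comp_hasDerivAt t₁
    (hasDerivAt_of_hasFDerivAt_prod h2)

/-- Cartan's formula along a flow in a vector space: the derivative of `a_t(∂_r ψ)`, where `ψ` is a
family of solutions of `ψ' = X_t(ψ)` and `a_t(X_t) = 0`. -/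
theorem hasDerivAt_form_along_flow {a : ℝ × E → E →L[ℝ] ℝ} {X : ℝ × E → E} {ψ : ℝ × V → E}
    {t₁ : ℝ} {r₀ : V} (ha : DifferentiableAt ℝ a (t₁, ψ (t₁, r₀)))
    (hX : DifferentiableAt ℝ X (t₁, ψ (t₁, r₀))) (hψ : ContDiffAt ℝ 2 ψ (t₁, r₀))
    (hsol : ∀ᶠ p in 𝓝 (t₁, r₀), HasDerivAt (fun t ↦ ψ (t, p.2)) (X (p.1, ψ p)) p.1)
    (haX : ∀ᶠ z in 𝓝 (t₁, ψ (t₁, r₀)), a z (X z) = 0) (u : V) {w : E}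
    (hw : fderiv ℝ ψ (t₁, r₀) (0, u) = w) :
    HasDerivAt (fun t ↦ a (t, ψ (t, r₀)) (fderiv ℝ ψ (t, r₀) (0, u)))
      (fderiv ℝ a (t₁, ψ (t₁, r₀)) (1, 0) w +
        (fderiv ℝ a (t₁, ψ (t₁, r₀)) (0, X (t₁, ψ (t₁, r₀))) w -
          fderiv ℝ a (t₁, ψ (t₁, r₀)) (0, w) (X (t₁, ψ (t₁, r₀))))) t₁ := by
  have hwt := hasDerivAt_fderiv_along_flow hX hψ hsol u
  rw [hw] at hwt
  have hψt : HasDerivAt (fun t ↦ (t, ψ (t, r₀))) ((1 : ℝ), X (t₁, ψ (t₁, r₀))) t₁ :=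
    (hasDerivAt_id t₁).prodMk hsol.self_of_nhds
  generalize hz : (t₁, ψ (t₁, r₀)) = z at *
  have hc : HasDerivAt (fun t ↦ a (t, ψ (t, r₀))) (fderiv ℝ a z (1, X z)) t₁ :=
    HasFDerivAt.comp_hasDerivAt (l := a) t₁ (hz ▸ ha.hasFDerivAt) hψt
  have hfin := hc.clm_apply hwt
  -- Differentiating a(X) = 0 in the spatial direction w replaces a(DX·w) by -(Da·w)(X): the term
  -- d(ι_X a) of Cartan's formula vanishes, leaving ∂_t a + ι_X da.
  have hzero : fderiv ℝ a z (0, w) (X z) + a z (fderiv ℝ X z (0, w)) = 0 := by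
    have e1 := ha.hasFDerivAt.clm_apply hX.hasFDerivAt
    have e2 : HasFDerivAt (fun z ↦ a z (X z)) (0 : ℝ × E →L[ℝ] ℝ) z :=
      (hasFDerivAt_const (0 : ℝ) z).congr_of_eventuallyEq haX
    have e3 := DFunLike.congr_fun (e1.unique e2) ((0 : ℝ), w)
    simpa [add_comm] using e3
  have hsplit : fderiv ℝ a z (1, X z) = fderiv ℝ a z (1, 0) + fderiv ℝ a z (0, X z) := by
    rw [← map_add]; simp
  refine hfin.congr_deriv ?_
  rw [hsplit, hw, hz, add_apply]
  linarith

end Curl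

/-! ### 1-forms on manifolds -/

section Forms

variable {V E N : Type*} [NormedAddCommGroup V] [NormedSpace ℝ V]
  [NormedAddCommGroup E] [NormedSpace ℝ E]
  [TopologicalSpace N] [ChartedSpace E N]

/-- The coordinate expression of a 1-form in the preferred chart at `x₀`. -/
noncomputable def chartForm (η : N → E →L[ℝ] ℝ) (x₀ : N) (y : E) : E →L[ℝ] ℝ :=
  (η ((extChartAt 𝓘(ℝ, E) x₀).symm y)).comp (dchartSymm x₀ y)

/-- The exterior derivative of a 1-form. -/
noncomputable def dform (η : N → E →L[ℝ] ℝ) (x : N) (v w : E) : ℝ :=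
  curl (chartForm η x) (extChartAt 𝓘(ℝ, E) x x) (dchart x x v) (dchart x x w)

theorem dform_swap (η : N → E →L[ℝ] ℝ) (x : N) (v w : E) : dform η x v w = -dform η x w v := by
  simp [dform, curl]

theorem dform_add_left (η : N → E →L[ℝ] ℝ) (x : N) (v v' w : E) :
    dform η x (v + v') w = dform η x v w + dform η x v' w := by
  simp [dform, curl]; ring

theorem dform_smul_left (η : N → E →L[ℝ] ℝ) (x : N) (c : ℝ) (v w : E) :
    dform η x (c • v) w = c * dform η x v w := by
  simp [dform, curl]; ring

/-- A 1-form is smooth if its coordinate expressions are. -/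
def IsSmoothForm (η : N → E →L[ℝ] ℝ) : Prop :=
  ∀ x₀ : N, ContDiffOn ℝ ∞ (chartForm η x₀) (extChartAt 𝓘(ℝ, E) x₀).target

/-- A family of 1-forms is smooth on the time interval `I`. -/
def IsSmoothFormFamily (A : ℝ → N → E →L[ℝ] ℝ) (I : Set ℝ) : Prop :=
  ∀ x₀ : N, ContDiffOn ℝ ∞ (fun p : ℝ × E ↦ chartForm (A p.1) x₀ p.2)
    (I ×ˢ (extChartAt 𝓘(ℝ, E) x₀).target)

theorem IsSmoothFormFamily.isSmoothForm {A : ℝ → N → E →L[ℝ] ℝ} {I : Set ℝ}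
    (hA : IsSmoothFormFamily A I) {t : ℝ} (ht : t ∈ I) : IsSmoothForm (A t) := fun x₀ ↦
  (hA x₀).comp (f := fun y ↦ (t, y)) (by fun_prop) (fun _ hy ↦ ⟨ht, hy⟩)

theorem IsSmoothForm.differentiableAt {η : N → E →L[ℝ] ℝ} (hη : IsSmoothForm η) {x₀ : N} {y : E}
    (hy : y ∈ (extChartAt 𝓘(ℝ, E) x₀).target) : DifferentiableAt ℝ (chartForm η x₀) y :=
  ((hη x₀).contDiffAt ((isOpen_extChartAt_target x₀).mem_nhds hy)).differentiableAt (by simp)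

theorem IsSmoothFormFamily.contDiffAt {A : ℝ → N → E →L[ℝ] ℝ} {I : Set ℝ}
    (hA : IsSmoothFormFamily A I) (hI : IsOpen I) {x₀ : N} {p : ℝ × E} (ht : p.1 ∈ I)
    (hy : p.2 ∈ (extChartAt 𝓘(ℝ, E) x₀).target) :
    ContDiffAt ℝ ∞ (fun p : ℝ × E ↦ chartForm (A p.1) x₀ p.2) p :=
  (hA x₀).contDiffAt ((hI.prod (isOpen_extChartAt_target x₀)).mem_nhds ⟨ht, hy⟩)

/-- Links the exterior derivative used in the definition of a contact form to the curl in
coordinates: without boundary the model range is the whole space, and the alternating sum for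
1-forms has two terms. -/
theorem form_d_eq_dform {η : N → E →L[ℝ] ℝ} (hη : IsSmoothForm η) (x : N) (v w : E) :
    Form1.d (I := 𝓘(ℝ, E)) η x v w = dform η x v w := by
  have hd := hη.differentiableAt (mem_extChartAt_target (I := 𝓘(ℝ, E)) x)
  have hd' : DifferentiableAt ℝ (fun y ↦ ContinuousAlternatingMap.ofSubsingleton ℝ E ℝ (0 : Fin 1)
      (chartForm η x y)) (extChartAt 𝓘(ℝ, E) x x) :=
    (ContinuousAlternatingMap.ofSubsingletonLIE (𝕜 := ℝ) (E := E) (F := ℝ)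
      (0 : Fin 1)).toContinuousLinearEquiv.differentiableAt.comp _ hd
  have hu : ∀ u, fderiv ℝ (fun y ↦ chartForm η x y u) (extChartAt 𝓘(ℝ, E) x x) =
      (fderiv ℝ (chartForm η x) (extChartAt 𝓘(ℝ, E) x x)).flip u := fun u ↦ by
    rw [fderiv_clm_apply hd (differentiableAt_const u)]
    simp
  have hr : range 𝓘(ℝ, E) = univ := by simp
  have e : Form1.d (I := 𝓘(ℝ, E)) η x v w = extDerivWithin
      (fun y ↦ ContinuousAlternatingMap.ofSubsingleton ℝ E ℝ (0 : Fin 1) (chartForm η x y))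
      (range 𝓘(ℝ, E)) (extChartAt 𝓘(ℝ, E) x x) ![dchart x x v, dchart x x w] := rfl
  rw [e, hr, extDerivWithin_univ, extDeriv_apply hd']
  simp [-extChartAt, Fin.sum_univ_succ, dform, curl, Fin.removeNth, hu]
  ring

variable [IsManifold 𝓘(ℝ, E) ∞ N]

theorem chartForm_dchart (η : N → E →L[ℝ] ℝ) {x₀ x : N} (hx : x ∈ (extChartAt 𝓘(ℝ, E) x₀).source)
    (v : E) : chartForm η x₀ (extChartAt 𝓘(ℝ, E) x₀ x) (dchart x₀ x v) = η x v := by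
  have h := dchartSymm_dchart ((extChartAt 𝓘(ℝ, E) x₀).map_source hx) v
  rw [(extChartAt 𝓘(ℝ, E) x₀).left_inv hx] at h
  rw [chartForm, ContinuousLinearMap.comp_apply, h, (extChartAt 𝓘(ℝ, E) x₀).left_inv hx]

/-- The coordinate expression of the pullback of a 1-form along a smooth map. -/
theorem pullback_eventuallyEq (η : N → E →L[ℝ] ℝ) {c : V → N} {v₀ : V}
    (hc : ContMDiffAt 𝓘(ℝ, V) 𝓘(ℝ, E) ∞ c v₀) {x₀ : N}
    (h₀ : c v₀ ∈ (extChartAt 𝓘(ℝ, E) x₀).source) :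
    ContDiffAt ℝ ∞ (fun v ↦ extChartAt 𝓘(ℝ, E) x₀ (c v)) v₀ ∧
    (∀ v, c v ∈ (extChartAt 𝓘(ℝ, E) x₀).source → MDifferentiableAt 𝓘(ℝ, V) 𝓘(ℝ, E) c v →
      fderiv ℝ (fun v ↦ extChartAt 𝓘(ℝ, E) x₀ (c v)) v =
        (dchart x₀ (c v)).comp (D 𝓘(ℝ, V) 𝓘(ℝ, E) c v)) ∧
    (fun v ↦ (η (c v)).comp (D 𝓘(ℝ, V) 𝓘(ℝ, E) c v)) =ᶠ[𝓝 v₀] fun v ↦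
      (chartForm η x₀ (extChartAt 𝓘(ℝ, E) x₀ (c v))).comp
        (fderiv ℝ (fun v ↦ extChartAt 𝓘(ℝ, E) x₀ (c v)) v) := by
  have hfd : ∀ v, c v ∈ (extChartAt 𝓘(ℝ, E) x₀).source → MDifferentiableAt 𝓘(ℝ, V) 𝓘(ℝ, E) c v →
      fderiv ℝ (fun v ↦ extChartAt 𝓘(ℝ, E) x₀ (c v)) v =
        (dchart x₀ (c v)).comp (D 𝓘(ℝ, V) 𝓘(ℝ, E) c v) := fun v hv hd ↦
    (hasD_iff_hasFDerivAt.1 ((hasD_chart hv).comp (hasD_of_mdifferentiableAt hd) rfl)).fderiv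
  refine ⟨?_, hfd, ?_⟩
  · have h1 : ContMDiffAt 𝓘(ℝ, E) 𝓘(ℝ, E) ∞ (extChartAt 𝓘(ℝ, E) x₀) (c v₀) :=
      contMDiffAt_extChartAt' (by simpa using h₀)
    exact contMDiffAt_iff_contDiffAt.1 (h1.comp v₀ hc)
  · have hs : ∀ᶠ v in 𝓝 v₀, c v ∈ (extChartAt 𝓘(ℝ, E) x₀).source :=
      hc.continuousAt.eventually_mem ((isOpen_extChartAt_source x₀).mem_nhds h₀)
    have hd : ∀ᶠ v in 𝓝 v₀, MDifferentiableAt 𝓘(ℝ, V) 𝓘(ℝ, E) c v := by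
      have hN : IsManifold 𝓘(ℝ, E) 1 N := isManifold_one
      have : ContMDiffAt 𝓘(ℝ, V) 𝓘(ℝ, E) 1 c v₀ := hc.of_le (by exact_mod_cast le_top)
      exact ((contMDiffAt_iff_contMDiffAt_nhds (by simp)).1 this).mono fun v hv ↦ hv.mdifferentiableAt (by simp)
    filter_upwards [hs, hd] with v hv hdv
    rw [hfd v hv hdv]
    ext u
    simp only [ContinuousLinearMap.comp_apply]
    rw [chartForm_dchart η hv]

/-- Naturality of the exterior derivative. -/
theorem differentiableAt_pullback {η : N → E →L[ℝ] ℝ} (hη : IsSmoothForm η) {c : V → N} {v₀ : V}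
    (hc : ContMDiffAt 𝓘(ℝ, V) 𝓘(ℝ, E) ∞ c v₀) :
    DifferentiableAt ℝ (fun v ↦ (η (c v)).comp (D 𝓘(ℝ, V) 𝓘(ℝ, E) c v)) v₀ := by
  obtain ⟨h1, h2, h3⟩ := pullback_eventuallyEq η hc (mem_extChartAt_source (I := 𝓘(ℝ, E)) (c v₀))
  obtain ⟨L, hL, -⟩ := hasFDerivAt_pullback (h1.of_le two_le_infty)
    (hη.differentiableAt (mem_extChartAt_target (c v₀)))
  exact hL.differentiableAt.congr_of_eventuallyEq h3

/-- Naturality of d for maps from a vector space, read in the preferred chart at c v₀. It allows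
identities for dη to be proved by pulling back along parametrised families. -/
theorem curl_pullback_eq_dform {η : N → E →L[ℝ] ℝ} (hη : IsSmoothForm η) {c : V → N} {v₀ : V}
    (hc : ContMDiffAt 𝓘(ℝ, V) 𝓘(ℝ, E) ∞ c v₀) (e₁ e₂ : V) :
    curl (fun v ↦ (η (c v)).comp (D 𝓘(ℝ, V) 𝓘(ℝ, E) c v)) v₀ e₁ e₂ =
      dform η (c v₀) (D 𝓘(ℝ, V) 𝓘(ℝ, E) c v₀ e₁) (D 𝓘(ℝ, V) 𝓘(ℝ, E) c v₀ e₂) := by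
  have hs := mem_extChartAt_source (I := 𝓘(ℝ, E)) (c v₀)
  obtain ⟨h1, h2, h3⟩ := pullback_eventuallyEq η hc hs
  rw [curl_congr h3, curl_pullback (h1.of_le two_le_infty)
    (hη.differentiableAt (mem_extChartAt_target (c v₀))),
    h2 v₀ hs (hc.mdifferentiableAt (by simp))]
  rfl

/-- Independence of the chart: naturality applied to the inverse of the chart at x₀. -/
theorem dform_eq_curl {η : N → E →L[ℝ] ℝ} (hη : IsSmoothForm η) {x₀ x : N}
    (hx : x ∈ (extChartAt 𝓘(ℝ, E) x₀).source) (v w : E) :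
    dform η x v w = curl (chartForm η x₀) (extChartAt 𝓘(ℝ, E) x₀ x)
      (dchart x₀ x v) (dchart x₀ x w) := by
  have hy := (extChartAt 𝓘(ℝ, E) x₀).map_source hx
  have hc : ContMDiffAt 𝓘(ℝ, E) 𝓘(ℝ, E) ∞ (extChartAt 𝓘(ℝ, E) x₀).symm
      (extChartAt 𝓘(ℝ, E) x₀ x) :=
    (contMDiffOn_extChartAt_symm x₀).contMDiffAt ((isOpen_extChartAt_target x₀).mem_nhds hy)
  have h := curl_pullback_eq_dform hη hc (dchart x₀ x v) (dchart x₀ x w)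
  have hD : ∀ y ∈ (extChartAt 𝓘(ℝ, E) x₀).target,
      D 𝓘(ℝ, E) 𝓘(ℝ, E) (extChartAt 𝓘(ℝ, E) x₀).symm y = dchartSymm x₀ y :=
    fun y hy ↦ (hasD_chart_symm hy).eq_D
  have hv : ∀ v, dchartSymm x₀ (extChartAt 𝓘(ℝ, E) x₀ x) (dchart x₀ x v) = v := fun v ↦ by
    have h := dchartSymm_dchart ((extChartAt 𝓘(ℝ, E) x₀).map_source hx) v
    rwa [(extChartAt 𝓘(ℝ, E) x₀).left_inv hx] at h
  rw [hD _ hy, hv, hv, (extChartAt 𝓘(ℝ, E) x₀).left_inv hx] at h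
  rw [← h]
  refine curl_congr ?_ _ _
  filter_upwards [(isOpen_extChartAt_target x₀).mem_nhds hy] with y hy
  rw [hD y hy]
  rfl

/-- The time derivative of a family of 1-forms. -/
noncomputable def timeDeriv (A : ℝ → N → E →L[ℝ] ℝ) (t : ℝ) (x : N) : E →L[ℝ] ℝ :=
  deriv (fun s ↦ A s x) t

theorem timeDeriv_chart {A : ℝ → N → E →L[ℝ] ℝ} {I : Set ℝ}
    (hA : IsSmoothFormFamily A I) (hI : IsOpen I) {t : ℝ} (ht : t ∈ I) {x₀ x : N}
    (hx : x ∈ (extChartAt 𝓘(ℝ, E) x₀).source) (w : E) :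
    HasDerivAt (fun s ↦ A s x w) (fderiv ℝ (fun p : ℝ × E ↦ chartForm (A p.1) x₀ p.2)
      (t, extChartAt 𝓘(ℝ, E) x₀ x) (1, 0) (dchart x₀ x w)) t := by
  have h1 := ((hA.contDiffAt hI (p := (t, extChartAt 𝓘(ℝ, E) x₀ x)) ht
    ((extChartAt 𝓘(ℝ, E) x₀).map_source hx)).differentiableAt (by simp)).hasFDerivAt
  have h2 := (hasDerivAt_of_hasFDerivAt_prod h1).clm_apply (hasDerivAt_const t (dchart x₀ x w))
  simp only [chartForm_dchart _ hx, map_zero, add_zero] at h2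
  exact h2

theorem hasDerivAt_timeDeriv {A : ℝ → N → E →L[ℝ] ℝ} {I : Set ℝ}
    (hA : IsSmoothFormFamily A I) (hI : IsOpen I) {t : ℝ} (ht : t ∈ I) (x : N) (w : E) :
    HasDerivAt (fun s ↦ A s x w) (timeDeriv A t x w) t := by
  have hx := mem_extChartAt_source (I := 𝓘(ℝ, E)) x
  have hd : DifferentiableAt ℝ (fun s ↦ A s x) t := by
    have h1 := ((hA.contDiffAt hI (p := (t, extChartAt 𝓘(ℝ, E) x x)) ht
      (mem_extChartAt_target x)).differentiableAt (by simp)).hasFDerivAt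
    have h2 := (hasDerivAt_of_hasFDerivAt_prod h1).clm_comp (hasDerivAt_const t (dchart x x))
    refine h2.differentiableAt.congr_of_eventuallyEq (Eventually.of_forall fun s ↦ ?_)
    ext v
    exact (chartForm_dchart (A s) hx v).symm
  have := hd.hasDerivAt.clm_apply (hasDerivAt_const t w)
  simpa [timeDeriv] using this

theorem timeDeriv_eq {A : ℝ → N → E →L[ℝ] ℝ} {I : Set ℝ}
    (hA : IsSmoothFormFamily A I) (hI : IsOpen I) {t : ℝ} (ht : t ∈ I) {x₀ x : N}
    (hx : x ∈ (extChartAt 𝓘(ℝ, E) x₀).source) (w : E) :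
    timeDeriv A t x w = fderiv ℝ (fun p : ℝ × E ↦ chartForm (A p.1) x₀ p.2)
      (t, extChartAt 𝓘(ℝ, E) x₀ x) (1, 0) (dchart x₀ x w) :=
  (hasDerivAt_timeDeriv hA hI ht x w).unique (timeDeriv_chart hA hI ht hx w)

/-- The coordinate expression of a time-dependent map, in the preferred charts at `x₀`, `x₁`. -/
noncomputable def chartMap (Φ : ℝ → N → N) (x₀ x₁ : N) (p : ℝ × E) : E :=
  extChartAt 𝓘(ℝ, E) x₁ (Φ p.1 ((extChartAt 𝓘(ℝ, E) x₀).symm p.2))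

/-! ### Pullback of families of forms along time-dependent maps -/

section TimeDependentMap

variable {Φ : ℝ → N → N} {I : Set ℝ} {x₀ x₁ : N} {t : ℝ} {y : E}

theorem contDiffAt_chartMap (hI : IsOpen I)
    (hΦ : ContMDiffOn (𝓘(ℝ, ℝ).prod 𝓘(ℝ, E)) 𝓘(ℝ, E) ∞ (fun p : ℝ × N ↦ Φ p.1 p.2) (I ×ˢ univ))
    (ht : t ∈ I) (hy : y ∈ (extChartAt 𝓘(ℝ, E) x₀).target)
    (h₁ : Φ t ((extChartAt 𝓘(ℝ, E) x₀).symm y) ∈ (extChartAt 𝓘(ℝ, E) x₁).source) :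
    ContDiffAt ℝ ∞ (chartMap Φ x₀ x₁) (t, y) := by
  rw [← contMDiffAt_iff_contDiffAt]
  have a1 : ContMDiffAt 𝓘(ℝ, E) 𝓘(ℝ, E) ∞ (extChartAt 𝓘(ℝ, E) x₀).symm y :=
    (contMDiffOn_extChartAt_symm x₀).contMDiffAt ((isOpen_extChartAt_target x₀).mem_nhds hy)
  have a2 : ContMDiffAt 𝓘(ℝ, ℝ × E) 𝓘(ℝ, E) ∞
      (fun p : ℝ × E ↦ (extChartAt 𝓘(ℝ, E) x₀).symm p.2) (t, y) :=
    ContMDiffAt.comp (g := (extChartAt 𝓘(ℝ, E) x₀).symm) (t, y) a1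
      contDiff_snd.contMDiff.contMDiffAt
  have a3 : ContMDiffAt 𝓘(ℝ, ℝ × E) 𝓘(ℝ, ℝ) ∞ (fun p : ℝ × E ↦ p.1) (t, y) :=
    contDiff_fst.contMDiff.contMDiffAt
  have a4 := hΦ.contMDiffAt (x := (t, (extChartAt 𝓘(ℝ, E) x₀).symm y))
    ((hI.prod isOpen_univ).mem_nhds ⟨ht, mem_univ _⟩)
  have a5 : ContMDiffAt 𝓘(ℝ, E) 𝓘(ℝ, E) ∞ (extChartAt 𝓘(ℝ, E) x₁)
      (Φ t ((extChartAt 𝓘(ℝ, E) x₀).symm y)) := contMDiffAt_extChartAt' (by simpa using h₁)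
  have a6 := ContMDiffAt.comp (g := fun p : ℝ × N ↦ Φ p.1 p.2) (t, y) a4 (a3.prodMk a2)
  exact ContMDiffAt.comp (g := extChartAt 𝓘(ℝ, E) x₁) (t, y) a5 a6

omit [IsManifold 𝓘(ℝ, E) ∞ N] in
theorem hasD_of_contMDiffOn (hI : IsOpen I)
    (hΦ : ContMDiffOn (𝓘(ℝ, ℝ).prod 𝓘(ℝ, E)) 𝓘(ℝ, E) ∞ (fun p : ℝ × N ↦ Φ p.1 p.2) (I ×ˢ univ))
    (ht : t ∈ I) (x : N) : HasD 𝓘(ℝ, E) 𝓘(ℝ, E) (Φ t) x (D 𝓘(ℝ, E) 𝓘(ℝ, E) (Φ t) x) := by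
  have a4 := hΦ.contMDiffAt (x := (t, x)) ((hI.prod isOpen_univ).mem_nhds ⟨ht, mem_univ _⟩)
  exact hasD_of_contMDiffAt (ContMDiffAt.comp (g := fun p : ℝ × N ↦ Φ p.1 p.2) x a4
    (contMDiffAt_const.prodMk contMDiffAt_id)) (by simp)

theorem fderiv_chartMap (hI : IsOpen I)
    (hΦ : ContMDiffOn (𝓘(ℝ, ℝ).prod 𝓘(ℝ, E)) 𝓘(ℝ, E) ∞ (fun p : ℝ × N ↦ Φ p.1 p.2) (I ×ˢ univ))
    (ht : t ∈ I) (hy : y ∈ (extChartAt 𝓘(ℝ, E) x₀).target)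
    (h₁ : Φ t ((extChartAt 𝓘(ℝ, E) x₀).symm y) ∈ (extChartAt 𝓘(ℝ, E) x₁).source) (e : E) :
    fderiv ℝ (chartMap Φ x₀ x₁) (t, y) (0, e) =
      dchart x₁ (Φ t ((extChartAt 𝓘(ℝ, E) x₀).symm y))
        (D 𝓘(ℝ, E) 𝓘(ℝ, E) (Φ t) ((extChartAt 𝓘(ℝ, E) x₀).symm y) (dchartSymm x₀ y e)) := by
  have h := ((contDiffAt_chartMap hI hΦ ht hy h₁).differentiableAt (by simp)).hasFDerivAt
  have h' : HasFDerivAt (fun r ↦ chartMap Φ x₀ x₁ (t, r)) _ y :=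
    h.comp y ((hasFDerivAt_const t y).prodMk (hasFDerivAt_id y))
  have h2 : HasFDerivAt (fun r ↦ chartMap Φ x₀ x₁ (t, r)) _ y := hasD_iff_hasFDerivAt.1
    (((hasD_chart h₁).comp (hasD_of_contMDiffOn hI hΦ ht _) rfl).comp (hasD_chart_symm hy) rfl)
  have := DFunLike.congr_fun (h'.unique h2) e
  simpa using this

theorem chartForm_chartMap (hI : IsOpen I)
    (hΦ : ContMDiffOn (𝓘(ℝ, ℝ).prod 𝓘(ℝ, E)) 𝓘(ℝ, E) ∞ (fun p : ℝ × N ↦ Φ p.1 p.2) (I ×ˢ univ))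
    (ht : t ∈ I) (hy : y ∈ (extChartAt 𝓘(ℝ, E) x₀).target)
    (h₁ : Φ t ((extChartAt 𝓘(ℝ, E) x₀).symm y) ∈ (extChartAt 𝓘(ℝ, E) x₁).source)
    (η : N → E →L[ℝ] ℝ) (e : E) :
    chartForm η x₁ (chartMap Φ x₀ x₁ (t, y)) (fderiv ℝ (chartMap Φ x₀ x₁) (t, y) (0, e)) =
      η (Φ t ((extChartAt 𝓘(ℝ, E) x₀).symm y))
        (D 𝓘(ℝ, E) 𝓘(ℝ, E) (Φ t) ((extChartAt 𝓘(ℝ, E) x₀).symm y) (dchartSymm x₀ y e)) := by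
  rw [fderiv_chartMap hI hΦ ht hy h₁, chartMap, chartForm_dchart η h₁]

omit [IsManifold 𝓘(ℝ, E) ∞ N] in
theorem eventually_mem_source_chart (hI : IsOpen I)
    (hΦ : ContMDiffOn (𝓘(ℝ, ℝ).prod 𝓘(ℝ, E)) 𝓘(ℝ, E) ∞ (fun p : ℝ × N ↦ Φ p.1 p.2) (I ×ˢ univ))
    (ht : t ∈ I) (hy : y ∈ (extChartAt 𝓘(ℝ, E) x₀).target)
    (h₁ : Φ t ((extChartAt 𝓘(ℝ, E) x₀).symm y) ∈ (extChartAt 𝓘(ℝ, E) x₁).source) :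
    ∀ᶠ p in 𝓝 (t, y), p.1 ∈ I ∧ p.2 ∈ (extChartAt 𝓘(ℝ, E) x₀).target ∧
      Φ p.1 ((extChartAt 𝓘(ℝ, E) x₀).symm p.2) ∈ (extChartAt 𝓘(ℝ, E) x₁).source := by
  have hO := hI.prod (isOpen_extChartAt_target (I := 𝓘(ℝ, E)) x₀)
  have a4 := (hΦ.contMDiffAt (x := (t, (extChartAt 𝓘(ℝ, E) x₀).symm y))
    ((hI.prod isOpen_univ).mem_nhds ⟨ht, mem_univ _⟩)).continuousAt
  have a1 : ContinuousAt (extChartAt 𝓘(ℝ, E) x₀).symm y := continuousAt_extChartAt_symm'' hy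
  have a2 : ContinuousAt (fun p : ℝ × E ↦ (p.1, (extChartAt 𝓘(ℝ, E) x₀).symm p.2)) (t, y) :=
    continuousAt_fst.prodMk (ContinuousAt.comp (g := (extChartAt 𝓘(ℝ, E) x₀).symm) a1
      continuousAt_snd)
  have a3 : ContinuousAt (fun p : ℝ × E ↦ Φ p.1 ((extChartAt 𝓘(ℝ, E) x₀).symm p.2)) (t, y) :=
    ContinuousAt.comp (g := fun p : ℝ × N ↦ Φ p.1 p.2)
      (f := fun p : ℝ × E ↦ (p.1, (extChartAt 𝓘(ℝ, E) x₀).symm p.2)) (x := (t, y)) a4 a2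
  filter_upwards [hO.mem_nhds (show (t, y) ∈ _ from ⟨ht, hy⟩),
    a3.eventually_mem ((isOpen_extChartAt_source x₁).mem_nhds h₁)] with p hp hp'
  exact ⟨hp.1, hp.2, hp'⟩

/-- The derivative of the pullback of a family of 1-forms along a flow, if the forms annihilate the
vector field which generates the flow. -/
theorem hasDerivAt_pullback_along_flow {A : ℝ → N → E →L[ℝ] ℝ} {X : ℝ → N → E}
    (hA : IsSmoothFormFamily A I) (hX : IsSmoothField X I) (hI : IsOpen I)
    (hAX : ∀ t ∈ I, ∀ x, A t x (X t x) = 0)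
    (hΦ : ContMDiffOn (𝓘(ℝ, ℝ).prod 𝓘(ℝ, E)) 𝓘(ℝ, E) ∞ (fun p : ℝ × N ↦ Φ p.1 p.2) (I ×ˢ univ))
    (hsol : ∀ t ∈ I, ∀ x, IsSolAt X (fun s ↦ Φ s x) t) (ht : t ∈ I) (x : N) (u : E) :
    HasDerivAt (fun s ↦ A s (Φ s x) (D 𝓘(ℝ, E) 𝓘(ℝ, E) (Φ s) x u))
      (timeDeriv A t (Φ t x) (D 𝓘(ℝ, E) 𝓘(ℝ, E) (Φ t) x u) +
        dform (A t) (Φ t x) (X t (Φ t x)) (D 𝓘(ℝ, E) 𝓘(ℝ, E) (Φ t) x u)) t := by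
  set x₁ := Φ t x with hx₁
  set y := extChartAt 𝓘(ℝ, E) x x with hy
  have hxs := mem_extChartAt_source (I := 𝓘(ℝ, E)) x
  have hx₁s := mem_extChartAt_source (I := 𝓘(ℝ, E)) x₁
  have hyt : y ∈ (extChartAt 𝓘(ℝ, E) x).target := mem_extChartAt_target x
  have hyx : (extChartAt 𝓘(ℝ, E) x).symm y = x := (extChartAt 𝓘(ℝ, E) x).left_inv hxs
  have h₁ : Φ t ((extChartAt 𝓘(ℝ, E) x).symm y) ∈ (extChartAt 𝓘(ℝ, E) x₁).source := by
    rw [hyx]; exact hx₁s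
  have hev := eventually_mem_source_chart hI hΦ ht hyt h₁
  have hu : dchartSymm x y (dchart x x u) = u := by
    have := dchartSymm_dchart hyt u
    rwa [hyx] at this
  have hval : chartMap Φ x x₁ (t, y) = extChartAt 𝓘(ℝ, E) x₁ x₁ := by
    rw [chartMap]; simp only [hyx]; rw [hx₁]
  have hψt : chartMap Φ x x₁ (t, y) ∈ (extChartAt 𝓘(ℝ, E) x₁).target := by
    rw [hval]; exact mem_extChartAt_target x₁
  have haz := hA.contDiffAt hI (x₀ := x₁) (p := (t, chartMap Φ x x₁ (t, y))) ht hψt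
  have hXz := hX.contDiffAt hI (x₀ := x₁) ht hψt
  have hw : fderiv ℝ (chartMap Φ x x₁) (t, y) (0, dchart x x u) =
      dchart x₁ x₁ (D 𝓘(ℝ, E) 𝓘(ℝ, E) (Φ t) x u) := by
    rw [fderiv_chartMap hI hΦ ht hyt h₁, hu, hyx]
  have main := hasDerivAt_form_along_flow (a := fun p : ℝ × E ↦ chartForm (A p.1) x₁ p.2)
    (X := chartField X x₁) (ψ := chartMap Φ x x₁) (haz.differentiableAt (by simp))
    (hXz.differentiableAt (by simp))
    ((contDiffAt_chartMap hI hΦ ht hyt h₁).of_le two_le_infty)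
    (by
      filter_upwards [hev] with p hp
      exact (hsol p.1 hp.1 _).hasDerivAt_chart hp.2.2)
    (by
      filter_upwards [(hI.prod (isOpen_extChartAt_target x₁)).mem_nhds
        (show (t, chartMap Φ x x₁ (t, y)) ∈ _ from ⟨ht, hψt⟩)] with z hz
      rw [chartForm, chartField, ContinuousLinearMap.comp_apply, dchartSymm_dchart hz.2]
      exact hAX z.1 hz.1 _) (dchart x x u) hw
  rw [hval] at main haz
  have hXc : chartField X x₁ (t, extChartAt 𝓘(ℝ, E) x₁ x₁) = dchart x₁ x₁ (X t x₁) := by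
    rw [chartField]; simp only [(extChartAt 𝓘(ℝ, E) x₁).left_inv hx₁s]
  -- In purely spatial directions the derivative of the family is that of the frozen form A_t, so
  -- the bracket in `main` is the curl of A_t.
  have hpart : ∀ e e' : E, fderiv ℝ (fun p : ℝ × E ↦ chartForm (A p.1) x₁ p.2)
      (t, extChartAt 𝓘(ℝ, E) x₁ x₁) (0, e) e' =
      fderiv ℝ (chartForm (A t) x₁) (extChartAt 𝓘(ℝ, E) x₁ x₁) e e' := by
    intro e e'
    have h : HasFDerivAt (fun r ↦ chartForm (A t) x₁ r) _ (extChartAt 𝓘(ℝ, E) x₁ x₁) :=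
      HasFDerivAt.comp (g := fun p : ℝ × E ↦ chartForm (A p.1) x₁ p.2) (f := fun r ↦ (t, r)) _
        (haz.differentiableAt (by simp)).hasFDerivAt
        ((hasFDerivAt_const t _).prodMk (hasFDerivAt_id _))
    rw [h.fderiv]
    simp
  rw [hXc, hpart, hpart] at main
  rw [timeDeriv_eq hA hI ht hx₁s, dform, curl]
  refine main.congr_of_eventuallyEq ?_
  have hc : ContinuousAt (fun s ↦ (s, y)) t := by fun_prop
  filter_upwards [hc.eventually hev] with s hs
  have := chartForm_chartMap hI hΦ hs.1 hs.2.1 hs.2.2 (A s) (dchart x x u)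
  rw [hu, hyx] at this
  exact this.symm

end TimeDependentMap

end Forms

/-! ### Lifting through submersions -/

section Lift

/-- With B a right inverse of f'(a), the map T has derivative id at a and satisfies f'(a)(T y) = f y
- f a, so T straightens f to its linearisation. Lifting p becomes a linear problem, solved by z with
the derivative L prescribed, and c = T⁻¹ ∘ z. -/
theorem exists_lift_of_surjective_fderiv {V E F : Type*}
    [NormedAddCommGroup V] [NormedSpace ℝ V]
    [NormedAddCommGroup E] [NormedSpace ℝ E] [CompleteSpace E]
    [NormedAddCommGroup F] [NormedSpace ℝ F] [FiniteDimensional ℝ F]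
    {f : E → F} {a : E} (hf : ContDiffAt ℝ ∞ f a) (hs : Function.Surjective (fderiv ℝ f a))
    {p : V → F} {v₀ : V} (hp : ContDiffAt ℝ ∞ p v₀) (hpa : p v₀ = f a) {L : V →L[ℝ] E}
    (hL : (fderiv ℝ f a).comp L = fderiv ℝ p v₀) :
    ∃ c : V → E, ContDiffAt ℝ ∞ c v₀ ∧ c v₀ = a ∧ HasFDerivAt c L v₀ ∧
      ∀ᶠ v in 𝓝 v₀, f (c v) = p v := by
  obtain ⟨B, hB⟩ := (fderiv ℝ f a).exists_rightInverse_of_surjective (LinearMap.range_eq_top.2 hs)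
  have hB' : ∀ w, fderiv ℝ f a (B w) = w := fun w ↦ DFunLike.congr_fun hB w
  set T : E → E := fun y ↦ B (f y - f a) + (y - a) - B (fderiv ℝ f a (y - a)) with hT
  have hTs : ContDiffAt ℝ ∞ T a := by fun_prop
  have hT0 : T a = 0 := by simp [hT]
  have hTd : HasFDerivAt T ((ContinuousLinearEquiv.refl ℝ E : E ≃L[ℝ] E) : E →L[ℝ] E) a := by
    have h1 := (hf.differentiableAt (by simp)).hasFDerivAt
    have h2 : HasFDerivAt (fun y ↦ y - a) (ContinuousLinearMap.id ℝ E) a :=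
      (hasFDerivAt_id a).sub_const a
    have := ((B.hasFDerivAt.comp a (h1.sub_const (f a))).add h2).sub
      (B.hasFDerivAt.comp a ((fderiv ℝ f a).hasFDerivAt.comp a h2))
    refine HasFDerivAt.congr_fderiv (f := T) this ?_
    ext y
    simp
  have hfT : ∀ y, fderiv ℝ f a (T y) = f y - f a := fun y ↦ by
    simp only [hT, map_sub, map_add, hB']; abel
  set S := hTs.localInverse hTd (by simp) with hS
  have hSs : ContDiffAt ℝ ∞ S 0 := hT0 ▸ hTs.to_localInverse hTd (by simp)
  have hS0 : S 0 = a := by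
    have := hTs.localInverse_apply_image hTd (by simp)
    rwa [hT0] at this
  have hTS : ∀ᶠ y in 𝓝 (0 : E), T (S y) = y := by
    have := (hTs.hasStrictFDerivAt' hTd (by simp)).eventually_right_inverse
    rwa [hT0] at this
  -- B solves the equation and the remaining terms project L(v - v₀) to the kernel of f'(a); by `hL`
  -- the total derivative at v₀ is exactly L.
  set z : V → E := fun v ↦ B (p v - f a) + L (v - v₀) - B (fderiv ℝ f a (L (v - v₀))) with hz
  have hz0 : z v₀ = 0 := by simp [hz, hpa]
  have hzs : ContDiffAt ℝ ∞ z v₀ := by fun_prop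
  have hzd : HasFDerivAt z L v₀ := by
    have h1 := (hp.differentiableAt (by simp)).hasFDerivAt
    have h2 : HasFDerivAt (fun y ↦ y - v₀) (ContinuousLinearMap.id ℝ V) v₀ :=
      (hasFDerivAt_id v₀).sub_const v₀
    have h3 := L.hasFDerivAt.comp v₀ h2
    have := ((B.hasFDerivAt.comp v₀ (h1.sub_const (f a))).add h3).sub
      (B.hasFDerivAt.comp v₀ ((fderiv ℝ f a).hasFDerivAt.comp v₀ h3))
    refine HasFDerivAt.congr_fderiv (f := z) this ?_
    rw [← hL]
    ext y
    simp
  have hfz : ∀ v, fderiv ℝ f a (z v) = p v - f a := fun v ↦ by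
    simp only [hz, map_sub, map_add, hB']; abel
  have hcs : ContDiffAt ℝ ∞ (fun v ↦ S (z v)) v₀ :=
    ContDiffAt.comp (g := S) v₀ (hz0.symm ▸ hSs) hzs
  have hc0 : S (z v₀) = a := by rw [hz0, hS0]
  have hTc : ∀ᶠ v in 𝓝 v₀, T (S (z v)) = z v :=
    (show Tendsto z (𝓝 v₀) (𝓝 0) from hz0 ▸ hzs.continuousAt).eventually hTS
  refine ⟨fun v ↦ S (z v), hcs, hc0, ?_, ?_⟩
  · have h1 := (hcs.differentiableAt (by simp)).hasFDerivAt
    have h2 : HasFDerivAt (fun v ↦ T (S (z v))) _ v₀ :=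
      HasFDerivAt.comp (g := T) v₀ (hc0.symm ▸ hTd) h1
    have h3 := (h2.congr_of_eventuallyEq (EventuallyEq.symm hTc)).unique hzd
    have h4 : fderiv ℝ (fun v ↦ S (z v)) v₀ = L := by
      rw [← h3]; ext; simp
    rwa [h4] at h1
  · filter_upwards [hTc] with v hv
    have e1 := hfT (S (z v))
    rw [hv, hfz] at e1
    exact (sub_left_injective e1).symm

variable {V E N F B : Type*} [NormedAddCommGroup V] [NormedSpace ℝ V]
  [NormedAddCommGroup E] [NormedSpace ℝ E] [CompleteSpace E]
  [TopologicalSpace N] [ChartedSpace E N] [IsManifold 𝓘(ℝ, E) ∞ N]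
  [NormedAddCommGroup F] [NormedSpace ℝ F] [FiniteDimensional ℝ F]
  [TopologicalSpace B] [ChartedSpace F B] [IsManifold 𝓘(ℝ, F) ∞ B]

/-- A smooth map into the base of a submersion lifts locally, with prescribed derivative. -/
theorem exists_lift_of_submersion {f : N → B} (hf : ContMDiff 𝓘(ℝ, E) 𝓘(ℝ, F) ∞ f) {h : N}
    (hs : Function.Surjective (D 𝓘(ℝ, E) 𝓘(ℝ, F) f h)) {p : V → B} {v₀ : V}
    (hp : ContMDiffAt 𝓘(ℝ, V) 𝓘(ℝ, F) ∞ p v₀) (hpa : p v₀ = f h) {L : V →L[ℝ] E}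
    (hL : (D 𝓘(ℝ, E) 𝓘(ℝ, F) f h).comp L = D 𝓘(ℝ, V) 𝓘(ℝ, F) p v₀) :
    ∃ c : V → N, ContMDiffAt 𝓘(ℝ, V) 𝓘(ℝ, E) ∞ c v₀ ∧ c v₀ = h ∧
      HasD 𝓘(ℝ, V) 𝓘(ℝ, E) c v₀ L ∧ ∀ᶠ v in 𝓝 v₀, f (c v) = p v := by
  set φ := extChartAt 𝓘(ℝ, E) h with hφ
  set χ := extChartAt 𝓘(ℝ, F) (f h) with hχ
  have hhs : h ∈ φ.source := mem_extChartAt_source h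
  have hht : φ h ∈ φ.target := mem_extChartAt_target h
  have hφh : φ.symm (φ h) = h := φ.left_inv hhs
  have hfhs : f h ∈ χ.source := mem_extChartAt_source (f h)
  have hsymm : ContMDiffAt 𝓘(ℝ, E) 𝓘(ℝ, E) ∞ φ.symm (φ h) :=
    (contMDiffOn_extChartAt_symm h).contMDiffAt ((isOpen_extChartAt_target h).mem_nhds hht)
  have hχm : ContMDiffAt 𝓘(ℝ, F) 𝓘(ℝ, F) ∞ χ (f h) := contMDiffAt_extChartAt
  have hfφ : ContMDiffAt 𝓘(ℝ, E) 𝓘(ℝ, F) ∞ (fun y ↦ f (φ.symm y)) (φ h) :=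
    ContMDiffAt.comp (g := f) (φ h) hf.contMDiffAt hsymm
  have hft : ContDiffAt ℝ ∞ (fun y ↦ χ (f (φ.symm y))) (φ h) :=
    contMDiffAt_iff_contDiffAt.1
      (ContMDiffAt.comp (g := χ) (φ h) (by simp only [hφh]; exact hχm) hfφ)
  have hpt : ContDiffAt ℝ ∞ (fun v ↦ χ (p v)) v₀ :=
    contMDiffAt_iff_contDiffAt.1 (ContMDiffAt.comp (g := χ) v₀ (by rw [hpa]; exact hχm) hp)
  have hd1 : fderiv ℝ (fun y ↦ χ (f (φ.symm y))) (φ h) = (dchart (f h) (f h)).comp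
      ((D 𝓘(ℝ, E) 𝓘(ℝ, F) f h).comp (dchartSymm h (φ h))) := by
    refine (hasD_iff_hasFDerivAt.1 ((hasD_chart hfhs).comp ((hasD_of_contMDiffAt
      hf.contMDiffAt (by simp)).comp (hasD_chart_symm hht) hφh) ?_)).fderiv
    rw [hφh]
  have hd2 : fderiv ℝ (fun v ↦ χ (p v)) v₀ = (dchart (f h) (f h)).comp
      (D 𝓘(ℝ, V) 𝓘(ℝ, F) p v₀) :=
    (hasD_iff_hasFDerivAt.1 ((hasD_chart hfhs).comp (hasD_of_contMDiffAt hp (by simp)) hpa)).fderiv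
  have hdd : ∀ v, dchartSymm h (φ h) (dchart h h v) = v := fun v ↦ by
    have := dchartSymm_dchart hht v
    rwa [hφh] at this
  have hddB : ∀ v, dchart (f h) (f h) (dchartSymm (f h) (χ (f h)) v) = v := fun v ↦ by
    have := dchart_dchartSymm (χ.map_source hfhs) v
    rwa [χ.left_inv hfhs] at this
  obtain ⟨c, hc, hc0, hcd, hcf⟩ := exists_lift_of_surjective_fderiv hft (by
      rw [hd1]
      intro w
      obtain ⟨u, hu⟩ := hs (dchartSymm (f h) (χ (f h)) w)
      refine ⟨dchart h h u, ?_⟩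
      simp only [ContinuousLinearMap.comp_apply, hdd, hu, hddB]) hpt (by simp only [hφh, hpa])
      (L := (dchart h h).comp L) (by
      rw [hd1, hd2, ← hL]
      ext v
      simp only [ContinuousLinearMap.comp_apply, hdd])
  have hcs : ∀ᶠ v in 𝓝 v₀, c v ∈ φ.target :=
    hc.continuousAt.eventually_mem (by rw [hc0]; exact (isOpen_extChartAt_target h).mem_nhds hht)
  have hsm : ContMDiffAt 𝓘(ℝ, V) 𝓘(ℝ, E) ∞ (fun v ↦ φ.symm (c v)) v₀ :=
    ContMDiffAt.comp (g := φ.symm) v₀ (by rw [hc0]; exact hsymm) hc.contMDiffAt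
  refine ⟨fun v ↦ φ.symm (c v), hsm, by simp only [hc0, hφh], ?_, ?_⟩
  · convert (hasD_chart_symm hht).comp (hasD_iff_hasFDerivAt.2 hcd) hc0 using 1
    ext v
    simp only [ContinuousLinearMap.comp_apply]
    rw [hdd]
  · have h1 : ∀ᶠ v in 𝓝 v₀, f (φ.symm (c v)) ∈ χ.source := by
      refine (hf.continuous.continuousAt.comp hsm.continuousAt).eventually_mem ?_
      simp only [Function.comp_apply, hc0, hφh]
      exact (isOpen_extChartAt_source (f h)).mem_nhds hfhs
    have h2 : ∀ᶠ v in 𝓝 v₀, p v ∈ χ.source :=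
      hp.continuousAt.eventually_mem
        (by rw [hpa]; exact (isOpen_extChartAt_source (f h)).mem_nhds hfhs)
    filter_upwards [h1, h2, hcf] with v a1 a2 a3
    exact χ.injOn a1 a2 a3

omit [CompleteSpace E] in
/-- A smooth map with prescribed value and derivative at a point. -/
theorem exists_map_hasD (g : N) (v₀ : V) (L : V →L[ℝ] E) :
    ∃ c : V → N, ContMDiffAt 𝓘(ℝ, V) 𝓘(ℝ, E) ∞ c v₀ ∧ c v₀ = g ∧
      HasD 𝓘(ℝ, V) 𝓘(ℝ, E) c v₀ L := by
  set φ := extChartAt 𝓘(ℝ, E) g with hφ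
  have hht : φ g ∈ φ.target := mem_extChartAt_target g
  have hφh : φ.symm (φ g) = g := φ.left_inv (mem_extChartAt_source g)
  set q : V → E := fun v ↦ φ g + dchart g g (L (v - v₀)) with hq
  have hq0 : q v₀ = φ g := by simp [hq]
  have hqs : ContDiff ℝ ∞ q := by fun_prop
  have hqd : HasFDerivAt q ((dchart g g).comp L) v₀ :=
    ((dchart g g).hasFDerivAt.comp v₀ (L.hasFDerivAt.comp v₀
      ((hasFDerivAt_id v₀).sub_const v₀))).const_add (φ g)
  refine ⟨fun v ↦ φ.symm (q v), ContMDiffAt.comp (g := φ.symm) v₀ ?_ hqs.contMDiff.contMDiffAt,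
    by simp only [hq0, hφh], ?_⟩
  · rw [hq0]
    exact (contMDiffOn_extChartAt_symm g).contMDiffAt ((isOpen_extChartAt_target g).mem_nhds hht)
  · convert (hasD_chart_symm hht).comp (hasD_iff_hasFDerivAt.2 hqd) hq0 using 1
    ext v
    have := dchartSymm_dchart hht (L v)
    rw [hφh] at this
    simp only [ContinuousLinearMap.comp_apply]
    exact this.symm

end Lift

/-! ### The tangent groupoid -/

namespace LieGroupoid

section Tangent

variable {EG EM G M : Type*}
  [NormedAddCommGroup EG] [NormedSpace ℝ EG] [NormedAddCommGroup EM] [NormedSpace ℝ EM]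
  [TopologicalSpace G] [ChartedSpace EG G] [TopologicalSpace M] [ChartedSpace EM M]
  (𝒢 : LieGroupoid 𝓘(ℝ, EG) 𝓘(ℝ, EM) G M)

/-- The derivative of the source map. -/
noncomputable def ds (g : G) : EG →L[ℝ] EM := D 𝓘(ℝ, EG) 𝓘(ℝ, EM) 𝒢.src g

/-- The derivative of the target map. -/
noncomputable def dt (g : G) : EG →L[ℝ] EM := D 𝓘(ℝ, EG) 𝓘(ℝ, EM) 𝒢.tgt g

/-- The derivative of the unit map. -/
noncomputable def du (x : M) : EM →L[ℝ] EG := D 𝓘(ℝ, EM) 𝓘(ℝ, EG) 𝒢.unit x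

/-- The tangent multiplication as a linear map. -/
noncomputable def dm (g h : G) : EG × EG →L[ℝ] EG :=
  mfderivWithin (𝓘(ℝ, EG).prod 𝓘(ℝ, EG)) 𝓘(ℝ, EG) (fun p : G × G ↦ 𝒢.mul p.1 p.2) 𝒢.composable
    (g, h)

/-- Multiplicativity of a 1-form, without dependent types. -/
def IsMult (α : G → EG →L[ℝ] ℝ) (F : G → ℝ) : Prop :=
  ∀ g h, 𝒢.src g = 𝒢.tgt h → ∀ X Y : EG, 𝒢.ds g X = 𝒢.dt h Y →
    α (𝒢.mul g h) (𝒢.dm g h (X, Y)) = α g X + F g * α h Y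

theorem hasD_src (g : G) : HasD 𝓘(ℝ, EG) 𝓘(ℝ, EM) 𝒢.src g (𝒢.ds g) :=
  hasD_of_contMDiffAt 𝒢.smooth_src.contMDiffAt (by simp)

theorem hasD_tgt (g : G) : HasD 𝓘(ℝ, EG) 𝓘(ℝ, EM) 𝒢.tgt g (𝒢.dt g) :=
  hasD_of_contMDiffAt 𝒢.smooth_tgt.contMDiffAt (by simp)

theorem hasD_unit (x : M) : HasD 𝓘(ℝ, EM) 𝓘(ℝ, EG) 𝒢.unit x (𝒢.du x) :=
  hasD_of_contMDiffAt 𝒢.smooth_unit.contMDiffAt (by simp)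

theorem surjective_ds (g : G) : Function.Surjective (𝒢.ds g) := 𝒢.submersion_src g

theorem surjective_dt (g : G) : Function.Surjective (𝒢.dt g) := 𝒢.submersion_tgt g

theorem ds_du (x : M) (v : EM) : 𝒢.ds (𝒢.unit x) (𝒢.du x v) = v := by
  have h := (𝒢.hasD_src (𝒢.unit x)).comp (𝒢.hasD_unit x) rfl
  simp only [𝒢.src_unit] at h
  exact DFunLike.congr_fun (h.unique (hasD_id x)) v

theorem dt_du (x : M) (v : EM) : 𝒢.dt (𝒢.unit x) (𝒢.du x v) = v := by
  have h := (𝒢.hasD_tgt (𝒢.unit x)).comp (𝒢.hasD_unit x) rfl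
  simp only [𝒢.tgt_unit] at h
  exact DFunLike.congr_fun (h.unique (hasD_id x)) v

/-! ### Differentiating products of composable maps -/

section Mul

variable {E' H' P : Type*} [NormedAddCommGroup E'] [NormedSpace ℝ E'] [TopologicalSpace H']
  [TopologicalSpace P] [ChartedSpace H' P] {I' : ModelWithCorners ℝ E' H'}

/-- Near p the pair takes values in the composable set, so the chain rule within that set yields a
genuine derivative. This turns groupoid identities into identities for `dm`. -/
theorem hasD_mul {c₁ c₂ : P → G} {p : P} {L₁ L₂ : E' →L[ℝ] EG} (h₁ : HasD I' 𝓘(ℝ, EG) c₁ p L₁)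
    (h₂ : HasD I' 𝓘(ℝ, EG) c₂ p L₂) (hc : ∀ᶠ q in 𝓝 p, 𝒢.src (c₁ q) = 𝒢.tgt (c₂ q)) :
    HasD I' 𝓘(ℝ, EG) (fun q ↦ 𝒢.mul (c₁ q) (c₂ q)) p ((𝒢.dm (c₁ p) (c₂ p)).comp (L₁.prod L₂)) := by
  have h1 : HasMFDerivWithinAt (𝓘(ℝ, EG).prod 𝓘(ℝ, EG)) 𝓘(ℝ, EG)
      (fun p : G × G ↦ 𝒢.mul p.1 p.2) 𝒢.composable (c₁ p, c₂ p) (𝒢.dm (c₁ p) (c₂ p)) :=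
    ((𝒢.smooth_mul (c₁ p, c₂ p) hc.self_of_nhds).mdifferentiableWithinAt
      (by simp)).hasMFDerivWithinAt
  have h2 : HasMFDerivWithinAt I' (𝓘(ℝ, EG).prod 𝓘(ℝ, EG)) (fun q ↦ (c₁ q, c₂ q))
      {q | 𝒢.src (c₁ q) = 𝒢.tgt (c₂ q)} p (L₁.prod L₂) :=
    HasMFDerivAt.hasMFDerivWithinAt (HasD.prodMk h₁ h₂)
  exact (HasMFDerivWithinAt.comp (u := 𝒢.composable) p h1 h2 (fun q hq ↦ hq)).hasMFDerivAt hc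

theorem contMDiffAt_mul {n : WithTop ℕ∞} (hn : n ≤ ∞) {c₁ c₂ : P → G} {p : P}
    (h₁ : ContMDiffAt I' 𝓘(ℝ, EG) n c₁ p)
    (h₂ : ContMDiffAt I' 𝓘(ℝ, EG) n c₂ p) (hc : ∀ᶠ q in 𝓝 p, 𝒢.src (c₁ q) = 𝒢.tgt (c₂ q)) :
    ContMDiffAt I' 𝓘(ℝ, EG) n (fun q ↦ 𝒢.mul (c₁ q) (c₂ q)) p := by
  have h1 := (𝒢.smooth_mul (c₁ p, c₂ p) hc.self_of_nhds).of_le hn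
  have h2 : ContMDiffWithinAt I' (𝓘(ℝ, EG).prod 𝓘(ℝ, EG)) n (fun q ↦ (c₁ q, c₂ q))
      {q | 𝒢.src (c₁ q) = 𝒢.tgt (c₂ q)} p := (h₁.prodMk h₂).contMDiffWithinAt
  exact (ContMDiffWithinAt.comp (t := {p : G × G | 𝒢.src p.1 = 𝒢.tgt p.2}) p h1 h2 (fun q hq ↦ hq)).contMDiffAt hc

end Mul

theorem dm_unit_left (g : G) (Y : EG) :
    𝒢.dm (𝒢.unit (𝒢.tgt g)) g (𝒢.du (𝒢.tgt g) (𝒢.dt g Y), Y) = Y := by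
  have h := 𝒢.hasD_mul ((𝒢.hasD_unit _).comp (𝒢.hasD_tgt g) rfl) (hasD_id g)
    (Eventually.of_forall fun q ↦ 𝒢.src_unit _)
  simp only [𝒢.unit_mul] at h
  exact DFunLike.congr_fun (h.unique (hasD_id g)) Y

theorem dm_unit_right (g : G) (X : EG) :
    𝒢.dm g (𝒢.unit (𝒢.src g)) (X, 𝒢.du (𝒢.src g) (𝒢.ds g X)) = X := by
  have h := 𝒢.hasD_mul (hasD_id g) ((𝒢.hasD_unit _).comp (𝒢.hasD_src g) rfl)
    (Eventually.of_forall fun q ↦ (𝒢.tgt_unit _).symm)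
  simp only [𝒢.mul_unit] at h
  exact DFunLike.congr_fun (h.unique (hasD_id g)) X

variable [IsManifold 𝓘(ℝ, EG) ∞ G] [IsManifold 𝓘(ℝ, EM) ∞ M]
  [FiniteDimensional ℝ EG] [FiniteDimensional ℝ EM]

/-- Infinitesimally composable data are realised by composable maps: choose c₁ freely and lift s ∘
c₁ through the submersion t. -/
theorem exists_composable_maps {V : Type*} [NormedAddCommGroup V] [NormedSpace ℝ V] {g h : G}
    (hgh : 𝒢.src g = 𝒢.tgt h) {L₁ L₂ : V →L[ℝ] EG} (hL : (𝒢.ds g).comp L₁ = (𝒢.dt h).comp L₂) :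
    ∃ c₁ c₂ : V → G, ContMDiffAt 𝓘(ℝ, V) 𝓘(ℝ, EG) ∞ c₁ 0 ∧ ContMDiffAt 𝓘(ℝ, V) 𝓘(ℝ, EG) ∞ c₂ 0 ∧
      c₁ 0 = g ∧ c₂ 0 = h ∧ HasD 𝓘(ℝ, V) 𝓘(ℝ, EG) c₁ 0 L₁ ∧ HasD 𝓘(ℝ, V) 𝓘(ℝ, EG) c₂ 0 L₂ ∧
      ∀ᶠ v in 𝓝 0, 𝒢.src (c₁ v) = 𝒢.tgt (c₂ v) := by
  have : CompleteSpace EG := FiniteDimensional.complete ℝ EG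
  obtain ⟨c₁, h1, h2, h3⟩ := exists_map_hasD g (0 : V) L₁
  obtain ⟨c₂, a1, a2, a3, a4⟩ := exists_lift_of_submersion 𝒢.smooth_tgt (𝒢.surjective_dt h)
    (p := fun v ↦ 𝒢.src (c₁ v)) (v₀ := 0)
    (ContMDiffAt.comp (g := 𝒢.src) 0 𝒢.smooth_src.contMDiffAt h1)
    (by rw [h2, hgh]) (L := L₂) (by
      rw [((𝒢.hasD_src g).comp h3 h2).eq_D, hL]; rfl)
  exact ⟨c₁, c₂, h1, a1, h2, a2, h3, a3, a4.mono fun v hv ↦ hv.symm⟩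

variable {𝒢} in
/-- Division from the right in the tangent groupoid. -/
theorem exists_dm_eq_of_ds_eq {g h : G} (hgh : 𝒢.src g = 𝒢.tgt h) {W Y : EG}
    (hW : 𝒢.ds (𝒢.mul g h) W = 𝒢.ds h Y) :
    ∃ X, 𝒢.ds g X = 𝒢.dt h Y ∧ 𝒢.dm g h (X, Y) = W := by
  have : CompleteSpace EG := FiniteDimensional.complete ℝ EG
  obtain ⟨k, k1, k2, k3⟩ := exists_map_hasD (𝒢.mul g h) (0 : ℝ)
    (ContinuousLinearMap.toSpanSingleton ℝ W)
  obtain ⟨η, η1, η2, η3, η4⟩ := exists_lift_of_submersion 𝒢.smooth_src (𝒢.surjective_ds h)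
    (p := fun v ↦ 𝒢.src (k v)) (v₀ := 0)
    (ContMDiffAt.comp (g := 𝒢.src) 0 𝒢.smooth_src.contMDiffAt k1)
    (by rw [k2, 𝒢.src_mul _ _ hgh]) (L := ContinuousLinearMap.toSpanSingleton ℝ Y) (by
      rw [((𝒢.hasD_src _).comp k3 k2).eq_D]
      ext
      simpa [ds, dt] using hW.symm)
  -- The quotient curve k η⁻¹ passes through g, and its velocity is the required X.
  have hinv : ContMDiffAt 𝓘(ℝ, ℝ) 𝓘(ℝ, EG) ∞ (fun v ↦ 𝒢.inv (η v)) 0 :=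
    ContMDiffAt.comp (g := 𝒢.inv) 0 𝒢.smooth_inv.contMDiffAt η1
  have hk : ∀ᶠ v in 𝓝 (0 : ℝ), 𝒢.src (k v) = 𝒢.tgt (𝒢.inv (η v)) :=
    η4.mono fun v hv ↦ by rw [𝒢.tgt_inv, hv]
  have hc0 : 𝒢.mul (k 0) (𝒢.inv (η 0)) = g := by
    rw [k2, η2, 𝒢.mul_assoc _ _ _ hgh (𝒢.tgt_inv h).symm, 𝒢.mul_inv, ← hgh, 𝒢.mul_unit]
  have hc := hasD_of_contMDiffAt (𝒢.contMDiffAt_mul le_rfl k1 hinv hk) (by simp)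
  have hcη : ∀ᶠ v in 𝓝 (0 : ℝ), 𝒢.src (𝒢.mul (k v) (𝒢.inv (η v))) = 𝒢.tgt (η v) :=
    hk.mono fun v hv ↦ by rw [𝒢.src_mul _ _ hv, 𝒢.src_inv]
  have hkk : ∀ᶠ v in 𝓝 (0 : ℝ), k v = 𝒢.mul (𝒢.mul (k v) (𝒢.inv (η v))) (η v) := by
    filter_upwards [hk, η4] with v hv hv'
    rw [𝒢.mul_assoc _ _ _ hv (𝒢.src_inv _), 𝒢.inv_mul, hv', 𝒢.mul_unit]
  have e1 := k3.unique ((𝒢.hasD_mul hc η3 hcη).congr hkk)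
  have e2 := ((𝒢.hasD_src g).comp hc hc0).unique
    (((𝒢.hasD_tgt h).comp η3 η2).congr hcη)
  refine ⟨_, by simpa using DFunLike.congr_fun e2 1, ?_⟩
  beta_reduce at e1
  rw [hc0, η2] at e1
  simpa using (DFunLike.congr_fun e1 1).symm

variable {𝒢} in
/-- Division from the left in the tangent groupoid. -/
theorem exists_dm_eq_of_dt_eq {g h : G} (hgh : 𝒢.src g = 𝒢.tgt h) {W X : EG}
    (hW : 𝒢.dt (𝒢.mul g h) W = 𝒢.dt g X) :
    ∃ Y, 𝒢.ds g X = 𝒢.dt h Y ∧ 𝒢.dm g h (X, Y) = W := by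
  have : CompleteSpace EG := FiniteDimensional.complete ℝ EG
  obtain ⟨k, k1, k2, k3⟩ := exists_map_hasD (𝒢.mul g h) (0 : ℝ)
    (ContinuousLinearMap.toSpanSingleton ℝ W)
  obtain ⟨η, η1, η2, η3, η4⟩ := exists_lift_of_submersion 𝒢.smooth_tgt (𝒢.surjective_dt g)
    (p := fun v ↦ 𝒢.tgt (k v)) (v₀ := 0)
    (ContMDiffAt.comp (g := 𝒢.tgt) 0 𝒢.smooth_tgt.contMDiffAt k1)
    (by rw [k2, 𝒢.tgt_mul _ _ hgh]) (L := ContinuousLinearMap.toSpanSingleton ℝ X) (by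
      rw [((𝒢.hasD_tgt _).comp k3 k2).eq_D]
      ext
      simpa [ds, dt] using hW.symm)
  -- The quotient curve η⁻¹ k passes through h, and its velocity is the required Y.
  have hinv : ContMDiffAt 𝓘(ℝ, ℝ) 𝓘(ℝ, EG) ∞ (fun v ↦ 𝒢.inv (η v)) 0 :=
    ContMDiffAt.comp (g := 𝒢.inv) 0 𝒢.smooth_inv.contMDiffAt η1
  have hk : ∀ᶠ v in 𝓝 (0 : ℝ), 𝒢.src (𝒢.inv (η v)) = 𝒢.tgt (k v) :=
    η4.mono fun v hv ↦ by rw [𝒢.src_inv, hv]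
  have hc0 : 𝒢.mul (𝒢.inv (η 0)) (k 0) = h := by
    rw [k2, η2, ← 𝒢.mul_assoc _ _ _ (𝒢.src_inv g) hgh, 𝒢.inv_mul, hgh, 𝒢.unit_mul]
  have hc := hasD_of_contMDiffAt (𝒢.contMDiffAt_mul le_rfl hinv k1 hk) (by simp)
  have hcη : ∀ᶠ v in 𝓝 (0 : ℝ), 𝒢.tgt (𝒢.mul (𝒢.inv (η v)) (k v)) = 𝒢.src (η v) :=
    hk.mono fun v hv ↦ by rw [𝒢.tgt_mul _ _ hv, 𝒢.tgt_inv]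
  have hkk : ∀ᶠ v in 𝓝 (0 : ℝ), k v = 𝒢.mul (η v) (𝒢.mul (𝒢.inv (η v)) (k v)) := by
    filter_upwards [hk, η4] with v hv hv'
    rw [← 𝒢.mul_assoc _ _ _ (𝒢.tgt_inv _).symm hv, 𝒢.mul_inv, hv', 𝒢.unit_mul]
  have e1 := k3.unique ((𝒢.hasD_mul η3 hc (hcη.mono fun v hv ↦ hv.symm)).congr hkk)
  have e2 := ((𝒢.hasD_tgt h).comp hc hc0).unique
    (((𝒢.hasD_src g).comp η3 η2).congr hcη)
  refine ⟨_, by simpa using (DFunLike.congr_fun e2 1).symm, ?_⟩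
  beta_reduce at e1
  rw [hc0, η2] at e1
  simpa using (DFunLike.congr_fun e1 1).symm

variable {𝒢} in
/-- The exterior derivative of a multiplicative 1-form is multiplicative. -/
theorem IsMult.dform_dm {α : G → EG →L[ℝ] ℝ} {σ : G → ℝ} (hα : 𝒢.IsMult α σ)
    (hs : IsSmoothForm α) (hσ : Continuous σ) (hσ1 : ∀ g, σ g = 1 ∨ σ g = -1) {g h : G}
    (hgh : 𝒢.src g = 𝒢.tgt h) {X Y X' Y' : EG}
    (hXY : 𝒢.ds g X = 𝒢.dt h Y) (hXY' : 𝒢.ds g X' = 𝒢.dt h Y') :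
    dform α (𝒢.mul g h) (𝒢.dm g h (X, Y)) (𝒢.dm g h (X', Y')) =
      dform α g X X' + σ g * dform α h Y Y' := by
  set L : EG → EG → (ℝ × ℝ →L[ℝ] EG) := fun X X' ↦
    (ContinuousLinearMap.toSpanSingleton ℝ X).coprod (ContinuousLinearMap.toSpanSingleton ℝ X')
    with hLdef
  have hL1 : ∀ X X', L X X' (1, 0) = X := fun X X' ↦ by simp [hLdef]
  have hL2 : ∀ X X', L X X' (0, 1) = X' := fun X X' ↦ by simp [hLdef]
  obtain ⟨c₁, c₂, s1, s2, h1, h2, h3, h4, h5⟩ := 𝒢.exists_composable_maps hgh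
    (L₁ := L X X') (L₂ := L Y Y') (by ext <;> simp [hLdef, hXY, hXY'])
  have s3 := 𝒢.contMDiffAt_mul le_rfl s1 s2 h5
  have h6 := 𝒢.hasD_mul h3 h4 h5
  have hG : IsManifold 𝓘(ℝ, EG) 1 G := isManifold_one
  have hd : ∀ {c : ℝ × ℝ → G}, ContMDiffAt 𝓘(ℝ, ℝ × ℝ) 𝓘(ℝ, EG) ∞ c 0 →
      ∀ᶠ v in 𝓝 0, MDifferentiableAt 𝓘(ℝ, ℝ × ℝ) 𝓘(ℝ, EG) c v := by
    intro c hc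
    have : ContMDiffAt 𝓘(ℝ, ℝ × ℝ) 𝓘(ℝ, EG) 1 c 0 := hc.of_le (by exact_mod_cast le_top)
    exact ((contMDiffAt_iff_contMDiffAt_nhds (by simp)).1 this).mono
      fun v hv ↦ hv.mdifferentiableAt (by simp)
  -- Values ±1 closer than 1 coincide, so σ is locally constant and contributes no dσ term.
  have hσc : ∀ᶠ v in 𝓝 (0 : ℝ × ℝ), σ (c₁ v) = σ g := by
    have hc : ContinuousAt (fun v ↦ σ (c₁ v)) 0 := hσ.continuousAt.comp s1.continuousAt
    have := Metric.continuousAt_iff'.1 hc 1 one_pos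
    filter_upwards [this] with v hv
    rw [h1, Real.dist_eq, abs_lt] at hv
    rcases hσ1 (c₁ v) with a | a <;> rcases hσ1 g with b | b <;> rw [a, b] at hv ⊢ <;>
      norm_num at hv
  -- Multiplicativity along two-parameter families is an identity of 1-forms on the plane with the
  -- constant coefficient σ g; its curl at 0 is the claim.
  have key : (fun v ↦ (α (𝒢.mul (c₁ v) (c₂ v))).comp
        (D 𝓘(ℝ, ℝ × ℝ) 𝓘(ℝ, EG) (fun v ↦ 𝒢.mul (c₁ v) (c₂ v)) v)) =ᶠ[𝓝 0]
      fun v ↦ (α (c₁ v)).comp (D 𝓘(ℝ, ℝ × ℝ) 𝓘(ℝ, EG) c₁ v) +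
        σ g • (α (c₂ v)).comp (D 𝓘(ℝ, ℝ × ℝ) 𝓘(ℝ, EG) c₂ v) := by
    filter_upwards [hd s1, hd s2, hσc, eventually_eventually_nhds.2 h5] with v d1 d2 hv hv'
    have a1 := hasD_of_mdifferentiableAt d1
    have a2 := hasD_of_mdifferentiableAt d2
    have a3 := 𝒢.hasD_mul a1 a2 hv'
    have a4 := ((𝒢.hasD_src _).comp a1 rfl).unique (((𝒢.hasD_tgt _).comp a2 rfl).congr hv')
    rw [a3.eq_D]
    refine ContinuousLinearMap.ext fun e ↦ ?_
    have a5 := hα (c₁ v) (c₂ v) hv'.self_of_nhds (D 𝓘(ℝ, ℝ × ℝ) 𝓘(ℝ, EG) c₁ v e)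
      (D 𝓘(ℝ, ℝ × ℝ) 𝓘(ℝ, EG) c₂ v e) (DFunLike.congr_fun a4 e)
    rw [hv] at a5
    exact a5
  have k1 := curl_pullback_eq_dform hs s3 (1, 0) (0, 1)
  rw [curl_congr key, curl_add_const_mul (differentiableAt_pullback hs s1)
    (differentiableAt_pullback hs s2), curl_pullback_eq_dform hs s1, curl_pullback_eq_dform hs s2,
    h6.eq_D, h3.eq_D, h4.eq_D] at k1
  simp only [ContinuousLinearMap.comp_apply, ContinuousLinearMap.prod_apply, hL1, hL2, h1, h2]
    at k1
  exact k1.symm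

end Tangent

end LieGroupoid


/-! ### Linear algebra of contact forms -/

section ContactPair

open Module

variable {V : Type*} [AddCommGroup V] [Module ℝ V]

/-- The pointwise data of a contact form: an alternating form which is nondegenerate on the kernel
of a nonzero linear form. -/
structure IsContactPair (η : V →ₗ[ℝ] V →ₗ[ℝ] ℝ) (a : V →ₗ[ℝ] ℝ) : Prop where
  swap : ∀ v w, η v w = -η w v
  ne_zero : ∃ v, a v ≠ 0
  nondegenerate : ∀ v, a v = 0 → (∀ w, a w = 0 → η v w = 0) → v = 0

/-- The Reeb vector of a contact pair. -/
def IsReeb (η : V →ₗ[ℝ] V →ₗ[ℝ] ℝ) (a : V →ₗ[ℝ] ℝ) (r : V) : Prop :=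
  a r = 1 ∧ ∀ v, η r v = 0

/-- The vector of `ker a` which is dual to the restriction of `-b` to `ker a`. -/
def IsGray (η : V →ₗ[ℝ] V →ₗ[ℝ] ℝ) (a b : V →ₗ[ℝ] ℝ) (x : V) : Prop :=
  a x = 0 ∧ ∀ v, a v = 0 → η x v = -b v

variable {η : V →ₗ[ℝ] V →ₗ[ℝ] ℝ} {a b : V →ₗ[ℝ] ℝ}

theorem IsContactPair.self_eq_zero (h : IsContactPair η a) (v : V) : η v v = 0 := by
  linarith [h.swap v v]

theorem IsContactPair.isReeb_unique (h : IsContactPair η a) {r r' : V} (hr : IsReeb η a r)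
    (hr' : IsReeb η a r') : r = r' := by
  refine sub_eq_zero.1 (h.nondegenerate _ ?_ fun w _ ↦ ?_)
  · rw [map_sub, hr.1, hr'.1, sub_self]
  · rw [map_sub, LinearMap.sub_apply, hr.2, hr'.2, sub_self]

theorem IsContactPair.isGray_unique (h : IsContactPair η a) {x x' : V} (hx : IsGray η a b x)
    (hx' : IsGray η a b x') : x = x' := by
  refine sub_eq_zero.1 (h.nondegenerate _ ?_ fun w hw ↦ ?_)
  · rw [map_sub, hx.1, hx'.1, sub_self]
  · rw [map_sub, LinearMap.sub_apply, hx.2 w hw, hx'.2 w hw, sub_self]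

/-- The condition on ker a is applied to v - a(v) r; the Reeb vector r is in the radical of η. -/
theorem IsGray.apply (h : IsContactPair η a) {r x : V} (hr : IsReeb η a r) (hx : IsGray η a b x)
    (v : V) : η x v = -b v + b r * a v := by
  have h1 := hx.2 (v - a v • r) (by simp [hr.1])
  have h2 := h.swap x r
  rw [hr.2] at h2
  simp only [map_sub, map_smul, h2, smul_eq_mul] at h1
  linarith

/-- The bilinear form `η + a ⊗ a`. -/
def psi (η : V →ₗ[ℝ] V →ₗ[ℝ] ℝ) (a : V →ₗ[ℝ] ℝ) : V →ₗ[ℝ] Dual ℝ V := η + a.smulRight a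

theorem psi_apply (v w : V) : psi η a v w = η v w + a v * a w := by simp [psi]

variable [FiniteDimensional ℝ V]

/-- The map V → (ker a)* induced by η has a kernel for dimension reasons. A nonzero vector in it
cannot lie in ker a, by nondegeneracy, so it can be rescaled. -/
theorem IsContactPair.exists_isReeb (h : IsContactPair η a) : ∃ r, IsReeb η a r := by
  obtain ⟨v₀, hv₀⟩ := h.ne_zero
  have hlt : finrank ℝ (LinearMap.ker a) < finrank ℝ V :=
    Submodule.finrank_lt fun htop ↦ hv₀ (LinearMap.mem_ker.1 (htop ▸ Submodule.mem_top))
  set T : V →ₗ[ℝ] Dual ℝ (LinearMap.ker a) :=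
    (LinearMap.ker a).dualRestrict.comp η with hT
  have hk : LinearMap.ker T ≠ ⊥ := LinearMap.ker_ne_bot_of_finrank_lt (by
    rw [Subspace.dual_finrank_eq]; exact hlt)
  obtain ⟨v, hv, hv0⟩ := (Submodule.ne_bot_iff _).1 hk
  have hvw : ∀ w, a w = 0 → η v w = 0 := fun w hw ↦
    DFunLike.congr_fun (LinearMap.mem_ker.1 hv) (⟨w, hw⟩ : LinearMap.ker a)
  have hav : a v ≠ 0 := fun h0 ↦ hv0 (h.nondegenerate v h0 hvw)
  refine ⟨(a v)⁻¹ • v, by simp [hav], fun w ↦ ?_⟩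
  have h1 := hvw (w - (a w * (a v)⁻¹) • v) (by simp [hav])
  rw [map_sub, map_smul, h.self_eq_zero] at h1
  simp at h1
  simp [h1]

/-- Pairing with the Reeb vector shows that a vanishes on a kernel vector; nondegeneracy finishes.
So contact data are encoded by an invertible bilinear form, which gives existence and smoothness of
Reeb and Gray vectors. -/
theorem IsContactPair.psi_injective (h : IsContactPair η a) : Function.Injective (psi η a) := by
  obtain ⟨r, hr⟩ := h.exists_isReeb
  refine LinearMap.ker_eq_bot.1 ((Submodule.eq_bot_iff _).2 fun v hv ↦ ?_)
  have hv' : ∀ w, η v w + a v * a w = 0 := fun w ↦ by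
    rw [← psi_apply, LinearMap.mem_ker.1 hv]; rfl
  have hav : a v = 0 := by
    have := hv' r
    rwa [h.swap, hr.2, hr.1, neg_zero, zero_add, mul_one] at this
  exact h.nondegenerate v hav fun w _ ↦ by simpa [hav] using hv' w

theorem IsContactPair.exists_psi_eq (h : IsContactPair η a) (f : Dual ℝ V) :
    ∃ v, psi η a v = f :=
  (LinearMap.injective_iff_surjective_of_finrank_eq_finrank
    Subspace.dual_finrank_eq.symm).1 h.psi_injective f

/-- Solve the invertible equation with right-hand side -b + b(r) a; this functional kills r, which
forces a x = 0. -/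
theorem IsContactPair.exists_isGray (h : IsContactPair η a) (b : V →ₗ[ℝ] ℝ) :
    ∃ x, IsGray η a b x := by
  obtain ⟨r, hr⟩ := h.exists_isReeb
  obtain ⟨x, hx⟩ := h.exists_psi_eq (-b + b r • a)
  have hx' : ∀ v, η x v + a x * a v = -b v + b r * a v := fun v ↦ by
    rw [← psi_apply, hx]; rfl
  have h0 : a x = 0 := by
    have := hx' r
    rw [h.swap, hr.2, hr.1] at this
    linarith
  exact ⟨x, h0, fun v hv ↦ by simpa [h0, hv] using hx' v⟩

/-- The right orthogonal of a subspace with respect to `η + a ⊗ a`. -/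
def psiOrth (η : V →ₗ[ℝ] V →ₗ[ℝ] ℝ) (a : V →ₗ[ℝ] ℝ) (K : Submodule ℝ V) : Submodule ℝ V :=
  (K.map (psi η a)).dualCoannihilator

omit [FiniteDimensional ℝ V] in
theorem mem_psiOrth {K : Submodule ℝ V} {y : V} :
    y ∈ psiOrth η a K ↔ ∀ v ∈ K, η v y + a v * a y = 0 := by
  simp [psiOrth, Submodule.mem_dualCoannihilator, psi_apply]

theorem IsContactPair.finrank_psiOrth (h : IsContactPair η a) (K : Submodule ℝ V) :
    finrank ℝ K + finrank ℝ (psiOrth η a K) = finrank ℝ V := by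
  rw [← Subspace.finrank_add_finrank_dualCoannihilator_eq (K.map (psi η a)),
    (Submodule.equivMapOfInjective (psi η a) h.psi_injective K).finrank_eq]
  rfl

/-- U is contained in its orthogonal, which also contains the Reeb vector; the latter is outside ker
a, so the inclusion is strict. -/
theorem IsContactPair.two_mul_finrank_lt (h : IsContactPair η a) {U : Submodule ℝ V}
    (hU : ∀ v ∈ U, a v = 0) (hUU : ∀ v ∈ U, ∀ w ∈ U, η v w = 0) :
    2 * finrank ℝ U + 1 ≤ finrank ℝ V := by
  obtain ⟨r, hr⟩ := h.exists_isReeb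
  have hlt : U < psiOrth η a U := by
    refine lt_of_le_of_ne (fun y hy ↦ mem_psiOrth.2 fun v hv ↦ by simp [hUU v hv y hy, hU v hv])
      fun heq ↦ ?_
    have hrU : r ∈ psiOrth η a U := mem_psiOrth.2 fun v hv ↦ by
      simp [h.swap v r, hr.2, hU v hv]
    rw [← heq] at hrU
    exact one_ne_zero (hr.1.symm.trans (hU r hrU))
  have := Submodule.finrank_lt_finrank_of_lt hlt
  have := h.finrank_psiOrth U
  omega

/-- A maximal isotropic subspace of `ker a` is its own orthogonal in `ker a`. -/
theorem IsContactPair.mem_of_isotropic (h : IsContactPair η a) {U : Submodule ℝ V}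
    (hU : ∀ v ∈ U, a v = 0) (hUU : ∀ v ∈ U, ∀ w ∈ U, η v w = 0)
    (hd : finrank ℝ V ≤ 2 * finrank ℝ U + 1) {x : V} (hx : a x = 0) (hxU : ∀ v ∈ U, η x v = 0) :
    x ∈ U := by
  have hU' : U ≤ LinearMap.ker a := hU
  have hle : U ≤ psiOrth η a U ⊓ LinearMap.ker a :=
    fun y hy ↦ ⟨mem_psiOrth.2 fun v hv ↦ by simp [hUU v hv y hy, hU v hv], hU y hy⟩
  obtain ⟨r, hr⟩ := h.exists_isReeb
  have hlt : psiOrth η a U ⊓ LinearMap.ker a < psiOrth η a U := by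
    refine lt_of_le_of_ne inf_le_left fun heq ↦ ?_
    have hrU : r ∈ psiOrth η a U := mem_psiOrth.2 fun v hv ↦ by
      simp [h.swap v r, hr.2, hU v hv]
    rw [← heq] at hrU
    exact one_ne_zero (hr.1.symm.trans hrU.2)
  have := Submodule.finrank_lt_finrank_of_lt hlt
  have := h.finrank_psiOrth U
  rw [Submodule.eq_of_le_of_finrank_le hle (by omega)]
  exact ⟨mem_psiOrth.2 fun v hv ↦ by simp [h.swap v x, hxU v hv, hU v hv], hx⟩

theorem finrank_le_finrank_inf_ker (a : V →ₗ[ℝ] ℝ) (S : Submodule ℝ V) :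
    finrank ℝ S ≤ finrank ℝ (S ⊓ LinearMap.ker a : Submodule ℝ V) + 1 := by
  have h1 := a.finrank_range_add_finrank_ker
  have h2 : finrank ℝ (LinearMap.range a) ≤ 1 :=
    (Submodule.finrank_le _).trans (finrank_self ℝ).le
  have h3 := Submodule.finrank_sup_add_finrank_inf_eq S (LinearMap.ker a)
  have h4 := Submodule.finrank_le (S ⊔ LinearMap.ker a)
  omega

variable {S T : Submodule ℝ V} {m : ℕ}

omit [FiniteDimensional ℝ V] in
theorem le_psiOrth (hST : ∀ v ∈ S, ∀ w ∈ T, η v w = 0) :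
    T ≤ psiOrth η a (S ⊓ LinearMap.ker a) := fun y hy ↦ mem_psiOrth.2 fun v hv ↦ by
  have : a v = 0 := hv.2
  simp [hST v hv.1 y hy, this]

/-- T lies in the orthogonal of S ∩ ker a, and cutting S by ker a loses at most one dimension; hence
dim V - m ≤ m + 1. -/
theorem IsContactPair.finrank_le (h : IsContactPair η a) (hST : ∀ v ∈ S, ∀ w ∈ T, η v w = 0)
    (hS : finrank ℝ S + m = finrank ℝ V) (hT : finrank ℝ T + m = finrank ℝ V) :
    finrank ℝ V ≤ 2 * m + 1 := by
  have := finrank_le_finrank_inf_ker a S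
  have := h.finrank_psiOrth (S ⊓ LinearMap.ker a)
  have := Submodule.finrank_mono (le_psiOrth (a := a) hST)
  omega

/-- In the extremal dimension the inclusion of T in the orthogonal of S ∩ ker a is an equality: the
orthogonal has dimension at most m + 1 ≤ dim T. -/
theorem IsContactPair.mem_of_orthogonal (h : IsContactPair η a)
    (hST : ∀ v ∈ S, ∀ w ∈ T, η v w = 0) (hS : finrank ℝ S + m = finrank ℝ V)
    (hT : finrank ℝ T + m = finrank ℝ V) (hm : 2 * m + 1 ≤ finrank ℝ V) {y : V}
    (hy : ∀ v ∈ S, a v = 0 → η y v = 0) : y ∈ T := by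
  have := finrank_le_finrank_inf_ker a S
  have := h.finrank_psiOrth (S ⊓ LinearMap.ker a)
  rw [Submodule.eq_of_le_of_finrank_le (le_psiOrth (a := a) hST) (by omega)]
  refine mem_psiOrth.2 fun v hv ↦ ?_
  have hv2 : a v = 0 := hv.2
  simp [h.swap v y, hy v hv.1 hv2, hv2]

end ContactPair


section

variable {E N : Type*} [NormedAddCommGroup E] [NormedSpace ℝ E]
  [TopologicalSpace N] [ChartedSpace E N]

/-- The exterior derivative of a 1-form at a point, as a bilinear map. -/
noncomputable def dformₗ (η : N → E →L[ℝ] ℝ) (x : N) : E →ₗ[ℝ] E →ₗ[ℝ] ℝ :=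
  LinearMap.mk₂ ℝ (dform η x) (dform_add_left η x) (dform_smul_left η x)
    (fun v w w' ↦ by
      rw [dform_swap, dform_add_left, dform_swap η x w, dform_swap η x w']; ring)
    (fun c v w ↦ by rw [dform_swap, dform_smul_left, dform_swap η x w, smul_eq_mul]; ring)

end

/-! ### Multiplicative contact forms -/

namespace LieGroupoid

variable {EG EM G M : Type*}
  [NormedAddCommGroup EG] [NormedSpace ℝ EG] [NormedAddCommGroup EM] [NormedSpace ℝ EM]
  [TopologicalSpace G] [ChartedSpace EG G] [TopologicalSpace M] [ChartedSpace EM M]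

/-- A smooth contact form which is multiplicative with respect to a character with values `±1`. -/
structure IsContactMult (𝒢 : LieGroupoid 𝓘(ℝ, EG) 𝓘(ℝ, EM) G M) (a : G → EG →L[ℝ] ℝ)
    (σ : G → ℝ) : Prop where
  smooth : IsSmoothForm a
  contactPair : ∀ g, IsContactPair (dformₗ a g) (a g : EG →ₗ[ℝ] ℝ)
  mult : 𝒢.IsMult a σ
  continuous_char : Continuous σ
  char_eq : ∀ g, σ g = 1 ∨ σ g = -1
  char_mul : ∀ g h, 𝒢.src g = 𝒢.tgt h → σ (𝒢.mul g h) = σ g * σ h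

variable {𝒢 : LieGroupoid 𝓘(ℝ, EG) 𝓘(ℝ, EM) G M} {a b : G → EG →L[ℝ] ℝ} {σ : G → ℝ}

theorem mul_unit_unit (𝒢 : LieGroupoid 𝓘(ℝ, EG) 𝓘(ℝ, EM) G M) (x : M) :
    𝒢.mul (𝒢.unit x) (𝒢.unit x) = 𝒢.unit x := by
  have := 𝒢.mul_unit (𝒢.unit x)
  rwa [𝒢.src_unit] at this

theorem src_unit_eq_tgt_unit (𝒢 : LieGroupoid 𝓘(ℝ, EG) 𝓘(ℝ, EM) G M) (x : M) :
    𝒢.src (𝒢.unit x) = 𝒢.tgt (𝒢.unit x) := by rw [𝒢.src_unit, 𝒢.tgt_unit]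

theorem unit_mul_of_tgt_eq (𝒢 : LieGroupoid 𝓘(ℝ, EG) 𝓘(ℝ, EM) G M) {x : M} {g : G}
    (h : 𝒢.tgt g = x) : 𝒢.mul (𝒢.unit x) g = g := h ▸ 𝒢.unit_mul g

theorem mul_unit_of_src_eq (𝒢 : LieGroupoid 𝓘(ℝ, EG) 𝓘(ℝ, EM) G M) {x : M} {g : G}
    (h : 𝒢.src g = x) : 𝒢.mul g (𝒢.unit x) = g := h ▸ 𝒢.mul_unit g

theorem dm_unit_unit (𝒢 : LieGroupoid 𝓘(ℝ, EG) 𝓘(ℝ, EM) G M) (x : M) (v : EM) :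
    𝒢.dm (𝒢.unit x) (𝒢.unit x) (𝒢.du x v, 𝒢.du x v) = 𝒢.du x v := by
  have h := 𝒢.hasD_mul (𝒢.hasD_unit x) (𝒢.hasD_unit x)
    (Eventually.of_forall fun q ↦ 𝒢.src_unit_eq_tgt_unit q)
  simp only [𝒢.mul_unit_unit] at h
  exact DFunLike.congr_fun (h.unique (𝒢.hasD_unit x)) v

theorem ds_du_eq_dt_du (𝒢 : LieGroupoid 𝓘(ℝ, EG) 𝓘(ℝ, EM) G M) (x : M) (v : EM) :
    𝒢.ds (𝒢.unit x) (𝒢.du x v) = 𝒢.dt (𝒢.unit x) (𝒢.du x v) := by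
  rw [ds_du, dt_du]

theorem IsContactMult.char_unit (h : 𝒢.IsContactMult a σ) (x : M) : σ (𝒢.unit x) = 1 := by
  have := h.char_mul _ _ (𝒢.src_unit_eq_tgt_unit x)
  rw [𝒢.mul_unit_unit] at this
  rcases h.char_eq (𝒢.unit x) with h | h <;> rw [h] at this ⊢
  norm_num at this

theorem IsContactMult.char_mul_self (h : 𝒢.IsContactMult a σ) (g : G) : σ g * σ g = 1 := by
  rcases h.char_eq g with h | h <;> rw [h] <;> norm_num

/-- Multiplicativity on 1_x · 1_x = 1_x reads b = b + b, because σ is 1 on units. -/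
theorem IsContactMult.mult_du (h : 𝒢.IsContactMult a σ) (hb : 𝒢.IsMult b σ) (x : M) (v : EM) :
    b (𝒢.unit x) (𝒢.du x v) = 0 := by
  have := hb _ _ (𝒢.src_unit_eq_tgt_unit x) _ _ (𝒢.ds_du_eq_dt_du x v)
  rw [dm_unit_unit, 𝒢.mul_unit_unit, h.char_unit] at this
  linarith

theorem dm_du_left {g : G} {x : M} (hx : 𝒢.tgt g = x) {y : EM} {v : EG} (hv : 𝒢.dt g v = y) :
    𝒢.dm (𝒢.unit x) g (𝒢.du x y, v) = v := by
  subst hx hv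
  exact 𝒢.dm_unit_left g v

theorem dm_du_right {g : G} {x : M} (hx : 𝒢.src g = x) {y : EM} {v : EG} (hv : 𝒢.ds g v = y) :
    𝒢.dm g (𝒢.unit x) (v, 𝒢.du x y) = v := by
  subst hx hv
  exact 𝒢.dm_unit_right g v

/-! ### Dimension counts and the kernels of ds and dt -/

open Module

theorem finrank_ker_add [FiniteDimensional ℝ EG] {L : EG →L[ℝ] EM} (hL : Function.Surjective L) :
    finrank ℝ (LinearMap.ker (L : EG →ₗ[ℝ] EM)) + finrank ℝ EM = finrank ℝ EG := by
  rw [← (L : EG →ₗ[ℝ] EM).finrank_range_add_finrank_ker, LinearMap.range_eq_top.2 hL, finrank_top,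
    add_comm]

theorem finrank_range_du (𝒢 : LieGroupoid 𝓘(ℝ, EG) 𝓘(ℝ, EM) G M) (x : M) :
    finrank ℝ (LinearMap.range (𝒢.du x : EM →ₗ[ℝ] EG)) = finrank ℝ EM :=
  LinearMap.finrank_range_of_inj (Function.LeftInverse.injective (g := 𝒢.ds (𝒢.unit x))
    fun v ↦ 𝒢.ds_du x v)

variable [IsManifold 𝓘(ℝ, EG) ∞ G] [IsManifold 𝓘(ℝ, EM) ∞ M]
  [FiniteDimensional ℝ EG] [FiniteDimensional ℝ EM]

theorem IsContactMult.dform_dm (h : 𝒢.IsContactMult a σ) {g k : G} (hgk : 𝒢.src g = 𝒢.tgt k)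
    {X Y X' Y' : EG} (hXY : 𝒢.ds g X = 𝒢.dt k Y) (hXY' : 𝒢.ds g X' = 𝒢.dt k Y') :
    dformₗ a (𝒢.mul g k) (𝒢.dm g k (X, Y)) (𝒢.dm g k (X', Y')) =
      dformₗ a g X X' + σ g * dformₗ a k Y Y' :=
  h.mult.dform_dm h.smooth h.continuous_char h.char_eq hgk hXY hXY'

theorem IsContactMult.dform_du (h : 𝒢.IsContactMult a σ) (x : M) (v w : EM) :
    dformₗ a (𝒢.unit x) (𝒢.du x v) (𝒢.du x w) = 0 := by
  have := h.dform_dm (𝒢.src_unit_eq_tgt_unit x) (𝒢.ds_du_eq_dt_du x v) (𝒢.ds_du_eq_dt_du x w)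
  rw [dm_unit_unit, dm_unit_unit, 𝒢.mul_unit_unit, h.char_unit] at this
  linarith

/-- A vector in the kernel of `ds` at `g` is a right translate of one at a unit. -/
theorem exists_dm_eq_of_ds_eq_zero {g : G} {x : M} (hx : 𝒢.tgt g = x) {v : EG}
    (hv : 𝒢.ds g v = 0) :
    ∃ v₀, 𝒢.ds (𝒢.unit x) v₀ = 0 ∧ 𝒢.dm (𝒢.unit x) g (v₀, 0) = v := by
  have := exists_dm_eq_of_ds_eq (𝒢 := 𝒢) (g := 𝒢.unit x) (h := g) (W := v) (Y := 0)
    (by rw [𝒢.src_unit, hx]) (by rw [𝒢.unit_mul_of_tgt_eq hx, hv, map_zero])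
  simpa using this

/-- A vector in the kernel of `dt` at `g` is a left translate of one at a unit. -/
theorem exists_dm_eq_of_dt_eq_zero {g : G} {x : M} (hx : 𝒢.src g = x) {v : EG}
    (hv : 𝒢.dt g v = 0) :
    ∃ v₀, 𝒢.dt (𝒢.unit x) v₀ = 0 ∧ 𝒢.dm g (𝒢.unit x) (0, v₀) = v := by
  have := exists_dm_eq_of_dt_eq (𝒢 := 𝒢) (g := g) (h := 𝒢.unit x) (W := v) (X := 0)
    (by rw [𝒢.tgt_unit, hx]) (by rw [𝒢.mul_unit_of_src_eq hx, hv, map_zero])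
  simpa [eq_comm] using this

/-- Over the product 1_{t(g)} · g, the vector v is v₀ · 0 and w is 0 · w; each summand of the
multiplicativity formula contains a zero vector. -/
theorem IsContactMult.dform_ker (h : 𝒢.IsContactMult a σ) (g : G) (v w : EG)
    (hv : 𝒢.ds g v = 0) (hw : 𝒢.dt g w = 0) : dformₗ a g v w = 0 := by
  obtain ⟨v₀, h1, h2⟩ := exists_dm_eq_of_ds_eq_zero rfl hv
  have h3 := dm_du_left rfl hw
  rw [map_zero] at h3
  have := h.dform_dm (𝒢.src_unit _) (h1.trans (map_zero (𝒢.dt g)).symm)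
    ((map_zero (𝒢.ds (𝒢.unit (𝒢.tgt g)))).trans hw.symm)
  rw [h2, h3, 𝒢.unit_mul] at this
  simpa using this

/-- The tangent space of the units is isotropic in ker a. Together with `IsContactMult.finrank_le`
this pins dim G to 2 dim M + 1. -/
theorem IsContactMult.two_mul_finrank_lt (h : 𝒢.IsContactMult a σ) (x : M) :
    2 * finrank ℝ EM + 1 ≤ finrank ℝ EG := by
  rw [← 𝒢.finrank_range_du x]
  refine (h.contactPair (𝒢.unit x)).two_mul_finrank_lt ?_ ?_
  · rintro _ ⟨v, rfl⟩
    exact h.mult_du h.mult x v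
  · rintro _ ⟨v, rfl⟩ _ ⟨w, rfl⟩
    exact h.dform_du x v w

theorem IsContactMult.finrank_le (h : 𝒢.IsContactMult a σ) (g : G) :
    finrank ℝ EG ≤ 2 * finrank ℝ EM + 1 :=
  (h.contactPair g).finrank_le (S := LinearMap.ker (𝒢.ds g : EG →ₗ[ℝ] EM))
    (T := LinearMap.ker (𝒢.dt g : EG →ₗ[ℝ] EM)) (fun v hv w hw ↦ h.dform_ker g v w hv hw)
    (finrank_ker_add (𝒢.surjective_ds g)) (finrank_ker_add (𝒢.surjective_dt g))

/-- Extremality of the dimension makes ker dt the full orthogonal of ker ds ∩ ker a. This is the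
test by which projections to M are computed. -/
theorem IsContactMult.dt_eq_zero (h : 𝒢.IsContactMult a σ) {g : G} {y : EG}
    (hy : ∀ v, 𝒢.ds g v = 0 → a g v = 0 → dformₗ a g y v = 0) : 𝒢.dt g y = 0 :=
  (h.contactPair g).mem_of_orthogonal (S := LinearMap.ker (𝒢.ds g : EG →ₗ[ℝ] EM))
    (T := LinearMap.ker (𝒢.dt g : EG →ₗ[ℝ] EM)) (fun v hv w hw ↦ h.dform_ker g v w hv hw)
    (finrank_ker_add (𝒢.surjective_ds g)) (finrank_ker_add (𝒢.surjective_dt g))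
    (h.two_mul_finrank_lt (𝒢.src g)) hy

theorem IsContactMult.ds_eq_zero (h : 𝒢.IsContactMult a σ) {g : G} {y : EG}
    (hy : ∀ v, 𝒢.dt g v = 0 → a g v = 0 → dformₗ a g y v = 0) : 𝒢.ds g y = 0 :=
  (h.contactPair g).mem_of_orthogonal (S := LinearMap.ker (𝒢.dt g : EG →ₗ[ℝ] EM))
    (T := LinearMap.ker (𝒢.ds g : EG →ₗ[ℝ] EM))
    (fun v hv w hw ↦ by
      rw [(h.contactPair g).swap]; exact neg_eq_zero.2 (h.dform_ker g w v hw hv))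
    (finrank_ker_add (𝒢.surjective_dt g)) (finrank_ker_add (𝒢.surjective_ds g))
    (h.two_mul_finrank_lt (𝒢.src g)) hy

/-- The Reeb vector, for a multiplicative contact form. -/
abbrev IsReebAt (a : G → EG →L[ℝ] ℝ) (g : G) (r : EG) : Prop :=
  IsReeb (dformₗ a g) (a g : EG →ₗ[ℝ] ℝ) r

/-- The value at `g` of the vector field used in Gray's argument. -/
abbrev IsGrayAt (a b : G → EG →L[ℝ] ℝ) (g : G) (X : EG) : Prop :=
  IsGray (dformₗ a g) (a g : EG →ₗ[ℝ] ℝ) (b g : EG →ₗ[ℝ] ℝ) X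

/-- The Reeb vector at a unit is in ker ds, since it is orthogonal to everything; its right
translate inherits both Reeb conditions from multiplicativity of a and da. -/
theorem IsContactMult.isReebAt_right (h : 𝒢.IsContactMult a σ) {g : G} {x : M}
    (hx : 𝒢.tgt g = x) {r : EG} (hr : IsReebAt a (𝒢.unit x) r) :
    𝒢.ds (𝒢.unit x) r = 0 ∧ IsReebAt a g (𝒢.dm (𝒢.unit x) g (r, 0)) := by
  have h0 : 𝒢.ds (𝒢.unit x) r = 0 := h.ds_eq_zero fun v _ _ ↦ hr.2 v
  have hu : 𝒢.src (𝒢.unit x) = 𝒢.tgt g := by rw [𝒢.src_unit, hx]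
  have hd : 𝒢.ds (𝒢.unit x) r = 𝒢.dt g 0 := by rw [h0, map_zero]
  refine ⟨h0, ?_, fun v ↦ ?_⟩
  · have := h.mult _ _ hu _ _ hd
    rw [𝒢.unit_mul_of_tgt_eq hx, map_zero, mul_zero, add_zero] at this
    exact this.trans hr.1
  · have := h.dform_dm hu hd (X' := 𝒢.du x (𝒢.dt g v)) (Y' := v) (ds_du _ _ _)
    rw [𝒢.unit_mul_of_tgt_eq hx, dm_du_left hx rfl, hr.2] at this
    simpa using this

/-- On the second factor a and da are scaled by σ g, which the factor σ g = (σ g)⁻¹ undoes. -/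
theorem IsContactMult.isReebAt_left (h : 𝒢.IsContactMult a σ) {g : G} {x : M}
    (hx : 𝒢.src g = x) {r : EG} (hr : IsReebAt a (𝒢.unit x) r) :
    𝒢.dt (𝒢.unit x) r = 0 ∧ IsReebAt a g (σ g • 𝒢.dm g (𝒢.unit x) (0, r)) := by
  have h0 : 𝒢.dt (𝒢.unit x) r = 0 := h.dt_eq_zero fun v _ _ ↦ hr.2 v
  have hu : 𝒢.src g = 𝒢.tgt (𝒢.unit x) := by rw [𝒢.tgt_unit, hx]
  have hd : 𝒢.ds g 0 = 𝒢.dt (𝒢.unit x) r := by rw [h0, map_zero]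
  refine ⟨h0, ?_, fun v ↦ ?_⟩
  · have := h.mult _ _ hu _ _ hd
    have hr1 : a (𝒢.unit x) r = 1 := hr.1
    rw [𝒢.mul_unit_of_src_eq hx, map_zero, zero_add, hr1, mul_one] at this
    simp [this, h.char_mul_self]
  · have := h.dform_dm hu hd (X' := v) (Y' := 𝒢.du x (𝒢.ds g v)) (dt_du _ _ _).symm
    rw [𝒢.mul_unit_of_src_eq hx, dm_du_right hx rfl, hr.2] at this
    rw [map_smul, LinearMap.smul_apply, this]
    simp

/-! ### Invariance of Reeb values and multiplicativity of the Gray field -/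

section Gray

theorem IsContactMult.mult_reeb_tgt (h : 𝒢.IsContactMult a σ) (hb : 𝒢.IsMult b σ) {g : G} {x : M}
    (hx : 𝒢.tgt g = x) {r r' : EG} (hr : IsReebAt a g r) (hr' : IsReebAt a (𝒢.unit x) r') :
    b g r = b (𝒢.unit x) r' := by
  obtain ⟨h0, h1⟩ := h.isReebAt_right hx hr'
  rw [(h.contactPair g).isReeb_unique hr h1]
  have := hb (𝒢.unit x) g (by rw [𝒢.src_unit, hx]) r' 0 (by rw [h0, map_zero])
  rw [𝒢.unit_mul_of_tgt_eq hx] at this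
  simpa using this

/-- Left translation brings two factors σ g, one from the Reeb vector and one from b; they cancel
because σ g = ±1. -/
theorem IsContactMult.mult_reeb_src (h : 𝒢.IsContactMult a σ) (hb : 𝒢.IsMult b σ) {g : G} {x : M}
    (hx : 𝒢.src g = x) {r r' : EG} (hr : IsReebAt a g r) (hr' : IsReebAt a (𝒢.unit x) r') :
    b g r = b (𝒢.unit x) r' := by
  obtain ⟨h0, h1⟩ := h.isReebAt_left hx hr'
  rw [(h.contactPair g).isReeb_unique hr h1]
  have := hb g (𝒢.unit x) (by rw [𝒢.tgt_unit, hx]) 0 r' (by rw [h0, map_zero])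
  rw [𝒢.mul_unit_of_src_eq hx, map_zero, zero_add] at this
  rw [map_smul, this, smul_eq_mul, ← _root_.mul_assoc, h.char_mul_self, one_mul]

/-- Since b vanishes on tangent vectors to the units, X is orthogonal to this maximal isotropic
subspace of ker a, hence belongs to it. -/
theorem IsContactMult.exists_gray_unit (h : 𝒢.IsContactMult a σ) (hb : 𝒢.IsMult b σ) (x : M)
    {X : EG} (hX : IsGrayAt a b (𝒢.unit x) X) : ∃ y, 𝒢.du x y = X :=
  (h.contactPair (𝒢.unit x)).mem_of_isotropic
    (U := LinearMap.range (𝒢.du x : EM →ₗ[ℝ] EG))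
    (by rintro _ ⟨v, rfl⟩; exact h.mult_du h.mult x v)
    (by rintro _ ⟨v, rfl⟩ _ ⟨w, rfl⟩; exact h.dform_du x v w)
    (by rw [𝒢.finrank_range_du]; exact h.finrank_le (𝒢.unit x)) hX.1
    (by
      rintro _ ⟨v, rfl⟩
      refine (hX.2 _ (h.mult_du h.mult x v)).trans (neg_eq_zero.2 (h.mult_du hb x v)))

/-- Compare X with any Y over y. Against v in ker ds ∩ ker a, written as a right translate of v₀,
both da(X, v) and da(Y, v) equal -b(v₀), so X - Y is in ker dt. -/
theorem IsContactMult.dt_gray (h : 𝒢.IsContactMult a σ) (hb : 𝒢.IsMult b σ) {g : G} {x : M}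
    (hx : 𝒢.tgt g = x) {X : EG} (hX : IsGrayAt a b g X) {y : EM}
    (hy : IsGrayAt a b (𝒢.unit x) (𝒢.du x y)) : 𝒢.dt g X = y := by
  obtain ⟨Y, hY⟩ := 𝒢.surjective_dt g y
  rw [← sub_eq_zero, ← hY, ← map_sub]
  refine h.dt_eq_zero fun v hv hav ↦ ?_
  obtain ⟨v₀, h1, h2⟩ := exists_dm_eq_of_ds_eq_zero hx hv
  have hu : 𝒢.src (𝒢.unit x) = 𝒢.tgt g := by rw [𝒢.src_unit, hx]
  have hd : 𝒢.ds (𝒢.unit x) v₀ = 𝒢.dt g 0 := by rw [h1, map_zero]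
  have e1 := h.mult _ _ hu _ _ hd
  have e2 := hb _ _ hu _ _ hd
  have e3 := h.dform_dm hu ((𝒢.ds_du x y).trans hY.symm) hd
  rw [h2, 𝒢.unit_mul_of_tgt_eq hx, map_zero, mul_zero, add_zero] at e1 e2 e3
  rw [dm_du_left hx hY] at e3
  have e4 := hX.2 v hav
  have e5 := hy.2 v₀ (e1.symm.trans hav)
  rw [map_sub, LinearMap.sub_apply, e4, e3, e5]
  simp [e2]

theorem IsContactMult.ds_gray (h : 𝒢.IsContactMult a σ) (hb : 𝒢.IsMult b σ) {g : G} {x : M}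
    (hx : 𝒢.src g = x) {X : EG} (hX : IsGrayAt a b g X) {y : EM}
    (hy : IsGrayAt a b (𝒢.unit x) (𝒢.du x y)) : 𝒢.ds g X = y := by
  obtain ⟨Y, hY⟩ := 𝒢.surjective_ds g y
  rw [← sub_eq_zero, ← hY, ← map_sub]
  refine h.ds_eq_zero fun v hv hav ↦ ?_
  obtain ⟨v₀, h1, h2⟩ := exists_dm_eq_of_dt_eq_zero hx hv
  have hu : 𝒢.src g = 𝒢.tgt (𝒢.unit x) := by rw [𝒢.tgt_unit, hx]
  have hd : 𝒢.ds g 0 = 𝒢.dt (𝒢.unit x) v₀ := by rw [h1, map_zero]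
  have e1 := h.mult _ _ hu _ _ hd
  have e2 := hb _ _ hu _ _ hd
  have e3 := h.dform_dm hu (hY.trans (𝒢.dt_du x y).symm) hd
  rw [h2, 𝒢.mul_unit_of_src_eq hx, map_zero, zero_add] at e1 e2 e3
  rw [dm_du_right hx hY] at e3
  have hσ : σ g ≠ 0 := left_ne_zero_of_mul_eq_one (h.char_mul_self g)
  have e4 := hX.2 v hav
  have e5 := hy.2 v₀ ((mul_eq_zero.1 (e1.symm.trans hav)).resolve_left hσ)
  rw [map_sub, LinearMap.sub_apply, e4, e3, e5]
  simp [e2]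

/-- The vector field used in Gray's argument is multiplicative. -/
theorem IsContactMult.isGrayAt_dm (h : 𝒢.IsContactMult a σ) (hb : 𝒢.IsMult b σ) {g k : G}
    (hgk : 𝒢.src g = 𝒢.tgt k) {X Y : EG} (hX : IsGrayAt a b g X) (hY : IsGrayAt a b k Y)
    (hXY : 𝒢.ds g X = 𝒢.dt k Y) : IsGrayAt a b (𝒢.mul g k) (𝒢.dm g k (X, Y)) := by
  have hX1 : a g X = 0 := hX.1
  have hY1 : a k Y = 0 := hY.1
  refine ⟨(h.mult _ _ hgk _ _ hXY).trans (by rw [hX1, hY1, mul_zero, add_zero]), fun v hv ↦ ?_⟩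
  -- Every vector at a product is a tangent product: lift its source component to k and divide.
  obtain ⟨v₂, hv₂⟩ := 𝒢.surjective_ds k (𝒢.ds (𝒢.mul g k) v)
  obtain ⟨v₁, h1, rfl⟩ := exists_dm_eq_of_ds_eq hgk hv₂.symm
  obtain ⟨r, hr⟩ := (h.contactPair g).exists_isReeb
  obtain ⟨r', hr'⟩ := (h.contactPair k).exists_isReeb
  obtain ⟨r₀, hr₀⟩ := (h.contactPair (𝒢.unit (𝒢.src g))).exists_isReeb
  -- Both Reeb values equal the one at the unit s(g) = t(k), so the two Reeb corrections combine
  -- into a multiple of a(v) = 0.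
  have hH : b g r = b k r' :=
    (h.mult_reeb_src hb rfl hr hr₀).trans (h.mult_reeb_tgt hb hgk.symm hr' hr₀).symm
  have e1 := hX.apply (h.contactPair g) hr v₁
  have e2 := hY.apply (h.contactPair k) hr' v₂
  have e3 := h.mult _ _ hgk _ _ h1
  have e4 := hb _ _ hgk _ _ h1
  have e5 : a (𝒢.mul g k) (𝒢.dm g k (v₁, v₂)) = 0 := hv
  rw [h.dform_dm hgk hXY h1, e1, e2]
  simp only [ContinuousLinearMap.coe_coe, e4, hH]
  rw [e3] at e5
  linear_combination b k r' * e5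

end Gray

end LieGroupoid


/-! ### Smoothness of the vector field in Gray's argument -/

section GrayField

variable {E N : Type*} [NormedAddCommGroup E] [NormedSpace ℝ E]
  [TopologicalSpace N] [ChartedSpace E N]

/-- The coordinate expression of a family of 1-forms. -/
noncomputable def formChart (A : ℝ → N → E →L[ℝ] ℝ) (x₀ : N) (p : ℝ × E) : E →L[ℝ] ℝ :=
  chartForm (A p.1) x₀ p.2

/-- The coordinate expression of the time derivative of a family of 1-forms. -/
noncomputable def derivChart (A : ℝ → N → E →L[ℝ] ℝ) (x₀ : N) (p : ℝ × E) : E →L[ℝ] ℝ :=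
  fderiv ℝ (formChart A x₀) p (1, 0)

/-- The coordinate expression of `dA_t + A_t ⊗ A_t`, for a family of 1-forms `A_t`. -/
noncomputable def psiChart (A : ℝ → N → E →L[ℝ] ℝ) (x₀ : N) (p : ℝ × E) : E →L[ℝ] E →L[ℝ] ℝ :=
  (fderiv ℝ (formChart A x₀) p).comp (ContinuousLinearMap.inr ℝ ℝ E) -
    ((fderiv ℝ (formChart A x₀) p).comp (ContinuousLinearMap.inr ℝ ℝ E)).flip +
    (formChart A x₀ p).smulRight (formChart A x₀ p)

/-- The coordinate expression of the Reeb field. -/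
noncomputable def reebChart (A : ℝ → N → E →L[ℝ] ℝ) (x₀ : N) (p : ℝ × E) : E :=
  (psiChart A x₀ p).inverse (formChart A x₀ p)

variable {A : ℝ → N → E →L[ℝ] ℝ} {I : Set ℝ} {x₀ : N}

theorem contDiffOn_fderiv_formChart (hA : IsSmoothFormFamily A I) (hI : IsOpen I) (x₀ : N) :
    ContDiffOn ℝ ∞ (fderiv ℝ (formChart A x₀)) (I ×ˢ (extChartAt 𝓘(ℝ, E) x₀).target) :=
  (hA x₀).fderiv_of_isOpen (hI.prod (isOpen_extChartAt_target x₀)) (by simp)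

theorem contDiffOn_derivChart (hA : IsSmoothFormFamily A I) (hI : IsOpen I) (x₀ : N) :
    ContDiffOn ℝ ∞ (derivChart A x₀) (I ×ˢ (extChartAt 𝓘(ℝ, E) x₀).target) :=
  (contDiffOn_fderiv_formChart hA hI x₀).clm_apply contDiffOn_const

theorem contDiffOn_psiChart [FiniteDimensional ℝ E] (hA : IsSmoothFormFamily A I) (hI : IsOpen I) (x₀ : N) :
    ContDiffOn ℝ ∞ (psiChart A x₀) (I ×ˢ (extChartAt 𝓘(ℝ, E) x₀).target) := by
  have h1 := (contDiffOn_fderiv_formChart hA hI x₀).clm_comp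
    (contDiffOn_const (c := ContinuousLinearMap.inr ℝ ℝ E))
  have h2 : ContDiffOn ℝ ∞ (fun p ↦ ((fderiv ℝ (formChart A x₀) p).comp
      (ContinuousLinearMap.inr ℝ ℝ E)).flip) (I ×ˢ (extChartAt 𝓘(ℝ, E) x₀).target) :=
    contDiffOn_clm_apply.2 fun v ↦ contDiffOn_clm_apply.2 fun w ↦
      (h1.clm_apply (contDiffOn_const (c := w))).clm_apply (contDiffOn_const (c := v))
  exact (h1.sub h2).add (ContDiffOn.smulRight (hA x₀) (hA x₀))

variable [IsManifold 𝓘(ℝ, E) ∞ N]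

theorem dchart_surjective {x : N} (hx : x ∈ (extChartAt 𝓘(ℝ, E) x₀).source) (v : E) :
    ∃ w, dchart x₀ x w = v := by
  have := dchart_dchartSymm ((extChartAt 𝓘(ℝ, E) x₀).map_source hx) v
  rw [(extChartAt 𝓘(ℝ, E) x₀).left_inv hx] at this
  exact ⟨_, this⟩

theorem psiChart_dchart (hA : IsSmoothFormFamily A I) (hI : IsOpen I) {t : ℝ} (ht : t ∈ I) {x : N}
    (hx : x ∈ (extChartAt 𝓘(ℝ, E) x₀).source) (v w : E) :
    psiChart A x₀ (t, extChartAt 𝓘(ℝ, E) x₀ x) (dchart x₀ x v) (dchart x₀ x w) =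
      psi (dformₗ (A t) x) (A t x : E →ₗ[ℝ] ℝ) v w := by
  have hd : HasFDerivAt (chartForm (A t) x₀) ((fderiv ℝ (formChart A x₀)
      (t, extChartAt 𝓘(ℝ, E) x₀ x)).comp ((0 : E →L[ℝ] ℝ).prod (ContinuousLinearMap.id ℝ E)))
      (extChartAt 𝓘(ℝ, E) x₀ x) :=
    HasFDerivAt.comp (g := formChart A x₀) (extChartAt 𝓘(ℝ, E) x₀ x)
      ((hA.contDiffAt hI (p := (t, extChartAt 𝓘(ℝ, E) x₀ x)) ht
        ((extChartAt 𝓘(ℝ, E) x₀).map_source hx)).differentiableAt (by simp)).hasFDerivAt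
      ((hasFDerivAt_const t (extChartAt 𝓘(ℝ, E) x₀ x)).prodMk
        (hasFDerivAt_id (extChartAt 𝓘(ℝ, E) x₀ x)))
  have h1 : dformₗ (A t) x v w = curl (chartForm (A t) x₀) (extChartAt 𝓘(ℝ, E) x₀ x)
      (dchart x₀ x v) (dchart x₀ x w) := dform_eq_curl (hA.isSmoothForm ht) hx v w
  have h2 := chartForm_dchart (A t) hx
  rw [psi_apply, h1, curl, hd.fderiv]
  simp [-extChartAt, psiChart, formChart, h2]

variable [FiniteDimensional ℝ E]

theorem isInvertible_psiChart (hA : IsSmoothFormFamily A I) (hI : IsOpen I) {t : ℝ} (ht : t ∈ I)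
    {x : N} (hx : x ∈ (extChartAt 𝓘(ℝ, E) x₀).source)
    (hc : IsContactPair (dformₗ (A t) x) (A t x : E →ₗ[ℝ] ℝ)) :
    (psiChart A x₀ (t, extChartAt 𝓘(ℝ, E) x₀ x)).IsInvertible := by
  have hinj : Function.Injective (psiChart A x₀ (t, extChartAt 𝓘(ℝ, E) x₀ x)) := by
    refine (injective_iff_map_eq_zero _).2 fun u hu ↦ ?_
    obtain ⟨v, rfl⟩ := dchart_surjective hx u
    have : v = 0 := hc.psi_injective (by
      rw [map_zero]
      ext w
      rw [← psiChart_dchart hA hI ht hx, hu]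
      rfl)
    rw [this, map_zero]
  have hfr : Module.finrank ℝ E = Module.finrank ℝ (E →L[ℝ] ℝ) := by
    rw [← (LinearMap.toContinuousLinearMap (𝕜 := ℝ) (E := E) (F' := ℝ)).finrank_eq]
    exact Subspace.dual_finrank_eq.symm
  exact ⟨(LinearEquiv.ofInjectiveOfFinrankEq
    (psiChart A x₀ (t, extChartAt 𝓘(ℝ, E) x₀ x) : E →ₗ[ℝ] E →L[ℝ] ℝ)
    hinj hfr).toContinuousLinearEquiv, by ext; rfl⟩

theorem contDiffOn_inverse_psiChart (hA : IsSmoothFormFamily A I) (hI : IsOpen I)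
    (hc : ∀ t ∈ I, ∀ x, IsContactPair (dformₗ (A t) x) (A t x : E →ₗ[ℝ] ℝ)) (x₀ : N) :
    ContDiffOn ℝ ∞ (fun p ↦ (psiChart A x₀ p).inverse)
      (I ×ˢ (extChartAt 𝓘(ℝ, E) x₀).target) := by
  have : CompleteSpace E := FiniteDimensional.complete ℝ E
  rintro ⟨t, y⟩ ⟨ht, hy⟩
  have hinv := isInvertible_psiChart hA hI ht ((extChartAt 𝓘(ℝ, E) x₀).map_target hy) (hc t ht _)
  rw [(extChartAt 𝓘(ℝ, E) x₀).right_inv hy] at hinv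
  exact hinv.contDiffAt_map_inverse.comp_contDiffWithinAt (t, y)
    (contDiffOn_psiChart hA hI x₀ (t, y) ⟨ht, hy⟩)

theorem contDiffOn_reebChart (hA : IsSmoothFormFamily A I) (hI : IsOpen I)
    (hc : ∀ t ∈ I, ∀ x, IsContactPair (dformₗ (A t) x) (A t x : E →ₗ[ℝ] ℝ)) (x₀ : N) :
    ContDiffOn ℝ ∞ (reebChart A x₀) (I ×ˢ (extChartAt 𝓘(ℝ, E) x₀).target) :=
  (contDiffOn_inverse_psiChart hA hI hc x₀).clm_apply (hA x₀)

/-- The Reeb vector is the solution of the invertible equation (η + a ⊗ a)(r) = a, so it depends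
smoothly on the coefficients. -/
theorem reebChart_eq (hA : IsSmoothFormFamily A I) (hI : IsOpen I) {t : ℝ} (ht : t ∈ I)
    {x : N} (hx : x ∈ (extChartAt 𝓘(ℝ, E) x₀).source)
    (hc : IsContactPair (dformₗ (A t) x) (A t x : E →ₗ[ℝ] ℝ)) {r : E}
    (hr : IsReeb (dformₗ (A t) x) (A t x : E →ₗ[ℝ] ℝ) r) :
    reebChart A x₀ (t, extChartAt 𝓘(ℝ, E) x₀ x) = dchart x₀ x r := by
  have h := isInvertible_psiChart hA hI ht hx hc
  refine h.injective ?_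
  rw [reebChart, h.self_apply_inverse]
  ext u
  obtain ⟨v, rfl⟩ := dchart_surjective hx u
  rw [psiChart_dchart hA hI ht hx, psi_apply, hr.2, hr.1, formChart, chartForm_dchart _ hx]
  simp

/-- The vector field in Gray's argument is smooth. -/
theorem isSmoothField_of_isGray (hA : IsSmoothFormFamily A I) (hI : IsOpen I)
    (hc : ∀ t ∈ I, ∀ x, IsContactPair (dformₗ (A t) x) (A t x : E →ₗ[ℝ] ℝ)) {X : ℝ → N → E}
    (hX : ∀ t ∈ I, ∀ x, IsGray (dformₗ (A t) x) (A t x : E →ₗ[ℝ] ℝ)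
      (timeDeriv A t x : E →ₗ[ℝ] ℝ) (X t x)) : IsSmoothField X I := by
  intro x₀
  -- In coordinates the field is the inverse of da + a ⊗ a applied to -ȧ + ȧ(R) a.
  have hs := (contDiffOn_inverse_psiChart hA hI hc x₀).clm_apply
    ((contDiffOn_derivChart hA hI x₀).neg.add
      (((contDiffOn_derivChart hA hI x₀).clm_apply (contDiffOn_reebChart hA hI hc x₀)).smul
        (hA x₀)))
  refine hs.congr ?_
  rintro ⟨t, y⟩ ⟨ht, hy⟩
  change t ∈ I at ht
  change y ∈ (extChartAt 𝓘(ℝ, E) x₀).target at hy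
  have hx := (extChartAt 𝓘(ℝ, E) x₀).map_target hy
  have hyx := (extChartAt 𝓘(ℝ, E) x₀).right_inv hy
  obtain ⟨r, hr⟩ := (hc t ht ((extChartAt 𝓘(ℝ, E) x₀).symm y)).exists_isReeb
  have h := isInvertible_psiChart hA hI ht hx (hc t ht _)
  have hrc := reebChart_eq hA hI ht hx (hc t ht _) hr
  have hb := timeDeriv_eq hA hI ht hx
  have ha := chartForm_dchart (A t) hx
  have hΨ := psiChart_dchart hA hI ht hx
  rw [hyx] at h hrc hb ha hΨ
  refine h.injective ?_
  rw [h.self_apply_inverse]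
  change _ = -derivChart A x₀ (t, y) +
    derivChart A x₀ (t, y) (reebChart A x₀ (t, y)) • chartForm (A t) x₀ y
  rw [hrc]
  ext u
  obtain ⟨v, rfl⟩ := dchart_surjective hx u
  have hXt := hX t ht ((extChartAt 𝓘(ℝ, E) x₀).symm y)
  rw [chartField, hΨ, psi_apply, hXt.apply (hc t ht _) hr, hXt.1]
  have hb' : ∀ w, derivChart A x₀ (t, y) (dchart x₀ ((extChartAt 𝓘(ℝ, E) x₀).symm y) w) =
    timeDeriv A t ((extChartAt 𝓘(ℝ, E) x₀).symm y) w := fun w ↦ (hb w).symm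
  simp [-extChartAt, hb', ha]

/-- The factor in Gray's argument is continuous along curves. -/
theorem continuousAt_timeDeriv_reeb (hA : IsSmoothFormFamily A I) (hI : IsOpen I)
    (hc : ∀ t ∈ I, ∀ x, IsContactPair (dformₗ (A t) x) (A t x : E →ₗ[ℝ] ℝ)) {R : ℝ → N → E}
    (hR : ∀ t ∈ I, ∀ x, IsReeb (dformₗ (A t) x) (A t x : E →ₗ[ℝ] ℝ) (R t x))
    {γ : ℝ → N} {t : ℝ} (ht : t ∈ I) (hγ : ContinuousAt γ t) :
    ContinuousAt (fun s ↦ timeDeriv A s (γ s) (R s (γ s))) t := by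
  have hx := mem_extChartAt_source (I := 𝓘(ℝ, E)) (γ t)
  have hs : ContinuousAt (fun p ↦ derivChart A (γ t) p (reebChart A (γ t) p))
      (t, extChartAt 𝓘(ℝ, E) (γ t) (γ t)) :=
    ((contDiffOn_derivChart hA hI (γ t)).clm_apply (contDiffOn_reebChart hA hI hc
      (γ t))).continuousOn.continuousAt ((hI.prod (isOpen_extChartAt_target _)).mem_nhds
        ⟨ht, mem_extChartAt_target _⟩)
  have hcomp : ContinuousAt (fun s ↦ (s, extChartAt 𝓘(ℝ, E) (γ t) (γ s))) t :=
    continuousAt_id.prodMk (ContinuousAt.comp (g := extChartAt 𝓘(ℝ, E) (γ t))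
      (continuousAt_extChartAt (γ t)) hγ)
  refine (ContinuousAt.comp (g := fun p ↦ derivChart A (γ t) p (reebChart A (γ t) p))
    (f := fun s ↦ (s, extChartAt 𝓘(ℝ, E) (γ t) (γ s))) hs hcomp).congr ?_
  filter_upwards [hI.mem_nhds ht,
    hγ.eventually_mem ((isOpen_extChartAt_source (γ t)).mem_nhds hx)] with s hs hγs
  simp only [Function.comp_apply]
  rw [reebChart_eq hA hI hs hγs (hc s hs _) (hR s hs _), timeDeriv_eq hA hI hs hγs]
  rfl

end GrayField


/-! ### Gray's argument -/

section Gray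

variable {E N : Type*} [NormedAddCommGroup E] [NormedSpace ℝ E] [FiniteDimensional ℝ E]
  [TopologicalSpace N] [ChartedSpace E N] [IsManifold 𝓘(ℝ, E) ∞ N]

/-- The logarithm of the conformal factor in Gray's argument. -/
noncomputable def grayFactor (A : ℝ → N → E →L[ℝ] ℝ) (R : ℝ → N → E) (Φ : ℝ → N → N) (t : ℝ)
    (x : N) : ℝ :=
  ∫ s in (0 : ℝ)..t, timeDeriv A s (Φ s x) (R s (Φ s x))

/-- A family of maps `Φ_t`, with `Φ_0 = id`, generated by the vector field in Gray's argument for the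
family of contact forms `A_t`. The `R_t` are the Reeb fields. -/
structure IsGrayIsotopy (A : ℝ → N → E →L[ℝ] ℝ) (R X : ℝ → N → E) (I : Set ℝ) (Φ : ℝ → N → N) :
    Prop where
  isOpen : IsOpen I
  ordConnected : I.OrdConnected
  zero_mem : 0 ∈ I
  smooth_form : IsSmoothFormFamily A I
  contactPair : ∀ t ∈ I, ∀ x, IsContactPair (dformₗ (A t) x) (A t x : E →ₗ[ℝ] ℝ)
  isReeb : ∀ t ∈ I, ∀ x, IsReeb (dformₗ (A t) x) (A t x : E →ₗ[ℝ] ℝ) (R t x)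
  isGray : ∀ t ∈ I, ∀ x, IsGray (dformₗ (A t) x) (A t x : E →ₗ[ℝ] ℝ)
      (timeDeriv A t x : E →ₗ[ℝ] ℝ) (X t x)
  smooth : ContMDiffOn (𝓘(ℝ, ℝ).prod 𝓘(ℝ, E)) 𝓘(ℝ, E) ∞ (fun p : ℝ × N ↦ Φ p.1 p.2) (I ×ˢ univ)
  isSolAt : ∀ t ∈ I, ∀ x, IsSolAt X (fun s ↦ Φ s x) t
  zero : ∀ x, Φ 0 x = x

variable {A : ℝ → N → E →L[ℝ] ℝ} {R X : ℝ → N → E} {I : Set ℝ} {Φ : ℝ → N → N}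

theorem IsGrayIsotopy.hasDerivAt_grayFactor (h : IsGrayIsotopy A R X I Φ) {t : ℝ} (ht : t ∈ I)
    (x : N) : HasDerivAt (fun s ↦ grayFactor A R Φ s x)
      (timeDeriv A t (Φ t x) (R t (Φ t x))) t := by
  have hc : ∀ s ∈ I, ContinuousAt (fun s ↦ timeDeriv A s (Φ s x) (R s (Φ s x))) s := fun s hs ↦
    continuousAt_timeDeriv_reeb h.smooth_form h.isOpen h.contactPair h.isReeb hs
      (h.isSolAt s hs x).continuousAt
  have hc' : ContinuousOn (fun s ↦ timeDeriv A s (Φ s x) (R s (Φ s x))) I :=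
    fun s hs ↦ (hc s hs).continuousWithinAt
  exact intervalIntegral.integral_hasDerivAt_right
    ((hc'.mono (h.ordConnected.uIcc_subset h.zero_mem ht)).intervalIntegrable)
    (hc'.stronglyMeasurableAtFilter h.isOpen t ht) (hc t ht)

/-- For fixed x and u the pulled-back value c satisfies c' = ȧ(R) c by Cartan's formula, so c ·
exp(-∫ȧ(R)) is constant on the interval. -/
theorem IsGrayIsotopy.pullback_eq (h : IsGrayIsotopy A R X I Φ) {t : ℝ} (ht : t ∈ I)
    (x : N) (u : E) : A t (Φ t x) (D 𝓘(ℝ, E) 𝓘(ℝ, E) (Φ t) x u) =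
      Real.exp (grayFactor A R Φ t x) * A 0 x u := by
  set c : ℝ → ℝ := fun s ↦ A s (Φ s x) (D 𝓘(ℝ, E) 𝓘(ℝ, E) (Φ s) x u) with hc
  have hcd : ∀ s ∈ I, HasDerivAt c (timeDeriv A s (Φ s x) (R s (Φ s x)) * c s) s := fun s hs ↦ by
    have h1 := hasDerivAt_pullback_along_flow h.smooth_form
      (isSmoothField_of_isGray h.smooth_form h.isOpen h.contactPair h.isGray) h.isOpen
      (fun s hs y ↦ (h.isGray s hs y).1) h.smooth h.isSolAt hs x u
    refine h1.congr_deriv ?_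
    have h2 := (h.isGray s hs (Φ s x)).apply (h.contactPair s hs _) (h.isReeb s hs _)
      (D 𝓘(ℝ, E) 𝓘(ℝ, E) (Φ s) x u)
    change dform (A s) (Φ s x) (X s (Φ s x)) _ = _ at h2
    rw [h2]
    simp [hc]
  have hd : ∀ s ∈ I, HasDerivAt (fun s ↦ c s * Real.exp (-grayFactor A R Φ s x)) 0 s :=
    fun s hs ↦ ((hcd s hs).mul (h.hasDerivAt_grayFactor hs x).neg.exp).congr_deriv (by
      ring)
  have h3 := h.isOpen.is_const_of_deriv_eq_zero h.ordConnected.isPreconnected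
    (fun s hs ↦ (hd s hs).differentiableAt.differentiableWithinAt) (fun s hs ↦ (hd s hs).deriv)
    ht h.zero_mem
  have h0 : c 0 = A 0 x u := by
    have : D 𝓘(ℝ, E) 𝓘(ℝ, E) (Φ 0) x = ContinuousLinearMap.id ℝ E := by
      rw [show Φ 0 = fun z ↦ z from funext h.zero]
      exact (hasD_id x).eq_D
    simp only [hc, this, h.zero]
    rfl
  simp only [h0, show grayFactor A R Φ 0 x = 0 from intervalIntegral.integral_same, neg_zero,
    Real.exp_zero, mul_one, Real.exp_neg] at h3
  rw [← h3, mul_comm, mul_assoc, inv_mul_cancel₀ (Real.exp_pos _).ne', mul_one]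

/-- Instead of differentiating under the integral, read the factor off `IsGrayIsotopy.pullback_eq`:
it is the logarithm of A_t(dΦ_t u) / A_0(u), a quotient of smooth functions, for any u with A_0(u) ≠
0. -/
theorem IsGrayIsotopy.contMDiffOn_grayFactor (h : IsGrayIsotopy A R X I Φ) :
    ContMDiffOn (𝓘(ℝ, ℝ).prod 𝓘(ℝ, E)) 𝓘(ℝ, ℝ) ∞ (fun p : ℝ × N ↦ grayFactor A R Φ p.1 p.2)
      (I ×ˢ univ) := by
  rintro ⟨t, x₀⟩ ⟨ht, -⟩
  change t ∈ I at ht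
  refine ContMDiffAt.contMDiffWithinAt ?_
  set x₁ := Φ t x₀ with hx₁
  set y := extChartAt 𝓘(ℝ, E) x₀ x₀ with hy
  have hxs := mem_extChartAt_source (I := 𝓘(ℝ, E)) x₀
  have hyt : y ∈ (extChartAt 𝓘(ℝ, E) x₀).target := mem_extChartAt_target x₀
  have hyx : (extChartAt 𝓘(ℝ, E) x₀).symm y = x₀ := (extChartAt 𝓘(ℝ, E) x₀).left_inv hxs
  have h₁ : Φ t ((extChartAt 𝓘(ℝ, E) x₀).symm y) ∈ (extChartAt 𝓘(ℝ, E) x₁).source := by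
    rw [hyx]; exact mem_extChartAt_source x₁
  obtain ⟨u, hu⟩ := (h.contactPair 0 h.zero_mem x₀).ne_zero
  change A 0 x₀ u ≠ 0 at hu
  -- The coordinate vector e is frozen in the chart at x₀, so the denominator stays nonzero nearby.
  set e := dchart x₀ x₀ u with he
  have hψ := contDiffAt_chartMap h.isOpen h.smooth ht hyt h₁
  have hψx : chartMap Φ x₀ x₁ (t, y) ∈ (extChartAt 𝓘(ℝ, E) x₁).target :=
    (extChartAt 𝓘(ℝ, E) x₁).map_source h₁
  have hden : ContDiffAt ℝ ∞ (fun p : ℝ × E ↦ chartForm (A 0) x₀ p.2 e) (t, y) :=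
    (ContDiffAt.comp (g := chartForm (A 0) x₀) (t, y)
      (((h.smooth_form.isSmoothForm h.zero_mem) x₀).contDiffAt
        ((isOpen_extChartAt_target x₀).mem_nhds hyt)) contDiffAt_snd).clm_apply contDiffAt_const
  have hden0 : chartForm (A 0) x₀ y e ≠ 0 := by
    rw [he, hy, chartForm_dchart _ hxs]; exact hu
  have hnum : ContDiffAt ℝ ∞ (fun p : ℝ × E ↦ chartForm (A p.1) x₁ (chartMap Φ x₀ x₁ p)
      (fderiv ℝ (chartMap Φ x₀ x₁) p (0, e))) (t, y) :=
    (ContDiffAt.comp (g := fun p : ℝ × E ↦ chartForm (A p.1) x₁ p.2)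
      (f := fun p ↦ (p.1, chartMap Φ x₀ x₁ p)) (t, y)
      (h.smooth_form.contDiffAt h.isOpen ht hψx) (contDiffAt_fst.prodMk hψ)).clm_apply
      ((hψ.fderiv_right (by simp)).clm_apply contDiffAt_const)
  have hev := eventually_mem_source_chart h.isOpen h.smooth ht hyt h₁
  have heq : (fun p : ℝ × E ↦ grayFactor A R Φ p.1 ((extChartAt 𝓘(ℝ, E) x₀).symm p.2))
      =ᶠ[𝓝 (t, y)] fun p ↦ Real.log (chartForm (A p.1) x₁ (chartMap Φ x₀ x₁ p)
        (fderiv ℝ (chartMap Φ x₀ x₁) p (0, e)) / chartForm (A 0) x₀ p.2 e) := by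
    filter_upwards [hev, hden.continuousAt.eventually_ne hden0] with p hp hp0
    rw [chartForm_chartMap h.isOpen h.smooth hp.1 hp.2.1 hp.2.2, h.pullback_eq hp.1]
    change chartForm (A 0) x₀ p.2 e ≠ 0 at hp0
    rw [show A 0 ((extChartAt 𝓘(ℝ, E) x₀).symm p.2) (dchartSymm x₀ p.2 e) =
      chartForm (A 0) x₀ p.2 e from rfl, mul_div_cancel_right₀ _ hp0, Real.log_exp]
  have hquot := hnum.div hden hden0
  have hne : chartForm (A t) x₁ (chartMap Φ x₀ x₁ (t, y))
        (fderiv ℝ (chartMap Φ x₀ x₁) (t, y) (0, e)) / chartForm (A 0) x₀ y e ≠ 0 := by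
    rw [chartForm_chartMap h.isOpen h.smooth ht hyt h₁, h.pullback_eq ht]
    rw [show A 0 ((extChartAt 𝓘(ℝ, E) x₀).symm y) (dchartSymm x₀ y e) =
      chartForm (A 0) x₀ y e from rfl, mul_div_cancel_right₀ _ hden0]
    exact (Real.exp_pos _).ne'
  have hlog := (hquot.log hne).congr_of_eventuallyEq heq
  have hφ : ContMDiffAt (𝓘(ℝ, ℝ).prod 𝓘(ℝ, E)) 𝓘(ℝ, ℝ × E) ∞
      (fun p : ℝ × N ↦ (p.1, extChartAt 𝓘(ℝ, E) x₀ p.2)) (t, x₀) :=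
    contMDiffAt_fst.prodMk_space (ContMDiffAt.comp (g := extChartAt 𝓘(ℝ, E) x₀) (t, x₀)
      contMDiffAt_extChartAt contMDiffAt_snd)
  have hcomp := ContMDiffAt.comp
    (g := fun p : ℝ × E ↦ grayFactor A R Φ p.1 ((extChartAt 𝓘(ℝ, E) x₀).symm p.2))
    (f := fun p : ℝ × N ↦ (p.1, extChartAt 𝓘(ℝ, E) x₀ p.2)) (t, x₀) hlog.contMDiffAt hφ
  refine hcomp.congr_of_eventuallyEq ?_
  filter_upwards [continuousAt_snd.eventually_mem
    ((isOpen_extChartAt_source (I := 𝓘(ℝ, E)) x₀).mem_nhds hxs)] with p hp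
  simp only [Function.comp_apply]
  rw [(extChartAt 𝓘(ℝ, E) x₀).left_inv hp]

end Gray

/-! ### Multiplicativity of Gray's isotopy -/

namespace LieGroupoid

variable {EG EM G M : Type*}
  [NormedAddCommGroup EG] [NormedSpace ℝ EG] [NormedAddCommGroup EM] [NormedSpace ℝ EM]
  [TopologicalSpace G] [ChartedSpace EG G] [TopologicalSpace M] [ChartedSpace EM M]
  {𝒢 : LieGroupoid 𝓘(ℝ, EG) 𝓘(ℝ, EM) G M} {A : ℝ → G → EG →L[ℝ] ℝ} {σ : G → ℝ} {I : Set ℝ}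

/-- The multiplicativity equation is linear in the form, and σ does not depend on time. -/
theorem isMult_timeDeriv [IsManifold 𝓘(ℝ, EG) ∞ G] (hA : IsSmoothFormFamily A I) (hI : IsOpen I)
    (h : ∀ t ∈ I, 𝒢.IsMult (A t) σ) {t : ℝ} (ht : t ∈ I) : 𝒢.IsMult (timeDeriv A t) σ := by
  intro g k hgk X Y hXY
  refine (hasDerivAt_timeDeriv hA hI ht _ _).unique (((hasDerivAt_timeDeriv hA hI ht g X).add
    ((hasDerivAt_timeDeriv hA hI ht k Y).const_mul (σ g))).congr_of_eventuallyEq ?_)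
  filter_upwards [hI.mem_nhds ht] with s hs
  exact h s hs g k hgk X Y hXY

variable [IsManifold 𝓘(ℝ, EG) ∞ G] [IsManifold 𝓘(ℝ, EM) ∞ M]
  [FiniteDimensional ℝ EG] [FiniteDimensional ℝ EM]
  {R X : ℝ → G → EG} {ev : ℝ → ℝ → G → G}

/-- The evolution of the vector field in Gray's argument, for a family of multiplicative contact
forms. -/
structure IsGrayEvolution (𝒢 : LieGroupoid 𝓘(ℝ, EG) 𝓘(ℝ, EM) G M) (A : ℝ → G → EG →L[ℝ] ℝ)
    (σ : G → ℝ) (I : Set ℝ) (X : ℝ → G → EG) (ev : ℝ → ℝ → G → G) : Prop where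
  isOpen : IsOpen I
  ordConnected : I.OrdConnected
  smooth_form : IsSmoothFormFamily A I
  isContactMult : ∀ t ∈ I, 𝒢.IsContactMult (A t) σ
  isGray : ∀ t ∈ I, ∀ g, IsGrayAt (A t) (timeDeriv A t) g (X t g)
  isEvolution : IsEvolution X I ev

variable (h : 𝒢.IsGrayEvolution A σ I X ev)
include h

namespace IsGrayEvolution

omit [IsManifold 𝓘(ℝ, EM) ∞ M] [FiniteDimensional ℝ EM] in
theorem isSmoothField : IsSmoothField X I :=
  isSmoothField_of_isGray h.smooth_form h.isOpen (fun t ht ↦ (h.isContactMult t ht).contactPair)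
    h.isGray

omit [IsManifold 𝓘(ℝ, EM) ∞ M] [FiniteDimensional ℝ EG] [FiniteDimensional ℝ EM] in
theorem isMult {t : ℝ} (ht : t ∈ I) : 𝒢.IsMult (timeDeriv A t) σ :=
  isMult_timeDeriv h.smooth_form h.isOpen (fun t ht ↦ (h.isContactMult t ht).mult) ht

/-- The field is s-related to its own restriction to the units, which is tangent to them. -/
theorem du_ds {t : ℝ} (ht : t ∈ I) (g : G) :
    𝒢.du (𝒢.src g) (𝒢.ds g (X t g)) = X t (𝒢.unit (𝒢.src g)) := by
  have hX := h.isGray t ht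
  obtain ⟨y, hy⟩ := (h.isContactMult t ht).exists_gray_unit (h.isMult ht) _ (hX (𝒢.unit (𝒢.src g)))
  rw [(h.isContactMult t ht).ds_gray (h.isMult ht) rfl (hX g) (hy ▸ hX _), hy]

theorem du_dt {t : ℝ} (ht : t ∈ I) (g : G) :
    𝒢.du (𝒢.tgt g) (𝒢.dt g (X t g)) = X t (𝒢.unit (𝒢.tgt g)) := by
  have hX := h.isGray t ht
  obtain ⟨y, hy⟩ := (h.isContactMult t ht).exists_gray_unit (h.isMult ht) _ (hX (𝒢.unit (𝒢.tgt g)))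
  rw [(h.isContactMult t ht).dt_gray (h.isMult ht) rfl (hX g) (hy ▸ hX _), hy]

variable [T2Space G] {s t : ℝ}

/-- By `du_ds`, the map g ↦ 1_{s(g)} sends integral curves to integral curves; uniqueness concludes.
-/
theorem unit_src (hs : s ∈ I) (ht : t ∈ I) (g : G) :
    𝒢.unit (𝒢.src (ev t s g)) = ev t s (𝒢.unit (𝒢.src g)) := by
  have := h.isEvolution.eq_of_isSolAt h.isSmoothField h.isOpen subset_rfl h.isOpen h.ordConnected
    (γ := fun r ↦ 𝒢.unit (𝒢.src (ev r s g))) (fun r hr ↦ ?_) hs ht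
  · simpa only [h.isEvolution.self s hs] using this
  · have h1 := (𝒢.hasD_unit _).comp ((𝒢.hasD_src _).comp (h.isEvolution.isSolAt s hs r hr g) rfl) rfl
    have h2 := h.du_ds hr (ev r s g)
    unfold IsSolAt
    rw [← h2]
    convert h1 using 1
    ext
    simp

theorem unit_tgt (hs : s ∈ I) (ht : t ∈ I) (g : G) :
    𝒢.unit (𝒢.tgt (ev t s g)) = ev t s (𝒢.unit (𝒢.tgt g)) := by
  have := h.isEvolution.eq_of_isSolAt h.isSmoothField h.isOpen subset_rfl h.isOpen h.ordConnected
    (γ := fun r ↦ 𝒢.unit (𝒢.tgt (ev r s g))) (fun r hr ↦ ?_) hs ht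
  · simpa only [h.isEvolution.self s hs] using this
  · have h1 := (𝒢.hasD_unit _).comp ((𝒢.hasD_tgt _).comp (h.isEvolution.isSolAt s hs r hr g) rfl) rfl
    have h2 := h.du_dt hr (ev r s g)
    unfold IsSolAt
    rw [← h2]
    convert h1 using 1
    ext
    simp

theorem src_eq_tgt (hs : s ∈ I) (ht : t ∈ I) {g k : G} (hgk : 𝒢.src g = 𝒢.tgt k) :
    𝒢.src (ev t s g) = 𝒢.tgt (ev t s k) := by
  have := (h.unit_src hs ht g).trans ((congrArg (fun x ↦ ev t s (𝒢.unit x)) hgk).trans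
    (h.unit_tgt hs ht k).symm)
  rw [← 𝒢.src_unit (𝒢.src (ev t s g)), this, 𝒢.src_unit]

/-- The product of two composable integral curves has velocity `dm` of the two velocities, which is
again the Gray vector; uniqueness of Gray vectors and of integral curves concludes. -/
theorem map_mul (hs : s ∈ I) (ht : t ∈ I) {g k : G} (hgk : 𝒢.src g = 𝒢.tgt k) :
    ev t s (𝒢.mul g k) = 𝒢.mul (ev t s g) (ev t s k) := by
  have := h.isEvolution.eq_of_isSolAt h.isSmoothField h.isOpen subset_rfl h.isOpen h.ordConnected
    (γ := fun r ↦ 𝒢.mul (ev r s g) (ev r s k)) (fun r hr ↦ ?_) hs ht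
  · simpa only [h.isEvolution.self s hs] using this.symm
  · have e1 := h.isEvolution.isSolAt s hs r hr g
    have e2 := h.isEvolution.isSolAt s hs r hr k
    have hc : ∀ᶠ q in 𝓝 r, 𝒢.src (ev q s g) = 𝒢.tgt (ev q s k) := by
      filter_upwards [h.isOpen.mem_nhds hr] with q hq
      exact h.src_eq_tgt hs hq hgk
    have h1 := 𝒢.hasD_mul e1 e2 hc
    have hd := DFunLike.congr_fun (((𝒢.hasD_src _).comp e1 rfl).unique
      (((𝒢.hasD_tgt _).comp e2 rfl).congr hc)) 1
    simp only [ContinuousLinearMap.comp_apply, ContinuousLinearMap.toSpanSingleton_apply,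
      one_smul] at hd
    have h2 := ((h.isContactMult r hr).contactPair _).isGray_unique
      (h.isGray r hr (𝒢.mul (ev r s g) (ev r s k)))
      ((h.isContactMult r hr).isGrayAt_dm (h.isMult hr) hc.self_of_nhds
        (h.isGray r hr _) (h.isGray r hr _) hd)
    unfold IsSolAt
    rw [h2]
    convert h1 using 1
    ext
    simp

variable {R : ℝ → G → EG}

/-- The integrands agree at every time: the flow commutes with passing to the source unit, and the
Reeb value is the same at an arrow and at that unit. -/
theorem grayFactor_src (h0 : 0 ∈ I) (hR : ∀ t ∈ I, ∀ g, IsReebAt (A t) g (R t g)) (ht : t ∈ I)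
    (g : G) : grayFactor A R (fun r ↦ ev r 0) t (𝒢.unit (𝒢.src g)) =
      grayFactor A R (fun r ↦ ev r 0) t g := by
  refine intervalIntegral.integral_congr fun s hs ↦ ?_
  have hs : s ∈ I := h.ordConnected.uIcc_subset h0 ht hs
  simp only [← h.unit_src h0 hs g]
  exact ((h.isContactMult s hs).mult_reeb_src (h.isMult hs) rfl (hR s hs _) (hR s hs _)).symm

theorem grayFactor_tgt (h0 : 0 ∈ I) (hR : ∀ t ∈ I, ∀ g, IsReebAt (A t) g (R t g)) (ht : t ∈ I)
    (g : G) : grayFactor A R (fun r ↦ ev r 0) t (𝒢.unit (𝒢.tgt g)) =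
      grayFactor A R (fun r ↦ ev r 0) t g := by
  refine intervalIntegral.integral_congr fun s hs ↦ ?_
  have hs : s ∈ I := h.ordConnected.uIcc_subset h0 ht hs
  simp only [← h.unit_tgt h0 hs g]
  exact ((h.isContactMult s hs).mult_reeb_tgt (h.isMult hs) rfl (hR s hs _) (hR s hs _)).symm

end IsGrayEvolution

end LieGroupoid


/-! ### Smooth 1-forms in coordinates -/

section Coordinates

variable {V E H N : Type*} [NormedAddCommGroup V] [NormedSpace ℝ V]
  [NormedAddCommGroup E] [NormedSpace ℝ E] [TopologicalSpace H]
  [TopologicalSpace N] [ChartedSpace H N] {J : ModelWithCorners ℝ E H} [IsManifold J ∞ N]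

/-- Translates smoothness as a bundle section into coordinates: pair η with the tangent map of j on
the constant field e and keep the fibre component. -/
theorem Form1.IsSmooth.contDiffOn_pullback_apply {η : Form1 J N} (hη : Form1.IsSmooth η)
    {j : V → N} {s : Set V} (hs : IsOpen s) (hj : ContMDiffOn 𝓘(ℝ, V) J ∞ j s) (e : V) :
    ContDiffOn ℝ ∞ (fun p ↦ Form1.pullback (I := 𝓘(ℝ, V)) j η p e) s := by
  have : IsManifold J 1 N := IsManifold.of_le (n := ∞) (by exact_mod_cast le_top)
  have h1 : ContMDiffOn 𝓘(ℝ, V).tangent J.tangent ∞ (tangentMapWithin 𝓘(ℝ, V) J j s)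
      (Bundle.TotalSpace.proj ⁻¹' s) :=
    hj.contMDiffOn_tangentMapWithin (by simp) hs.uniqueMDiffOn
  have h2 : ContMDiff 𝓘(ℝ, V) 𝓘(ℝ, V).tangent ∞
      (fun p : V ↦ (⟨p, e⟩ : TangentBundle 𝓘(ℝ, V) V)) := by
    have h : ContMDiff 𝓘(ℝ, V) (𝓘(ℝ, V).prod 𝓘(ℝ, V)) ∞ (fun p : V ↦ (p, e)) :=
      contMDiff_id.prodMk contMDiff_const
    rw [chartedSpaceSelf_prod] at h
    refine ((contMDiff_tangentBundleModelSpaceHomeomorph_symm (I := 𝓘(ℝ, V)) (n := ∞)).comp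
      h).congr fun p ↦ ?_
    rw [Function.comp_apply, tangentBundleModelSpaceHomeomorph_coe_symm]
    rfl
  have h3 := h1.comp (f := fun p : V ↦ (⟨p, e⟩ : TangentBundle 𝓘(ℝ, V) V)) h2.contMDiffOn
    (s := s) (fun p hp ↦ hp)
  have h4 : ContMDiffOn 𝓘(ℝ, V) (J.prod 𝓘(ℝ, E →L[ℝ] ℝ)) ∞
      (fun p ↦ Bundle.TotalSpace.mk' (E →L[ℝ] ℝ)
        (E := fun x : N ↦ (TangentSpace J x →L[ℝ] ℝ)) (j p) (η (j p))) s :=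
    ContMDiff.comp_contMDiffOn (g := fun x ↦ Bundle.TotalSpace.mk' (E →L[ℝ] ℝ)
      (E := fun x : N ↦ (TangentSpace J x →L[ℝ] ℝ)) x (η x)) hη hj
  have h5 : ContMDiffOn 𝓘(ℝ, V) (J.prod 𝓘(ℝ, ℝ)) ∞
      (fun p ↦ Bundle.TotalSpace.mk' ℝ (E := Bundle.Trivial N ℝ) (j p)
        (η (j p) (mfderivWithin 𝓘(ℝ, V) J j s p e))) s :=
    ContMDiffOn.clm_bundle_apply (F₁ := E) (E₁ := fun x : N ↦ TangentSpace J x) h4 h3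
  rw [← contMDiffOn_iff_contDiffOn]
  refine ContMDiffOn.congr (f := fun p ↦ η (j p) (mfderivWithin 𝓘(ℝ, V) J j s p e)) ?_ ?_
  · intro p hp
    have := h5 p hp
    simp only [Bundle.contMDiffWithinAt_totalSpace] at this
    exact this.2
  · intro p hp
    rw [mfderivWithin_of_isOpen hs hp]
    rfl

end Coordinates

/-! ### The fibres of a deformation -/

open LieGroupoid

section Fibres

variable {E N : Type*} [NormedAddCommGroup E] [NormedSpace ℝ E] [FiniteDimensional ℝ E]
  [TopologicalSpace N] [ChartedSpace E N] [IsManifold 𝓘(ℝ, E) ∞ N]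
  {I : TopologicalSpace.Opens ℝ} (h0 : (0 : ℝ) ∈ I)

open Classical in
/-- A retraction of the real line onto `I`. -/
noncomputable def retract (h0 : (0 : ℝ) ∈ I) (t : ℝ) : I := if h : t ∈ I then ⟨t, h⟩ else ⟨0, h0⟩

theorem retract_of_mem {t : ℝ} (ht : t ∈ I) : retract h0 t = ⟨t, ht⟩ := dif_pos ht

theorem contMDiffAt_retract {t : ℝ} (ht : t ∈ I) :
    ContMDiffAt 𝓘(ℝ, ℝ) 𝓘(ℝ, ℝ) ∞ (retract h0) t := by
  refine (ContMDiffAt.subtypeVal_comp_iff I (retract h0) t).1 (contMDiffAt_id.congr_of_eventuallyEq ?_)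
  filter_upwards [I.isOpen.mem_nhds ht] with s hs
  rw [Function.comp_apply, retract_of_mem h0 hs]
  rfl

/-- The family of 1-forms on the fibres of `N × I`. -/
noncomputable def fibreForm (α' : Form1 (𝓘(ℝ, E).prod 𝓘(ℝ, ℝ)) (N × I)) (t : ℝ) (x : N) :
    E →L[ℝ] ℝ :=
  Form1.pullback (I := 𝓘(ℝ, E)) (incl N (retract h0 t)) α' x

/-- In coordinates the family is the pullback of α' along (t, y) ↦ (y, t), evaluated on the spatial
vectors (0, e), on which j and the fibre inclusion have the same derivative. -/
theorem isSmoothFormFamily_fibreForm {α' : Form1 (𝓘(ℝ, E).prod 𝓘(ℝ, ℝ)) (N × I)}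
    (hα' : Form1.IsSmooth α') : IsSmoothFormFamily (fibreForm h0 α') (I : Set ℝ) := by
  intro x₀
  set s := (I : Set ℝ) ×ˢ (extChartAt 𝓘(ℝ, E) x₀).target with hs
  set j : ℝ × E → N × I := fun p ↦ ((extChartAt 𝓘(ℝ, E) x₀).symm p.2, retract h0 p.1) with hj
  have hso : IsOpen s := I.isOpen.prod (isOpen_extChartAt_target x₀)
  have hjs : ContMDiffOn 𝓘(ℝ, ℝ × E) (𝓘(ℝ, E).prod 𝓘(ℝ, ℝ)) ∞ j s := by
    rintro ⟨t, y⟩ ⟨ht, hy⟩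
    have h1 : ContMDiffAt 𝓘(ℝ, E) 𝓘(ℝ, E) ∞ (extChartAt 𝓘(ℝ, E) x₀).symm y :=
      (contMDiffOn_extChartAt_symm x₀).contMDiffAt ((isOpen_extChartAt_target x₀).mem_nhds hy)
    exact (ContMDiffAt.prodMk
      (ContMDiffAt.comp (g := (extChartAt 𝓘(ℝ, E) x₀).symm) (t, y) h1
        contDiff_snd.contMDiff.contMDiffAt)
      (ContMDiffAt.comp (g := retract h0) (t, y) (contMDiffAt_retract h0 ht)
        contDiff_fst.contMDiff.contMDiffAt)).contMDiffWithinAt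
  refine contDiffOn_clm_apply.2 fun e ↦ ?_
  refine (hα'.contDiffOn_pullback_apply hso hjs (0, e)).congr ?_
  rintro ⟨t, y⟩ ⟨ht, hy⟩
  have d1 := hasD_of_contMDiffAt (hjs.contMDiffAt (hso.mem_nhds ⟨ht, hy⟩)) (by simp)
  have d2 : HasD 𝓘(ℝ, E) 𝓘(ℝ, ℝ × E) (fun y : E ↦ (t, y)) y (ContinuousLinearMap.inr ℝ ℝ E) :=
    hasD_iff_hasFDerivAt.2 ((hasFDerivAt_const t y).prodMk (hasFDerivAt_id y))
  have d3 : HasD 𝓘(ℝ, E) (𝓘(ℝ, E).prod 𝓘(ℝ, ℝ)) (incl N (retract h0 t))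
      ((extChartAt 𝓘(ℝ, E) x₀).symm y) _ :=
    hasD_of_contMDiffAt (n := ∞) (contMDiffAt_id.prodMk contMDiffAt_const) (by simp)
  have h := DFunLike.congr_fun ((d1.comp d2 rfl).unique (d3.comp (hasD_chart_symm hy) rfl)) e
  exact congrArg (α' (j (t, y))) h.symm

end Fibres

/-! ### From the Gray evolution to an automorphism of the constant deformation -/

section Deformation

variable {EG EM G M : Type*}
  [NormedAddCommGroup EG] [NormedSpace ℝ EG] [FiniteDimensional ℝ EG]
  [NormedAddCommGroup EM] [NormedSpace ℝ EM]
  [TopologicalSpace G] [ChartedSpace EG G] [IsManifold 𝓘(ℝ, EG) ∞ G]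
  [TopologicalSpace M] [ChartedSpace EM M]
  {𝒢 : LieGroupoid 𝓘(ℝ, EG) 𝓘(ℝ, EM) G M}

omit [FiniteDimensional ℝ EG] in
theorem LieGroupoid.IsCoOrientedContact.isContactMult {a : G → EG →L[ℝ] ℝ} {σ : G → ℝ}
    (h : 𝒢.IsCoOrientedContact (IG := 𝓘(ℝ, EG)) a σ) (ha : IsSmoothForm a)
    (hσ : ∀ g, σ g = 1 ∨ σ g = -1) : 𝒢.IsContactMult a σ where
  smooth := ha
  contactPair g :=
    { swap := dform_swap a g
      ne_zero := by
        obtain ⟨v, hv⟩ := h.isContact.surjective g 1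
        exact ⟨v, (ne_of_eq_of_ne hv one_ne_zero)⟩
      nondegenerate := fun v hv hw ↦ h.isContact.nondegenerate g v hv fun w hw' ↦
        (form_d_eq_dform ha g v w).trans (hw w hw') }
  mult := h.isMultiplicative
  continuous_char := h.isCharacter.smooth.continuous
  char_eq := hσ
  char_mul := h.isCharacter.map_mul

variable [FiniteDimensional ℝ EM] [IsManifold 𝓘(ℝ, EM) ∞ M] [T2Space G] [CompactSpace G]
  {A : ℝ → G → EG →L[ℝ] ℝ} {σ : G → ℝ} {I : TopologicalSpace.Opens ℝ} {X : ℝ → G → EG}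
  {ev : ℝ → ℝ → G → G}

omit [FiniteDimensional ℝ EM] [IsManifold 𝓘(ℝ, EM) ∞ M] in
theorem LieGroupoid.IsGrayEvolution.contMDiffAt (h : 𝒢.IsGrayEvolution A σ I X ev) {s t : ℝ}
    (hs : s ∈ I) (ht : t ∈ I) (g : G) : ContMDiffAt (𝓘(ℝ, ℝ × ℝ).prod 𝓘(ℝ, EG)) 𝓘(ℝ, EG) ∞
      (fun p : (ℝ × ℝ) × G ↦ ev p.1.1 p.1.2 p.2) ((t, s), g) := by
  have : CompleteSpace EG := FiniteDimensional.complete ℝ EG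
  exact (h.isEvolution.contMDiffOn h.isSmoothField h.isOpen h.ordConnected).contMDiffAt
    (((h.isOpen.prod h.isOpen).prod isOpen_univ).mem_nhds ⟨⟨ht, hs⟩, mem_univ _⟩)

omit [FiniteDimensional ℝ EM] [IsManifold 𝓘(ℝ, EM) ∞ M] [CompactSpace G] in
theorem LieGroupoid.IsGrayEvolution.comp_eq (h : 𝒢.IsGrayEvolution A σ I X ev) {s t : ℝ}
    (hs : s ∈ I) (ht : t ∈ I) (g : G) : ev s t (ev t s g) = g := by
  rw [h.isEvolution.comp h.isSmoothField h.isOpen h.ordConnected hs ht hs, h.isEvolution.self s hs]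

omit [FiniteDimensional ℝ EM] [IsManifold 𝓘(ℝ, EM) ∞ M] in
theorem LieGroupoid.IsGrayEvolution.contMDiff_left (h : 𝒢.IsGrayEvolution A σ I X ev)
    (h0 : (0 : ℝ) ∈ I) : ContMDiff (𝓘(ℝ, EG).prod 𝓘(ℝ, ℝ)) 𝓘(ℝ, EG) ∞
      (fun p : G × I ↦ ev p.2 0 p.1) := fun p ↦ by
  have hv : ContMDiff (𝓘(ℝ, EG).prod 𝓘(ℝ, ℝ)) 𝓘(ℝ, ℝ) ∞ (fun p : G × I ↦ (p.2 : ℝ)) :=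
    contMDiff_subtype_val.comp contMDiff_snd
  exact ContMDiffAt.comp (g := fun p : (ℝ × ℝ) × G ↦ ev p.1.1 p.1.2 p.2) p
    (h.contMDiffAt h0 p.2.2 p.1)
    (((hv.prodMk_space contMDiff_const).prodMk contMDiff_fst).contMDiffAt)

omit [FiniteDimensional ℝ EM] [IsManifold 𝓘(ℝ, EM) ∞ M] in
theorem LieGroupoid.IsGrayEvolution.contMDiff_right (h : 𝒢.IsGrayEvolution A σ I X ev)
    (h0 : (0 : ℝ) ∈ I) : ContMDiff (𝓘(ℝ, EG).prod 𝓘(ℝ, ℝ)) 𝓘(ℝ, EG) ∞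
      (fun p : G × I ↦ ev 0 p.2 p.1) := fun p ↦ by
  have hv : ContMDiff (𝓘(ℝ, EG).prod 𝓘(ℝ, ℝ)) 𝓘(ℝ, ℝ) ∞ (fun p : G × I ↦ (p.2 : ℝ)) :=
    contMDiff_subtype_val.comp contMDiff_snd
  exact ContMDiffAt.comp (g := fun p : (ℝ × ℝ) × G ↦ ev p.1.1 p.1.2 p.2) p
    (h.contMDiffAt p.2.2 h0 p.1)
    (((contMDiff_const.prodMk_space hv).prodMk contMDiff_fst).contMDiffAt)

/-- The automorphism of the constant deformation given by Gray's isotopy. -/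
noncomputable def LieGroupoid.IsGrayEvolution.constAut (h : 𝒢.IsGrayEvolution A σ I X ev)
    (h0 : (0 : ℝ) ∈ I) : 𝒢.ConstAut I h0 where
  arrows :=
    { toFun := fun p ↦ (ev p.2 0 p.1, p.2)
      invFun := fun p ↦ (ev 0 p.2 p.1, p.2)
      left_inv := fun p ↦ Prod.ext (h.comp_eq h0 p.2.2 p.1) rfl
      right_inv := fun p ↦ Prod.ext (h.comp_eq p.2.2 h0 p.1) rfl
      contMDiff_toFun := (h.contMDiff_left h0).prodMk contMDiff_snd
      contMDiff_invFun := (h.contMDiff_right h0).prodMk contMDiff_snd }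
  -- The evolution preserves the units, so it induces the map x ↦ t(ev(1_x)) on M, with inverse
  -- induced by the reverse evolution.
  base :=
    { toFun := fun p ↦ (𝒢.tgt (ev p.2 0 (𝒢.unit p.1)), p.2)
      invFun := fun p ↦ (𝒢.tgt (ev 0 p.2 (𝒢.unit p.1)), p.2)
      left_inv := fun p ↦ Prod.ext (by
        have := h.unit_tgt h0 p.2.2 (𝒢.unit p.1)
        rw [𝒢.tgt_unit] at this
        simp only [this, h.comp_eq h0 p.2.2, 𝒢.tgt_unit]) rfl
      right_inv := fun p ↦ Prod.ext (by
        have := h.unit_tgt p.2.2 h0 (𝒢.unit p.1)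
        rw [𝒢.tgt_unit] at this
        simp only [this, h.comp_eq p.2.2 h0, 𝒢.tgt_unit]) rfl
      contMDiff_toFun := (𝒢.smooth_tgt.comp ((h.contMDiff_left h0).comp
        (𝒢.const I).smooth_unit)).prodMk contMDiff_snd
      contMDiff_invFun := (𝒢.smooth_tgt.comp ((h.contMDiff_right h0).comp
        (𝒢.const I).smooth_unit)).prodMk contMDiff_snd }
  map_src p := Prod.ext (by
    change 𝒢.src (ev p.2 0 p.1) = 𝒢.tgt (ev p.2 0 (𝒢.unit (𝒢.src p.1)))
    rw [← h.unit_src h0 p.2.2, 𝒢.tgt_unit]) rfl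
  map_tgt p := Prod.ext (by
    change 𝒢.tgt (ev p.2 0 p.1) = 𝒢.tgt (ev p.2 0 (𝒢.unit (𝒢.tgt p.1)))
    rw [← h.unit_tgt h0 p.2.2, 𝒢.tgt_unit]) rfl
  map_mul p q hpq := Prod.ext (by
    have h1 : 𝒢.src p.1 = 𝒢.tgt q.1 := congrArg Prod.fst hpq
    have h2 : p.2 = q.2 := congrArg (fun x : M × I ↦ x.2) hpq
    change ev p.2 0 (𝒢.mul p.1 q.1) = 𝒢.mul (ev p.2 0 p.1) (ev q.2 0 q.1)
    rw [← h2]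
    exact h.map_mul h0 p.2.2 h1) rfl
  snd_arrows p := rfl
  arrows_zero g := Prod.ext (h.isEvolution.self 0 h0 g) rfl

omit [FiniteDimensional ℝ EM] [IsManifold 𝓘(ℝ, EM) ∞ M] in
theorem LieGroupoid.IsGrayEvolution.isGrayIsotopy (h : 𝒢.IsGrayEvolution A σ I X ev)
    (h0 : (0 : ℝ) ∈ I) {R : ℝ → G → EG} (hR : ∀ t ∈ I, ∀ g, IsReebAt (A t) g (R t g)) :
    IsGrayIsotopy A R X I (fun t ↦ ev t 0) where
  isOpen := h.isOpen
  ordConnected := h.ordConnected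
  zero_mem := h0
  smooth_form := h.smooth_form
  contactPair t ht := (h.isContactMult t ht).contactPair
  isReeb := hR
  isGray := h.isGray
  smooth := by
    rintro ⟨t, g⟩ ⟨ht, -⟩
    exact (ContMDiffAt.comp (g := fun p : (ℝ × ℝ) × G ↦ ev p.1.1 p.1.2 p.2) (t, g)
      (h.contMDiffAt h0 ht g) ((contMDiffAt_fst.prodMk_space contMDiffAt_const).prodMk
        contMDiffAt_snd)).contMDiffWithinAt
  isSolAt t ht g := h.isEvolution.isSolAt 0 h0 t ht g
  zero := h.isEvolution.self 0 h0

end Deformation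

end ContactGpd

/-! ### The stability theorem -/

theorem theorem3p3
    {EG EM : Type*}
    [NormedAddCommGroup EG] [NormedSpace ℝ EG] [FiniteDimensional ℝ EG]
    [NormedAddCommGroup EM] [NormedSpace ℝ EM] [FiniteDimensional ℝ EM]
    {G M : Type*}
    [TopologicalSpace G] [ChartedSpace EG G] [IsManifold 𝓘(ℝ, EG) ∞ G] [T2Space G]
    [CompactSpace G]
    [TopologicalSpace M] [ChartedSpace EM M] [IsManifold 𝓘(ℝ, EM) ∞ M] [T2Space M]
    (𝒢 : ContactGpd.LieGroupoid 𝓘(ℝ, EG) 𝓘(ℝ, EM) G M)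
    (α : ContactGpd.Form1 𝓘(ℝ, EG) G) (σ : G → ℝ) (hσ : ∀ g, σ g = 1 ∨ σ g = -1)
    (hα : 𝒢.IsCoOrientedContact α σ)
    (I : TopologicalSpace.Opens ℝ) (hI : (I : Set ℝ).OrdConnected) (h0 : (0 : ℝ) ∈ I)
    (α' : ContactGpd.Form1 (𝓘(ℝ, EG).prod 𝓘(ℝ, ℝ)) (G × I))
    (hα' : 𝒢.IsDeformation α σ I h0 α' (σ ∘ Prod.fst)) :
    ∃ (Φ : 𝒢.ConstAut I h0)
      (f : C^∞⟮𝓘(ℝ, EM).prod 𝓘(ℝ, ℝ), M × I; 𝓘(ℝ, ℝ), ℝ⟯),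
      (𝒢.const I).ConstOnOrbits f ∧
      ∀ (τ : I) (g : G),
        ContactGpd.Form1.pullback (I := 𝓘(ℝ, EG)) (I' := 𝓘(ℝ, EG)) (Φ.at τ)
            (ContactGpd.Form1.pullback (ContactGpd.LieGroupoid.incl G τ) α') g =
          Real.exp (f (𝒢.tgt g, τ)) • α g := by
  open ContactGpd in
  have : CompleteSpace EG := FiniteDimensional.complete ℝ EG
  have hA := isSmoothFormFamily_fibreForm h0 hα'.smooth
  have hc : ∀ t ∈ I, 𝒢.IsContactMult (fibreForm h0 α' t) σ := fun t ht ↦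
    (hα'.fibre (retract h0 t)).isContactMult (hA.isSmoothForm ht) hσ
  have hX : ∀ t ∈ I, ∀ g, ∃ X, LieGroupoid.IsGrayAt (fibreForm h0 α' t)
      (timeDeriv (fibreForm h0 α') t) g X := fun t ht g ↦ ((hc t ht).contactPair g).exists_isGray _
  have hR : ∀ t ∈ I, ∀ g, ∃ R, LieGroupoid.IsReebAt (fibreForm h0 α' t) g R :=
    fun t ht g ↦ ((hc t ht).contactPair g).exists_isReeb
  -- Reeb and Gray vectors are unique over I, so a pointwise choice is already smooth there; the
  -- values outside I are arbitrary and never enter.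
  choose! X hX using hX
  choose! R hR using hR
  obtain ⟨ev, hev⟩ := exists_isEvolution (isSmoothField_of_isGray hA I.isOpen
    (fun t ht ↦ (hc t ht).contactPair) hX) I.isOpen hI
  have h : 𝒢.IsGrayEvolution (fibreForm h0 α') σ I X ev := ⟨I.isOpen, hI, hA, hc, hX, hev⟩
  have hiso := h.isGrayIsotopy h0 hR
  -- The function on M × I is the exponent restricted to the units.
  have hf : ContMDiff (𝓘(ℝ, EM).prod 𝓘(ℝ, ℝ)) 𝓘(ℝ, ℝ) ∞ (fun p : M × I ↦
      grayFactor (fibreForm h0 α') R (fun t ↦ ev t 0) p.2 (𝒢.unit p.1)) := fun p ↦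
    ContMDiffAt.comp (g := fun p : ℝ × G ↦
      grayFactor (fibreForm h0 α') R (fun t ↦ ev t 0) p.1 p.2) p
      (hiso.contMDiffOn_grayFactor.contMDiffAt
        ((I.isOpen.prod isOpen_univ).mem_nhds ⟨p.2.2, mem_univ _⟩))
      ((contMDiff_subtype_val.comp contMDiff_snd).prodMk
        (𝒢.smooth_unit.comp contMDiff_fst)).contMDiffAt
  refine ⟨h.constAut h0, ⟨_, hf⟩, ?_, fun τ g ↦ ContinuousLinearMap.ext fun u ↦ ?_⟩
  · rintro x _ ⟨p, rfl, rfl⟩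
    exact (h.grayFactor_tgt h0 hR p.2.2 p.1).trans (h.grayFactor_src h0 hR p.2.2 p.1).symm
  · have h1 := hiso.pullback_eq τ.2 g u
    rw [← h.grayFactor_tgt h0 hR τ.2 g] at h1
    have h2 : fibreForm h0 α' τ = Form1.pullback (I := 𝓘(ℝ, EG)) (LieGroupoid.incl G τ) α' := by
      unfold fibreForm
      rw [retract_of_mem h0 τ.2]
    have h3 : fibreForm h0 α' 0 = α := by
      rw [← hα'.form_zero]
      unfold fibreForm
      rw [retract_of_mem h0 h0]
    rw [h2, h3] at h1
    exact h1
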